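/- Let $M$ be a smooth manifold of dimension $n$, let $U\subseteq M\times\mathbb R$ be open and non-empty, and consider the system $$\dot x=g^0(x,t)+\sum_{i=1}^{m_u}f^i(x,t)\,u_i+\sum_{j=1}^{m_w}g^j(x,t)\,w_j,\qquad y=[h_1(x,t),\dots,h_p(x,t)],$$ with known inputs $u_i$, unknown inputs $w_j$, and $f^i,g^\alpha,h_l$ smooth on $U$. Here $\nabla$, Lie derivatives $\mathcal L$ (of functions and of covector fields) and Lie brackets are taken with respect to $x$; distributions, codistributions and spans are modules over the ring of smooth functions of $(x,t)$ on $U$; for a codistribution $\Omega$, $\mathcal L_X\Omega$ is the span of all $\mathcal L_X\omega$, $\omega\in\Omega$; and whenever an operator $\mathcal L_{X^0}$ with upper index $0$ occurs in a sum $\sum_{\beta=0}^{m_w}\mathcal L_{X^\beta}$ it is to be replaced by $\mathcal L_{X^0}+\partial/\partial t$. Assume that the system is in canonical form on $U$, i.e. the matrix $(\mathcal L_{g^i}h_l)_{l,i}$ ($1\le l\le p$, $1\le i\le m_w$) has rank $m_w$ at every point of $U$, and let $\widetilde h_1,\dots,\widetilde h_{m_w}$ be outputs chosen among $h_1,\dots,h_p$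 such that $(\mathcal L_{g^i}\widetilde h_j)_{i,j}$ is invertible at every point of $U$. Put $\mu^0_0=1$, $\mu^i_0=0$, $\mu^0_j=\partial_t\widetilde h_j+\mathcal L_{g^0}\widetilde h_j$, $\mu^i_j=\mathcal L_{g^i}\widetilde h_j$ ($i,j=1,\dots,m_w$), $\nu=\mu^{-1}$ (that is, $\sum_\gamma\mu^\alpha_\gamma\nu^\gamma_\beta=\delta^\alpha_\beta$), $\widehat g^\alpha=\sum_{\beta=0}^{m_w}\nu^\alpha_\beta g^\beta$. For a vector field $\phi$ let $[\phi]^\alpha=\sum_{\beta=0}^{m_w}\nu^\alpha_\beta[g^\beta,\phi]+\delta^\alpha_0\,\partial\phi/\partial t$, and let $[\phi]^{(\alpha_1,\dots,\alpha_k)}$ be the result of iterating this operation, first along $\alpha_1$ and last along $\alpha_k$. Define: * $\Omega^g_0=\mathrm{span}\{\nabla\widetilde h_1,\dots,\nabla\widetilde h_{m_w}\}$, $\Omega^g_{k+1}=\Omega^g_k+\sum_{\beta=0}^{m_w}\mathcal L_{g^\beta}\Omega^g_k$, and $s$ the smallest integer $\ge1$ with $\Omega^g_s=\Omega^g_{s-1}$;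 * $\Delta_0=\mathrm{span}\{f^1,\dots,f^{m_u}\}$, $\Delta_{k+1}=\Delta_k+\sum_{\beta=0}^{m_w}\mathrm{span}\{[v]^\beta: v\in\Delta_k\}$, and $r$ the smallest integer $\ge 0$ with $\Delta_{r+1}=\Delta_r$; * $\widetilde{\mathcal O}=\sum_{q=1}^{m_w}\sum_{j=0}^{s+r}\sum_{\alpha_1,\dots,\alpha_j=0}^{m_w}\sum_{i=1}^{m_u}\mathrm{span}\{\nabla\mathcal L_{[f^i]^{(\alpha_1,\dots,\alpha_j)}}\widetilde h_q\}$; * $\mathcal O_0=\widetilde{\mathcal O}+\mathrm{span}\{\nabla h_1,\dots,\nabla h_p\}$, $\mathcal O_{k+1}=\mathcal O_k+\sum_{i=1}^{m_u}\mathcal L_{f^i}\mathcal O_k+\sum_{\beta=0}^{m_w}\mathcal L_{\widehat g^\beta}\mathcal O_k$; * $\Omega_0=\mathrm{span}\{\nabla h_1,\dots,\nabla h_p\}$, $\Omega_{k+1}=\Omega_k+\sum_{i=1}^{m_u}\mathcal L_{f^i}\Omega_k+\sum_{\beta=0}^{m_w}\mathcal L_{\widehat g^\beta}\Omega_k+\sum_{q=1}^{m_w}\sum_{i=1}^{m_u}\sum_{\alpha_1,\dots,\alpha_k=0}^{m_w}\mathrm{span}\{\mathcal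 L_{[f^i]^{(\alpha_1,\dots,\alpha_k)}}\nabla\widetilde h_q\}$. Assume that each of the $\Omega^g_k$, $\Delta_k$, $\mathcal O_k$ has constant dimension on $U$. Then $s$ and $r$ exist; there is a smallest $k^*\ge1$ with $\mathcal O_{k^*}=\mathcal O_{k^*-1}$, it satisfies $k^*\le n-m_w+1$, and $\mathcal O_j=\mathcal O:=\mathcal O_{k^*}$ for all $j\ge k^*-1$. Moreover there exists $\widehat k$ such that $\mathcal O\subseteq\Omega_k$ for every $k\ge\widehat k$, and conversely $\Omega_k\subseteq\mathcal O$ for every $k$. Hence $\mathcal O=\sum_{k\ge0}\Omega_k$, the codistribution computed by the recursion $(\Omega_k)_k$ (the observability codistribution of the system). -/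

import Mathlib

open scoped Manifold ContDiff

/- Without this, instance search equips `ℝ` and `EuclideanSpace ℝ (Fin n)` with an unfolded copy of
their standard structure of charted space, which the lemmas of the library do not match. -/
attribute [-instance] TopCat.of.chartedSpace TopCat.of.hasGroupoid

noncomputable section

namespace UnknownInput

/-! Notation: `M` is a manifold of dimension `n`; a point `z = (x, t)` of `M × ℝ` consists of a state
`x` and a time `t`. Scalar, vector and covector fields depend on `(x, t)`; `∇`, Lie derivatives and
Lie brackets are taken with respect to the state `x`, with `t` as a parameter. -/

/-- Time-dependent scalar fields on `M`. -/
abbrev ScalarField (M : Type*) : Type _ := M × ℝ → ℝ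

/-- Time-dependent vector fields on the `n`-dimensional manifold `M`. -/
abbrev VecField (n : ℕ) (M : Type*) [TopologicalSpace M]
    [ChartedSpace (EuclideanSpace ℝ (Fin n)) M] : Type _ :=
  (z : M × ℝ) → TangentSpace (𝓡 n) z.1

/-- Time-dependent covector fields on the `n`-dimensional manifold `M`. -/
abbrev CovField (n : ℕ) (M : Type*) [TopologicalSpace M]
    [ChartedSpace (EuclideanSpace ℝ (Fin n)) M] : Type _ :=
  (z : M × ℝ) → (TangentSpace (𝓡 n) z.1 →L[ℝ] ℝ)

section Calculus

variable {n : ℕ} {M : Type*} [TopologicalSpace M] [ChartedSpace (EuclideanSpace ℝ (Fin n)) M]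

/-- `∇ h`, the differential of `h` with respect to the state. -/
def grad (h : ScalarField M) : CovField n M :=
  fun z => mfderiv (𝓡 n) 𝓘(ℝ, ℝ) (fun x => h (x, z.2)) z.1

/-- The Lie derivative of a scalar field, `L_X h = ∇h · X`. -/
def lieScalar (X : VecField n M) (h : ScalarField M) : ScalarField M :=
  fun z => grad h z (X z)

/-- The Lie bracket `[X, Y]`, given in coordinates by `(∂Y/∂x) X - (∂X/∂x) Y`. -/
def bracket (X Y : VecField n M) : VecField n M :=
  fun z => VectorField.mlieBracket (𝓡 n) (fun x => X (x, z.2)) (fun x => Y (x, z.2)) z.1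

/-- The expression at time `t`, in the chart around `x₀`, of a vector field. -/
def vecInChart (x₀ : M) (t : ℝ) (X : VecField n M) :
    EuclideanSpace ℝ (Fin n) → EuclideanSpace ℝ (Fin n) :=
  VectorField.mpullback 𝓘(ℝ, EuclideanSpace ℝ (Fin n)) (𝓡 n) (extChartAt (𝓡 n) x₀).symm
    (fun x => X (x, t))

/-- The expression at time `t`, in the chart around `x₀`, of a covector field. -/
def covInChart (x₀ : M) (t : ℝ) (θ : CovField n M) :
    EuclideanSpace ℝ (Fin n) → (EuclideanSpace ℝ (Fin n) →L[ℝ] ℝ) :=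
  fun y => (θ ((extChartAt (𝓡 n) x₀).symm y, t)).comp
    (mfderiv 𝓘(ℝ, EuclideanSpace ℝ (Fin n)) (𝓡 n) (extChartAt (𝓡 n) x₀).symm y)

/-- The Lie derivative of a covector field. In the coordinates around the point at hand it has
components `∑ i, (X^i ∂_i θ_j + θ_i ∂_j X^i)`. -/
def lieCov (X : VecField n M) (θ : CovField n M) : CovField n M :=
  fun z =>
    (fderiv ℝ (covInChart z.1 z.2 θ) (extChartAt (𝓡 n) z.1 z.1)
        (vecInChart z.1 z.2 X (extChartAt (𝓡 n) z.1 z.1))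
      + (covInChart z.1 z.2 θ (extChartAt (𝓡 n) z.1 z.1)).comp
        (fderiv ℝ (vecInChart z.1 z.2 X) (extChartAt (𝓡 n) z.1 z.1))).comp
      (mfderiv (𝓡 n) 𝓘(ℝ, EuclideanSpace ℝ (Fin n)) (extChartAt (𝓡 n) z.1) z.1)

/-- `∂h/∂t`. -/
def dtScalar (h : ScalarField M) : ScalarField M :=
  fun z => deriv (fun τ => h (z.1, τ)) z.2

/-- `∂X/∂t`, at a fixed state `x`, in the fixed vector space `T_x M`. -/
def dtVec (X : VecField n M) : VecField n M :=
  fun z => deriv (fun τ => (X (z.1, τ) : EuclideanSpace ℝ (Fin n))) z.2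

/-- `∂θ/∂t`, at a fixed state `x`, in the fixed vector space `T_x^* M`. -/
def dtCov (θ : CovField n M) : CovField n M :=
  fun z => deriv (fun τ => (θ (z.1, τ) : EuclideanSpace ℝ (Fin n) →L[ℝ] ℝ)) z.2

/-- A scalar field is smooth on `U ⊆ M × ℝ`. -/
def SmoothScalarOn (n : ℕ) {M : Type*} [TopologicalSpace M]
    [ChartedSpace (EuclideanSpace ℝ (Fin n)) M] (U : Set (M × ℝ)) (h : ScalarField M) : Prop :=
  ContMDiffOn ((𝓡 n).prod 𝓘(ℝ, ℝ)) 𝓘(ℝ, ℝ) ∞ h U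

/-- A vector field is smooth, jointly in state and time, on `U ⊆ M × ℝ`. -/
def SmoothVecOn [IsManifold (𝓡 n) ∞ M] (U : Set (M × ℝ)) (X : VecField n M) : Prop :=
  ContMDiffOn ((𝓡 n).prod 𝓘(ℝ, ℝ)) (𝓡 n).tangent ∞
    (fun z : M × ℝ => (⟨z.1, X z⟩ : TangentBundle (𝓡 n) M)) U

end Calculus

section Spans

variable {n : ℕ} {M : Type*} [TopologicalSpace M] [ChartedSpace (EuclideanSpace ℝ (Fin n)) M]

/-- The ring of the scalar fields that are smooth on `U`. -/
def smoothRing (n : ℕ) {M : Type*} [TopologicalSpace M]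
    [ChartedSpace (EuclideanSpace ℝ (Fin n)) M] (U : Set (M × ℝ)) : Subring (M × ℝ → ℝ) where
  carrier := {c | SmoothScalarOn n U c}
  mul_mem' ha hb := ContMDiffOn.mul ha hb
  one_mem' := contMDiffOn_const
  add_mem' ha hb := ContMDiffOn.add ha hb
  zero_mem' := contMDiffOn_const
  neg_mem' ha := ContMDiffOn.neg ha

/-- A distribution on `U`: a module of vector fields over the functions smooth on `U`. -/
abbrev Dist (n : ℕ) {M : Type*} [TopologicalSpace M]
    [ChartedSpace (EuclideanSpace ℝ (Fin n)) M] (U : Set (M × ℝ)) : Type _ :=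
  Submodule (smoothRing n U) (VecField n M)

/-- A codistribution on `U`: a module of covector fields over the functions smooth on `U`. -/
abbrev Codist (n : ℕ) {M : Type*} [TopologicalSpace M]
    [ChartedSpace (EuclideanSpace ℝ (Fin n)) M] (U : Set (M × ℝ)) : Type _ :=
  Submodule (smoothRing n U) (CovField n M)

/-- The span of a set of vector fields on `U`. Fields are total functions here, of which only the
restriction to `U` matters; therefore the fields that vanish on `U` are adjoined, so that membership
in a span, and equality of spans, depend on nothing outside `U`. -/
def vecSpan (U : Set (M × ℝ)) (A : Set (VecField n M)) : Dist n U :=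
  Submodule.span (smoothRing n U) (A ∪ {X | ∀ z ∈ U, X z = 0})

/-- The span of a set of covector fields on `U`, with the same convention as for `vecSpan`. -/
def covSpan (U : Set (M × ℝ)) (A : Set (CovField n M)) : Codist n U :=
  Submodule.span (smoothRing n U) (A ∪ {θ | ∀ z ∈ U, θ z = 0})

/-- The dimension of a distribution at the point `z`. -/
def distDim {U : Set (M × ℝ)} (D : Dist n U) (z : M × ℝ) : ℕ :=
  Module.finrank ℝ (Submodule.span ℝ ((fun X : VecField n M => X z) '' (D : Set (VecField n M))))

/-- The dimension of a codistribution at the point `z`. -/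
def codistDim {U : Set (M × ℝ)} (W : Codist n U) (z : M × ℝ) : ℕ :=
  Module.finrank ℝ (Submodule.span ℝ ((fun θ : CovField n M => θ z) '' (W : Set (CovField n M))))

/-- `L_X W`, the span of all `L_X θ` with `θ ∈ W`. -/
def lieCodist {U : Set (M × ℝ)} (X : VecField n M) (W : Codist n U) : Codist n U :=
  covSpan U ((fun θ => lieCov X θ) '' (W : Set (CovField n M)))

/-- `(L_X + ∂/∂t) W`, the span of all `L_X θ + ∂θ/∂t` with `θ ∈ W`. -/
def lieDtCodist {U : Set (M × ℝ)} (X : VecField n M) (W : Codist n U) : Codist n U :=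
  covSpan U ((fun θ => lieCov X θ + dtCov θ) '' (W : Set (CovField n M)))

/-- The sum over `β = 0, …, m_w` of the codistributions `L_{X^β} W`, where for `β = 0` the operator
`L_{X^0}` is replaced by `L_{X^0} + ∂/∂t`. -/
def lieCodistSum {U : Set (M × ℝ)} {mw : ℕ} (X : Fin (mw + 1) → VecField n M) (W : Codist n U) :
    Codist n U :=
  lieDtCodist (X 0) W ⊔ ⨆ j : Fin mw, lieCodist (X j.succ) W

end Spans

/-- The data of the system
`ẋ = g^0(x,t) + ∑ f^i(x,t) u_i + ∑ g^j(x,t) w_j`, `y = (h_1(x,t), …, h_p(x,t))`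
with `mu` known inputs `u_i` and `mw` unknown inputs `w_j`; the drift is `g 0`. -/
structure System (n mu mw p : ℕ) (M : Type*) [TopologicalSpace M]
    [ChartedSpace (EuclideanSpace ℝ (Fin n)) M] where
  g : Fin (mw + 1) → VecField n M
  f : Fin mu → VecField n M
  h : Fin p → ScalarField M

namespace System

variable {n mu mw p : ℕ} {M : Type*} [TopologicalSpace M]
  [ChartedSpace (EuclideanSpace ℝ (Fin n)) M]

/-- All the vector fields and all the outputs of the system are smooth on `U`. -/
def SmoothOn [IsManifold (𝓡 n) ∞ M] (S : System n mu mw p M) (U : Set (M × ℝ)) : Prop :=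
  (∀ α, SmoothVecOn U (S.g α)) ∧ (∀ i, SmoothVecOn U (S.f i)) ∧ ∀ j, SmoothScalarOn n U (S.h j)

/-- The unknown input reconstructability matrix from the functions `lam 0, …, lam (k-1)`. -/
def reconstructabilityMatrix (S : System n mu mw p M) {k : ℕ} (lam : Fin k → ScalarField M)
    (z : M × ℝ) : Matrix (Fin k) (Fin mw) ℝ :=
  Matrix.of fun j i => lieScalar (S.g i.succ) (lam j) z

/-- The system is in canonical form with respect to its unknown inputs on `U`: there, the unknown
input degree of reconstructability from the outputs is `mw`. -/
def InCanonicalFormOn (S : System n mu mw p M) (U : Set (M × ℝ)) : Prop :=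
  ∀ z ∈ U, (S.reconstructabilityMatrix S.h z).rank = mw

/-- The `mw` functions selected from the outputs by `σ`. -/
def htilde (S : System n mu mw p M) (σ : Fin mw → Fin p) (q : Fin mw) : ScalarField M :=
  S.h (σ q)

/-- The tensor `μ`; the entry `(α, γ)` is `μ^α_γ`. -/
def muTensor (S : System n mu mw p M) (σ : Fin mw → Fin p) (z : M × ℝ) :
    Matrix (Fin (mw + 1)) (Fin (mw + 1)) ℝ :=
  Matrix.of fun α γ =>
    Fin.cases (motive := fun _ => ℝ)
      (if α = 0 then 1 else 0)
      (fun j => (if α = 0 then dtScalar (S.htilde σ j) z else 0)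
        + lieScalar (S.g α) (S.htilde σ j) z)
      γ

/-- The tensor `ν`, inverse of `μ`; the entry `(α, β)` is `ν^α_β`. -/
def nuTensor (S : System n mu mw p M) (σ : Fin mw → Fin p) (z : M × ℝ) :
    Matrix (Fin (mw + 1)) (Fin (mw + 1)) ℝ :=
  (S.muTensor σ z)⁻¹

/-- The vector fields `ĝ^α = ν^α_β g^β`. -/
def ghat (S : System n mu mw p M) (σ : Fin mw → Fin p) (α : Fin (mw + 1)) : VecField n M :=
  fun z => ∑ β, S.nuTensor σ z α β • S.g β z

/-- The autobracket `[φ]^α = ν^α_β [g^β, φ] + δ^α_0 ∂φ/∂t`. -/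
def autobracket (S : System n mu mw p M) (σ : Fin mw → Fin p) (φ : VecField n M)
    (α : Fin (mw + 1)) : VecField n M :=
  fun z => (∑ β, S.nuTensor σ z α β • bracket (S.g β) φ z) + if α = 0 then dtVec φ z else 0

/-- The iterated autobracket `[φ]^(α₁,…,α_m)`, first along `α₁`, last along `α_m`. -/
def autobracketIter (S : System n mu mw p M) (σ : Fin mw → Fin p) (φ : VecField n M)
    (l : List (Fin (mw + 1))) : VecField n M :=
  l.foldl (S.autobracket σ) φ

/-- The codistributions `Ω^g_k`. -/
def OmegaG (S : System n mu mw p M) (U : Set (M × ℝ)) (σ : Fin mw → Fin p) : ℕ → Codist n U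
  | 0 => covSpan U (Set.range fun j => grad (S.htilde σ j))
  | k + 1 => OmegaG S U σ k ⊔ lieCodistSum S.g (OmegaG S U σ k)

/-- `[D]^β`, the span of all `[v]^β` with `v ∈ D`. -/
def autobracketDist (S : System n mu mw p M) {U : Set (M × ℝ)} (σ : Fin mw → Fin p) (D : Dist n U)
    (β : Fin (mw + 1)) : Dist n U :=
  vecSpan U ((fun v => S.autobracket σ v β) '' (D : Set (VecField n M)))

/-- The distributions `Δ_k`. -/
def Delta (S : System n mu mw p M) (U : Set (M × ℝ)) (σ : Fin mw → Fin p) : ℕ → Dist n U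
  | 0 => vecSpan U (Set.range S.f)
  | k + 1 => Delta S U σ k ⊔ ⨆ β, S.autobracketDist σ (Delta S U σ k) β

/-- The smallest integer `s` such that `Ω^g_s = Ω^g_{s-1}`. -/
def sIndex (S : System n mu mw p M) (U : Set (M × ℝ)) (σ : Fin mw → Fin p) : ℕ :=
  sInf {s | 1 ≤ s ∧ S.OmegaG U σ s = S.OmegaG U σ (s - 1)}

/-- The smallest integer `r` such that `Δ_{r+1} = Δ_r`. -/
def rIndex (S : System n mu mw p M) (U : Set (M × ℝ)) (σ : Fin mw → Fin p) : ℕ :=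
  sInf {r | S.Delta U σ (r + 1) = S.Delta U σ r}

/-- The codistribution `Õ`, spanned by the differentials of the Lie derivatives of the functions
`h̃_q` along the iterated autobrackets of the `f^i` of order up to `s + r`. -/
def Otilde (S : System n mu mw p M) (U : Set (M × ℝ)) (σ : Fin mw → Fin p) : Codist n U :=
  covSpan U {θ | ∃ (q : Fin mw) (i : Fin mu) (l : List (Fin (mw + 1))),
    l.length ≤ S.sIndex U σ + S.rIndex U σ ∧
      θ = grad (lieScalar (S.autobracketIter σ (S.f i) l) (S.htilde σ q))}

/-- The codistributions `O_k` of the new algorithm. -/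
def Obs (S : System n mu mw p M) (U : Set (M × ℝ)) (σ : Fin mw → Fin p) : ℕ → Codist n U
  | 0 => S.Otilde U σ ⊔ covSpan U (Set.range fun j => grad (S.h j))
  | k + 1 => Obs S U σ k ⊔ (⨆ i, lieCodist (S.f i) (Obs S U σ k))
      ⊔ lieCodistSum (S.ghat σ) (Obs S U σ k)

/-- The step at which the new algorithm stops: the smallest `k` such that `O_k = O_{k-1}`. -/
def convStep (S : System n mu mw p M) (U : Set (M × ℝ)) (σ : Fin mw → Fin p) : ℕ :=
  sInf {k | 1 ≤ k ∧ S.Obs U σ k = S.Obs U σ (k - 1)}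

/-- The codistribution `O` returned by the new algorithm. -/
def ObsLimit (S : System n mu mw p M) (U : Set (M × ℝ)) (σ : Fin mw → Fin p) : Codist n U :=
  S.Obs U σ (S.convStep U σ)

/-- The codistributions `Ω_k` of the known algorithm, whose recursive step adds autobrackets of
ever higher order and which therefore has no evident stopping criterion. -/
def Omega (S : System n mu mw p M) (U : Set (M × ℝ)) (σ : Fin mw → Fin p) : ℕ → Codist n U
  | 0 => covSpan U (Set.range fun j => grad (S.h j))
  | k + 1 => Omega S U σ k ⊔ (⨆ i, lieCodist (S.f i) (Omega S U σ k))
      ⊔ lieCodistSum (S.ghat σ) (Omega S U σ k)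
      ⊔ covSpan U {θ | ∃ (q : Fin mw) (i : Fin mu) (l : List (Fin (mw + 1))),
          l.length = k ∧ θ = lieCov (S.autobracketIter σ (S.f i) l) (grad (S.htilde σ q))}

/-- Each of the distributions and codistributions built by the algorithms that are run up to their
convergence has the same dimension at all the points of `U`. -/
structure ConstantDimensions (S : System n mu mw p M) (U : Set (M × ℝ)) (σ : Fin mw → Fin p) :
    Prop where
  omegaG : ∀ k, ∃ d, ∀ z ∈ U, codistDim (S.OmegaG U σ k) z = d
  delta : ∀ k, ∃ d, ∀ z ∈ U, distDim (S.Delta U σ k) z = d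
  obs : ∀ k, ∃ d, ∀ z ∈ U, codistDim (S.Obs U σ k) z = d

end System

end UnknownInput

end

/-! Write X_w for the autobracket of some f^i iterated along the word w, and θ_v for the covector
obtained from some ∇h̃_q by iterating along v the dual operation θ ↦ ∑ ν^α_β L_{g^β} θ (with L_{g^0}
+ ∂/∂t at β = 0). Let D_α be L_{ĝ^α} + δ^α_0 ∂/∂t on functions. The Leibniz rule gives D_α⟨θ_v, X_w⟩
= ⟨θ_{vα}, X_w⟩ + ⟨θ_v, X_{wα}⟩ (`Regular.evolScalar_pairIter`). For empty v the pairing is L_{X_w}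
h̃_q, whose differential is what the recursion of Ω adds. So Ω_k ⊆ O follows once every pairing has
its differential in O (is "observable"); the initialization of O grants this for empty v and |w| ≤ s
+ r.

Since O is invariant under the D_α, as soon as ⟨θ_v, X_w⟩ is observable, ⟨θ_{vα}, X_w⟩ and ⟨θ_v,
X_{wα}⟩ are observable together (`Regular.pairIter_shift`). This settles all total orders |v| + |w|
≤ s + r. It also shows that, once the orders up to N are settled, order N + 1 needs only one
distribution of lengths between the two words.

For N ≥ s + r take |w| = r + 1 and |v| = N - r ≥ s. Pointwise, X_w is a combination of the X_a with
|a| ≤ r, and θ_v of the θ_b with |b| ≤ s - 1, because Δ and Ω^g are stationary from there on. Hence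
bordering P = (⟨θ_b, X_a⟩) by the row R = (⟨θ_b, X_w⟩), the column C = (⟨θ_v, X_a⟩) and the corner Q
= ⟨θ_v, X_w⟩ does not raise its rank. Near a point where the rank of P is locally maximal, Q is
therefore a rational function of the entries of P, R and C, all of order at most N, so ∇Q lies in O
there. The rank of P may drop elsewhere, but such points are dense, and the constant dimension of O
makes the condition closed (`frequently_covAt_grad_mem`,
`Regular.pairIter_observable_of_length_eq`).

Constant dimension also turns pointwise statements into statements on modules over the smooth
functions. The coefficients of minimal norm are unique and smooth, so local choices agree and
nothing has to be glued (`exists_contDiffAt_coeff`, `exists_smooth_coeff`). Since L_X ∇h = ∇ L_X h,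
the codistributions Ω^g_k and O_k are generated by finitely many differentials, and each chain stops
as soon as its dimension does; dim O_0 ≥ m_w yields the bound on k^*. The inclusion of O in Ω_k is
easy: the generators of O_0 have all entered by step s + r + 1, and the recursion of Ω contains that
of O. -/

noncomputable section

namespace UnknownInput

open Set Filter Topology

/-! ### Space-time charts and the coordinate form of fields -/

section Charts

variable {n : ℕ} {M : Type*} [TopologicalSpace M] [ChartedSpace (EuclideanSpace ℝ (Fin n)) M]

/-- The chart around `x₀`, extended to space-time. -/
def toChart (x₀ : M) (z : M × ℝ) : EuclideanSpace ℝ (Fin n) × ℝ :=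
  (extChartAt (𝓡 n) x₀ z.1, z.2)

/-- The inverse of the chart around `x₀`, extended to space-time. -/
def ofChart (x₀ : M) (p : EuclideanSpace ℝ (Fin n) × ℝ) : M × ℝ :=
  ((extChartAt (𝓡 n) x₀).symm p.1, p.2)

/-- The part of `U` in the chart around `x₀`, in coordinates. -/
def chartDom (x₀ : M) (U : Set (M × ℝ)) : Set (EuclideanSpace ℝ (Fin n) × ℝ) :=
  {p | p.1 ∈ (extChartAt (𝓡 n) x₀).target ∧ ofChart x₀ p ∈ U}

/-- The derivative of the chart around `x₀`. -/
def chartJac (x₀ x : M) : EuclideanSpace ℝ (Fin n) →L[ℝ] EuclideanSpace ℝ (Fin n) :=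
  mfderiv (𝓡 n) 𝓘(ℝ, EuclideanSpace ℝ (Fin n)) (extChartAt (𝓡 n) x₀) x

/-- The derivative of the inverse of the chart around `x₀`. -/
def chartInvJac (x₀ : M) (y : EuclideanSpace ℝ (Fin n)) :
    EuclideanSpace ℝ (Fin n) →L[ℝ] EuclideanSpace ℝ (Fin n) :=
  mfderiv 𝓘(ℝ, EuclideanSpace ℝ (Fin n)) (𝓡 n) (extChartAt (𝓡 n) x₀).symm y

/-- A vector field in the coordinates around `x₀`, as a function of state and time. -/
def vecRep (x₀ : M) (X : VecField n M) (p : EuclideanSpace ℝ (Fin n) × ℝ) :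
    EuclideanSpace ℝ (Fin n) :=
  vecInChart x₀ p.2 X p.1

/-- A covector field in the coordinates around `x₀`, as a function of state and time. -/
def covRep (x₀ : M) (θ : CovField n M) (p : EuclideanSpace ℝ (Fin n) × ℝ) :
    EuclideanSpace ℝ (Fin n) →L[ℝ] ℝ :=
  covInChart x₀ p.2 θ p.1

/-- The value of a vector field, in the model space. -/
def vecAt (X : VecField n M) (z : M × ℝ) : EuclideanSpace ℝ (Fin n) := X z

/-- The value of a covector field, in the dual of the model space. -/
def covAt (θ : CovField n M) (z : M × ℝ) : EuclideanSpace ℝ (Fin n) →L[ℝ] ℝ := θ z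

/-- The pairing of a covector field with a vector field. -/
def pairing (θ : CovField n M) (X : VecField n M) : ScalarField M := fun z => θ z (X z)

theorem ofChart_toChart (z : M × ℝ) : ofChart z.1 (toChart (n := n) z.1 z) = z := by
  simp [ofChart, toChart]

theorem ofChart_toChart' {x₀ : M} {z : M × ℝ} (hz : z.1 ∈ (extChartAt (𝓡 n) x₀).source) :
    ofChart x₀ (toChart (n := n) x₀ z) = z := by
  simp only [ofChart, toChart, (extChartAt (𝓡 n) x₀).left_inv hz]

theorem toChart_mem_chartDom {U : Set (M × ℝ)} {z : M × ℝ} (hz : z ∈ U) :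
    toChart (n := n) z.1 z ∈ chartDom z.1 U :=
  ⟨mem_extChartAt_target z.1, by rwa [ofChart_toChart]⟩

theorem isOpen_chartDom (x₀ : M) {U : Set (M × ℝ)} (hU : IsOpen U) :
    IsOpen (chartDom (n := n) x₀ U) := by
  have h : ContinuousOn (ofChart (n := n) x₀) (Prod.fst ⁻¹' (extChartAt (𝓡 n) x₀).target) :=
    ((continuousOn_extChartAt_symm x₀).comp continuousOn_fst fun p hp => hp).prodMk continuousOn_snd
  exact h.isOpen_inter_preimage ((isOpen_extChartAt_target x₀).preimage continuous_fst) hU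

theorem continuousAt_toChart (z : M × ℝ) : ContinuousAt (toChart (n := n) z.1) z :=
  ((continuousAt_extChartAt z.1).comp continuousAt_fst).prodMk continuousAt_snd

theorem vecRep_apply (x₀ : M) (X : VecField n M) (p : EuclideanSpace ℝ (Fin n) × ℝ) :
    vecRep x₀ X p = (chartInvJac x₀ p.1).inverse (vecAt X (ofChart x₀ p)) := rfl

theorem covRep_apply (x₀ : M) (θ : CovField n M) (p : EuclideanSpace ℝ (Fin n) × ℝ) :
    covRep x₀ θ p =
      (covAt θ (ofChart x₀ p)).comp (chartInvJac x₀ p.1) := rfl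

variable [IsManifold (𝓡 n) ∞ M]

theorem chartJac_comp_chartInvJac {x₀ : M} {y : EuclideanSpace ℝ (Fin n)}
    (hy : y ∈ (extChartAt (𝓡 n) x₀).target) :
    (chartJac x₀ ((extChartAt (𝓡 n) x₀).symm y)).comp (chartInvJac x₀ y) =
      ContinuousLinearMap.id ℝ _ := by
  have : IsManifold (𝓡 n) 1 M := IsManifold.of_le (n := ∞) (by norm_cast)
  have := mfderiv_extChartAt_comp_mfderivWithin_extChartAt_symm (I := 𝓡 n) hy
  rw [ModelWithCorners.range_eq_univ, mfderivWithin_univ] at this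
  exact this

theorem chartInvJac_comp_chartJac {x₀ : M} {y : EuclideanSpace ℝ (Fin n)}
    (hy : y ∈ (extChartAt (𝓡 n) x₀).target) :
    (chartInvJac x₀ y).comp (chartJac x₀ ((extChartAt (𝓡 n) x₀).symm y)) =
      ContinuousLinearMap.id ℝ _ := by
  have : IsManifold (𝓡 n) 1 M := IsManifold.of_le (n := ∞) (by norm_cast)
  have := mfderivWithin_extChartAt_symm_comp_mfderiv_extChartAt (I := 𝓡 n) hy
  rw [ModelWithCorners.range_eq_univ, mfderivWithin_univ] at this
  exact this

theorem chartInvJac_inverse {x₀ : M} {y : EuclideanSpace ℝ (Fin n)}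
    (hy : y ∈ (extChartAt (𝓡 n) x₀).target) :
    (chartInvJac x₀ y).inverse = chartJac x₀ ((extChartAt (𝓡 n) x₀).symm y) :=
  ContinuousLinearMap.inverse_eq (chartInvJac_comp_chartJac hy) (chartJac_comp_chartInvJac hy)

/-- The definition of `vecRep` uses `ContinuousLinearMap.inverse`, which is 0 at non-invertible
maps. On the target of the chart it is a true inverse, namely the derivative of the chart. -/
theorem vecRep_of_mem {x₀ : M} (X : VecField n M) {p : EuclideanSpace ℝ (Fin n) × ℝ}
    (hp : p.1 ∈ (extChartAt (𝓡 n) x₀).target) :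
    vecRep x₀ X p = chartJac x₀ (ofChart x₀ p).1 (vecAt X (ofChart x₀ p)) := by
  rw [vecRep_apply, chartInvJac_inverse hp]; rfl

theorem covRep_vecRep {x₀ : M} (θ : CovField n M) (X : VecField n M)
    {p : EuclideanSpace ℝ (Fin n) × ℝ} (hp : p.1 ∈ (extChartAt (𝓡 n) x₀).target) :
    covRep x₀ θ p (vecRep x₀ X p) = pairing θ X (ofChart x₀ p) := by
  rw [vecRep_of_mem X hp, covRep_apply]
  have := congrArg (fun A => A (vecAt X (ofChart x₀ p))) (chartInvJac_comp_chartJac hp)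
  exact congrArg (covAt θ (ofChart x₀ p)) this

/-- Covectors are determined by their coordinates. -/
theorem eq_of_covRep_eq {θ θ' : CovField n M} {z : M × ℝ}
    (h : covRep z.1 θ (toChart z.1 z) = covRep z.1 θ' (toChart z.1 z)) : θ z = θ' z := by
  have hy : (toChart (n := n) z.1 z).1 ∈ (extChartAt (𝓡 n) z.1).target := mem_extChartAt_target z.1
  have e := chartInvJac_comp_chartJac hy
  have key : ∀ η : CovField n M, covAt η z = (covRep z.1 η (toChart z.1 z)).comp
      (chartJac z.1 ((extChartAt (𝓡 n) z.1).symm (toChart (n := n) z.1 z).1)) := fun η => by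
    rw [covRep_apply, ContinuousLinearMap.comp_assoc, e, ContinuousLinearMap.comp_id,
      ofChart_toChart]
  change covAt θ z = covAt θ' z
  rw [key θ, key θ', h]

/-- Vectors are determined by their coordinates. -/
theorem eq_of_vecRep_eq {X Y : VecField n M} {z : M × ℝ}
    (h : vecRep z.1 X (toChart z.1 z) = vecRep z.1 Y (toChart z.1 z)) : X z = Y z := by
  have hy : (toChart (n := n) z.1 z).1 ∈ (extChartAt (𝓡 n) z.1).target := mem_extChartAt_target z.1
  have e := chartInvJac_comp_chartJac hy
  have key : ∀ Y : VecField n M, vecAt Y z = chartInvJac z.1 (toChart (n := n) z.1 z).1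
      (vecRep z.1 Y (toChart z.1 z)) := fun Y => by
    rw [vecRep_of_mem Y hy]
    refine Eq.trans ?_ (congrArg (fun A => A (vecAt Y (ofChart z.1 (toChart (n := n) z.1 z)))) e).symm
    rw [ofChart_toChart, ContinuousLinearMap.id_apply]
  change vecAt X z = vecAt Y z
  rw [key X, key Y, h]

theorem contMDiffAt_ofChart {x₀ : M} {p : EuclideanSpace ℝ (Fin n) × ℝ}
    (hp : p.1 ∈ (extChartAt (𝓡 n) x₀).target) :
    ContMDiffAt 𝓘(ℝ, EuclideanSpace ℝ (Fin n) × ℝ) ((𝓡 n).prod 𝓘(ℝ, ℝ)) ∞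
      (ofChart (n := n) x₀) p := by
  have h1 : ContMDiffAt 𝓘(ℝ, EuclideanSpace ℝ (Fin n)) (𝓡 n) ∞ (extChartAt (𝓡 n) x₀).symm p.1 :=
    (contMDiffOn_extChartAt_symm x₀).contMDiffAt ((isOpen_extChartAt_target x₀).mem_nhds hp)
  exact (h1.comp p contDiffAt_fst.contMDiffAt).prodMk contDiffAt_snd.contMDiffAt

theorem contMDiffAt_toChart {x₀ : M} {z : M × ℝ} (hz : z.1 ∈ (extChartAt (𝓡 n) x₀).source) :
    ContMDiffAt ((𝓡 n).prod 𝓘(ℝ, ℝ)) 𝓘(ℝ, EuclideanSpace ℝ (Fin n) × ℝ) ∞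
      (toChart (n := n) x₀) z := by
  rw [extChartAt_source] at hz
  have h1 : ContMDiffAt (𝓡 n) 𝓘(ℝ, EuclideanSpace ℝ (Fin n)) ∞ (extChartAt (𝓡 n) x₀) z.1 :=
    contMDiffAt_extChartAt' hz
  exact (h1.comp z contMDiffAt_fst).prodMk_space contMDiffAt_snd

theorem SmoothScalarOn.contDiffOn {U : Set (M × ℝ)} (hU : IsOpen U) {h : ScalarField M}
    (hh : SmoothScalarOn n U h) (x₀ : M) :
    ContDiffOn ℝ ∞ (h ∘ ofChart (n := n) x₀) (chartDom x₀ U) := by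
  intro p hp
  have h1 : ContMDiffAt ((𝓡 n).prod 𝓘(ℝ, ℝ)) 𝓘(ℝ, ℝ) ∞ h (ofChart (n := n) x₀ p) :=
    ContMDiffOn.contMDiffAt hh (hU.mem_nhds hp.2)
  exact (h1.comp p (contMDiffAt_ofChart hp.1)).contDiffAt.contDiffWithinAt

/-- Smoothness of a map into a normed space can be checked in the charts. -/
theorem contMDiffAt_of_contDiffAt {F : Type*} [NormedAddCommGroup F] [NormedSpace ℝ F]
    {h : M × ℝ → F} {z : M × ℝ}
    (hh : ContDiffAt ℝ ∞ (h ∘ ofChart (n := n) z.1) (toChart z.1 z)) :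
    ContMDiffAt ((𝓡 n).prod 𝓘(ℝ, ℝ)) 𝓘(ℝ, F) ∞ h z := by
  have h1 := hh.contMDiffAt.comp z (contMDiffAt_toChart (n := n) (mem_extChartAt_source z.1))
  refine h1.congr_of_eventuallyEq ?_
  have : Prod.fst ⁻¹' (extChartAt (𝓡 n) z.1).source ∈ 𝓝 z :=
    continuousAt_fst (extChartAt_source_mem_nhds z.1)
  filter_upwards [this] with w hw
  simp only [Function.comp_apply, ofChart_toChart' hw]

theorem smoothScalarOn_of_contDiffAt {U : Set (M × ℝ)} {h : ScalarField M}
    (hh : ∀ z ∈ U, ContDiffAt ℝ ∞ (h ∘ ofChart (n := n) z.1) (toChart z.1 z)) :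
    SmoothScalarOn n U h :=
  fun z hz => (contMDiffAt_of_contDiffAt (hh z hz)).contMDiffWithinAt

/-- The bridge between smoothness of a section of the tangent bundle, which is read in
trivializations, and smoothness of its components in a chart. -/
theorem trivializationAt_snd {x₀ : M} {z : M × ℝ} (X : VecField n M)
    (hz : z.1 ∈ (chartAt (EuclideanSpace ℝ (Fin n)) x₀).source) :
    (trivializationAt (EuclideanSpace ℝ (Fin n)) (TangentSpace (𝓡 n)) x₀
      (⟨z.1, X z⟩ : TangentBundle (𝓡 n) M)).2 = chartJac x₀ z.1 (vecAt X z) := by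
  have : IsManifold (𝓡 n) 1 M := IsManifold.of_le (n := ∞) (by norm_cast)
  have := TangentBundle.continuousLinearMapAt_trivializationAt (I := 𝓡 n) (x₀ := x₀) (x := z.1) hz
  have h2 := congrArg (fun A => A (X z)) this
  refine Eq.trans ?_ h2
  rw [Bundle.Trivialization.continuousLinearMapAt_apply, Bundle.Trivialization.linearMapAt_apply,
    if_pos]
  exact hz

theorem SmoothVecOn.contDiffOn {U : Set (M × ℝ)} (hU : IsOpen U) {X : VecField n M}
    (hX : SmoothVecOn U X) (x₀ : M) :
    ContDiffOn ℝ ∞ (vecRep x₀ X) (chartDom x₀ U) := by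
  intro p hp
  have h1 : ContMDiffAt ((𝓡 n).prod 𝓘(ℝ, ℝ)) (𝓡 n).tangent ∞
      (fun z : M × ℝ => (⟨z.1, X z⟩ : TangentBundle (𝓡 n) M)) (ofChart (n := n) x₀ p) :=
    ContMDiffOn.contMDiffAt hX (hU.mem_nhds hp.2)
  have hsrc : (ofChart x₀ p).1 ∈ (chartAt (EuclideanSpace ℝ (Fin n)) x₀).source := by
    rw [← extChartAt_source (𝓡 n)]; exact (extChartAt (𝓡 n) x₀).map_target hp.1
  rw [Bundle.Trivialization.contMDiffAt_iff
    (e := trivializationAt (EuclideanSpace ℝ (Fin n)) (TangentSpace (𝓡 n)) x₀)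
    (by rw [Bundle.Trivialization.mem_source]; exact hsrc)] at h1
  have h2 := (h1.2.comp p (contMDiffAt_ofChart hp.1)).contDiffAt
  refine (h2.congr_of_eventuallyEq ?_).contDiffWithinAt
  filter_upwards [(isOpen_chartDom x₀ hU).mem_nhds hp] with q hq
  rw [vecRep_of_mem X hq.1]
  refine (trivializationAt_snd X ?_).symm
  rw [← extChartAt_source (𝓡 n)]; exact (extChartAt (𝓡 n) x₀).map_target hq.1

theorem smoothVecOn_of_contDiffAt {U : Set (M × ℝ)} {X : VecField n M}
    (hX : ∀ z ∈ U, ContDiffAt ℝ ∞ (vecRep z.1 X) (toChart z.1 z)) : SmoothVecOn U X := by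
  intro z hz
  refine ContMDiffAt.contMDiffWithinAt ?_
  rw [Bundle.Trivialization.contMDiffAt_iff
    (e := trivializationAt (EuclideanSpace ℝ (Fin n)) (TangentSpace (𝓡 n)) z.1)
    (by rw [Bundle.Trivialization.mem_source]; exact mem_chart_source _ z.1)]
  refine ⟨contMDiffAt_fst, ?_⟩
  refine contMDiffAt_of_contDiffAt ((hX z hz).congr_of_eventuallyEq ?_)
  have : Prod.fst ⁻¹' (extChartAt (𝓡 n) z.1).target ∈ 𝓝 (toChart (n := n) z.1 z) :=
    ((isOpen_extChartAt_target z.1).preimage continuous_fst).mem_nhds (mem_extChartAt_target z.1)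
  filter_upwards [this] with q hq
  rw [vecRep_of_mem X hq]
  refine trivializationAt_snd X ?_
  rw [← extChartAt_source (𝓡 n)]; exact (extChartAt (𝓡 n) z.1).map_target hq

end Charts

/-! ### Partial derivatives on a product with the time axis -/

section Partial

variable {E F : Type*} [NormedAddCommGroup E] [NormedSpace ℝ E] [NormedAddCommGroup F]
  [NormedSpace ℝ F]

theorem fderiv_slice {f : E × ℝ → F} {p : E × ℝ} (hf : DifferentiableAt ℝ f p) :
    fderiv ℝ (fun y => f (y, p.2)) p.1 = (fderiv ℝ f p).comp (ContinuousLinearMap.inl ℝ E ℝ) := by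
  have h : HasFDerivAt f (fderiv ℝ f p) (p.1, p.2) := hf.hasFDerivAt
  exact (h.comp p.1 (hasFDerivAt_prodMk_left p.1 p.2)).fderiv

theorem hasDerivAt_slice {f : E × ℝ → F} {p : E × ℝ} (hf : DifferentiableAt ℝ f p) :
    HasDerivAt (fun τ => f (p.1, τ)) (fderiv ℝ f p (0, 1)) p.2 := by
  have h : HasFDerivAt f (fderiv ℝ f p) (p.1, p.2) := hf.hasFDerivAt
  have := (h.comp p.2 (hasFDerivAt_prodMk_right p.1 p.2)).hasDerivAt
  rw [ContinuousLinearMap.comp_apply, ContinuousLinearMap.inr_apply] at this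
  exact this

end Partial

/-! ### Coordinate formulas for derivatives along `X + ε ∂/∂t` -/

section Calculus

variable {n : ℕ} {M : Type*} [TopologicalSpace M] [ChartedSpace (EuclideanSpace ℝ (Fin n)) M]

/-- The derivative of a scalar field along `X + ε ∂/∂t`. -/
def evolScalar (X : VecField n M) (ε : ℝ) (h : ScalarField M) : ScalarField M :=
  lieScalar X h + ε • dtScalar h

/-- The derivative of a vector field along `X + ε ∂/∂t`. -/
def evolVec (X : VecField n M) (ε : ℝ) (Y : VecField n M) : VecField n M :=
  bracket X Y + ε • dtVec Y

/-- The derivative of a covector field along `X + ε ∂/∂t`. -/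
def evolCov (X : VecField n M) (ε : ℝ) (θ : CovField n M) : CovField n M :=
  lieCov X θ + ε • dtCov θ

/-- A covector field is differentiable at `z`. -/
def CovDifferentiableAt (θ : CovField n M) (z : M × ℝ) : Prop :=
  DifferentiableAt ℝ (covRep z.1 θ) (toChart z.1 z)

theorem covRep_add (x₀ : M) (θ η : CovField n M) : covRep x₀ (θ + η) = covRep x₀ θ + covRep x₀ η :=
  rfl

theorem covRep_smul (x₀ : M) (c : M × ℝ → ℝ) (θ : CovField n M) :
    covRep x₀ (fun z => c z • θ z) = fun p => c (ofChart (n := n) x₀ p) • covRep x₀ θ p := rfl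

theorem vecRep_add (x₀ : M) (X Y : VecField n M) : vecRep x₀ (X + Y) = vecRep x₀ X + vecRep x₀ Y := by
  funext p
  simp only [vecRep_apply, Pi.add_apply]
  exact map_add _ _ _

theorem vecRep_smul (x₀ : M) (c : M × ℝ → ℝ) (X : VecField n M) :
    vecRep x₀ (fun z => c z • X z) = fun p => c (ofChart (n := n) x₀ p) • vecRep x₀ X p := by
  funext p
  simp only [vecRep_apply]
  exact map_smul _ _ _

theorem SmoothScalarOn.mdifferentiableAt_slice {U : Set (M × ℝ)} (hU : IsOpen U) {h : ScalarField M}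
    (hh : SmoothScalarOn n U h) {z : M × ℝ} (hz : z ∈ U) :
    MDifferentiableAt (𝓡 n) 𝓘(ℝ, ℝ) (fun x => h (x, z.2)) z.1 := by
  have h1 : ContMDiffAt ((𝓡 n).prod 𝓘(ℝ, ℝ)) 𝓘(ℝ, ℝ) ∞ h (z.1, z.2) :=
    ContMDiffOn.contMDiffAt hh (hU.mem_nhds hz)
  have h2 : ContMDiffAt (𝓡 n) ((𝓡 n).prod 𝓘(ℝ, ℝ)) ∞ (fun x : M => (x, z.2)) z.1 :=
    contMDiffAt_id.prodMk contMDiffAt_const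
  exact (h1.comp z.1 h2).mdifferentiableAt (by simp)

variable [IsManifold (𝓡 n) ∞ M] {U : Set (M × ℝ)}

theorem vecAt_ofChart {x₀ : M} (X : VecField n M) {p : EuclideanSpace ℝ (Fin n) × ℝ}
    (hp : p.1 ∈ (extChartAt (𝓡 n) x₀).target) :
    vecAt X (ofChart x₀ p) = chartInvJac x₀ p.1 (vecRep x₀ X p) := by
  rw [vecRep_of_mem X hp]
  exact (congrArg (fun A => A (vecAt X (ofChart x₀ p))) (chartInvJac_comp_chartJac hp)).symm

theorem covAt_ofChart {x₀ : M} (θ : CovField n M) {p : EuclideanSpace ℝ (Fin n) × ℝ}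
    (hp : p.1 ∈ (extChartAt (𝓡 n) x₀).target) :
    covAt θ (ofChart x₀ p) = (covRep x₀ θ p).comp (chartJac x₀ (ofChart x₀ p).1) := by
  have e : (chartInvJac x₀ p.1).comp (chartJac x₀ (ofChart x₀ p).1) = ContinuousLinearMap.id ℝ _ :=
    chartInvJac_comp_chartJac hp
  rw [covRep_apply, ContinuousLinearMap.comp_assoc, e, ContinuousLinearMap.comp_id]

theorem SmoothScalarOn.contDiffAt (hU : IsOpen U) {h : ScalarField M} (hh : SmoothScalarOn n U h)
    {x₀ : M} {p : EuclideanSpace ℝ (Fin n) × ℝ} (hp : p ∈ chartDom x₀ U) :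
    ContDiffAt ℝ ∞ (h ∘ ofChart (n := n) x₀) p :=
  (hh.contDiffOn hU x₀).contDiffAt ((isOpen_chartDom x₀ hU).mem_nhds hp)

theorem SmoothVecOn.contDiffAt (hU : IsOpen U) {X : VecField n M} (hX : SmoothVecOn U X)
    {x₀ : M} {p : EuclideanSpace ℝ (Fin n) × ℝ} (hp : p ∈ chartDom x₀ U) :
    ContDiffAt ℝ ∞ (vecRep x₀ X) p :=
  (hX.contDiffOn hU x₀).contDiffAt ((isOpen_chartDom x₀ hU).mem_nhds hp)

theorem SmoothVecOn.mdifferentiableAt_slice (hU : IsOpen U) {X : VecField n M}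
    (hX : SmoothVecOn U X) {z : M × ℝ} (hz : z ∈ U) :
    MDifferentiableAt (𝓡 n) (𝓡 n).tangent
      (fun x => (⟨x, X (x, z.2)⟩ : TangentBundle (𝓡 n) M)) z.1 := by
  have h1 : ContMDiffAt ((𝓡 n).prod 𝓘(ℝ, ℝ)) (𝓡 n).tangent ∞
      (fun z : M × ℝ => (⟨z.1, X z⟩ : TangentBundle (𝓡 n) M)) (z.1, z.2) :=
    ContMDiffOn.contMDiffAt hX (hU.mem_nhds hz)
  have h2 : ContMDiffAt (𝓡 n) ((𝓡 n).prod 𝓘(ℝ, ℝ)) ∞ (fun x : M => (x, z.2)) z.1 :=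
    contMDiffAt_id.prodMk contMDiffAt_const
  exact (h1.comp z.1 h2).mdifferentiableAt (by simp)

theorem covRep_grad (hU : IsOpen U) {h : ScalarField M} (hh : SmoothScalarOn n U h)
    {x₀ : M} {p : EuclideanSpace ℝ (Fin n) × ℝ} (hp : p ∈ chartDom x₀ U) :
    covRep x₀ (grad h) p = (fderiv ℝ (h ∘ ofChart (n := n) x₀) p).comp
      (ContinuousLinearMap.inl ℝ _ ℝ) := by
  rw [← fderiv_slice ((hh.contDiffAt hU hp).differentiableAt (by simp)), ← mfderiv_eq_fderiv]
  have h1 : MDifferentiableAt 𝓘(ℝ, EuclideanSpace ℝ (Fin n)) (𝓡 n)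
      (extChartAt (𝓡 n) x₀).symm p.1 :=
    ((contMDiffOn_extChartAt_symm (n := ∞) x₀).contMDiffAt
      ((isOpen_extChartAt_target x₀).mem_nhds hp.1)).mdifferentiableAt (by simp)
  exact (mfderiv_comp p.1 (hh.mdifferentiableAt_slice hU hp.2) h1).symm

theorem dtScalar_ofChart (hU : IsOpen U) {h : ScalarField M} (hh : SmoothScalarOn n U h)
    {x₀ : M} {p : EuclideanSpace ℝ (Fin n) × ℝ} (hp : p ∈ chartDom x₀ U) :
    dtScalar h (ofChart x₀ p) = fderiv ℝ (h ∘ ofChart (n := n) x₀) p (0, 1) :=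
  (hasDerivAt_slice ((hh.contDiffAt hU hp).differentiableAt (by simp))).deriv

theorem evolScalar_ofChart (hU : IsOpen U) (X : VecField n M) (ε : ℝ) {h : ScalarField M}
    (hh : SmoothScalarOn n U h) {x₀ : M} {p : EuclideanSpace ℝ (Fin n) × ℝ}
    (hp : p ∈ chartDom x₀ U) :
    evolScalar X ε h (ofChart x₀ p) =
      fderiv ℝ (h ∘ ofChart (n := n) x₀) p (vecRep x₀ X p, ε) := by
  have h1 : lieScalar X h (ofChart x₀ p) =
      fderiv ℝ (h ∘ ofChart (n := n) x₀) p (vecRep x₀ X p, 0) := by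
    have := covRep_vecRep (grad h) X hp.1
    rw [covRep_grad hU hh hp] at this
    exact this.symm
  have h2 : ((vecRep x₀ X p, ε) : EuclideanSpace ℝ (Fin n) × ℝ) =
    (vecRep x₀ X p, 0) + ε • (0, 1) := by simp
  rw [h2, map_add, map_smul, ← h1, ← dtScalar_ofChart hU hh hp]
  rfl

/-- The Jacobian of the chart depends on the state only, so it passes through the time derivative.
-/
theorem vecRep_dtVec (hU : IsOpen U) {X : VecField n M} (hX : SmoothVecOn U X)
    {x₀ : M} {p : EuclideanSpace ℝ (Fin n) × ℝ} (hp : p ∈ chartDom x₀ U) :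
    vecRep x₀ (dtVec X) p = fderiv ℝ (vecRep x₀ X) p (0, 1) := by
  have h1 := hasDerivAt_slice ((hX.contDiffAt hU hp).differentiableAt (by simp))
  have h2 := ((chartInvJac x₀ p.1).hasFDerivAt (x := vecRep x₀ X p)).comp_hasDerivAt p.2 h1
  have h3 : vecAt (dtVec X) (ofChart x₀ p) =
      chartInvJac x₀ p.1 (fderiv ℝ (vecRep x₀ X) p (0, 1)) := by
    rw [← h2.deriv]
    change deriv (fun τ => vecAt X (ofChart x₀ (p.1, τ))) p.2 = _
    congr 1
    funext τ
    exact vecAt_ofChart X (p := (p.1, τ)) hp.1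
  rw [vecRep_of_mem _ hp.1, h3]
  exact congrArg (fun A => A (fderiv ℝ (vecRep x₀ X) p (0, 1))) (chartJac_comp_chartInvJac hp.1)

theorem covRep_dtCov {θ : CovField n M} {x₀ : M} {p : EuclideanSpace ℝ (Fin n) × ℝ}
    (hp : p.1 ∈ (extChartAt (𝓡 n) x₀).target) (hθ : DifferentiableAt ℝ (covRep x₀ θ) p) :
    covRep x₀ (dtCov θ) p = fderiv ℝ (covRep x₀ θ) p (0, 1) := by
  have h1 := hasDerivAt_slice hθ
  have h2 := h1.clm_comp (hasDerivAt_const p.2 (chartJac x₀ (ofChart x₀ p).1))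
  have h3 : covAt (dtCov θ) (ofChart x₀ p) =
      (fderiv ℝ (covRep x₀ θ) p (0, 1)).comp (chartJac x₀ (ofChart x₀ p).1) := by
    rw [ContinuousLinearMap.comp_zero, add_zero] at h2
    rw [← h2.deriv]
    change deriv (fun τ => covAt θ (ofChart x₀ (p.1, τ))) p.2 = _
    congr 1
    funext τ
    exact covAt_ofChart θ (p := (p.1, τ)) hp
  have e : (chartJac x₀ (ofChart x₀ p).1).comp (chartInvJac x₀ p.1) = ContinuousLinearMap.id ℝ _ :=
    chartJac_comp_chartInvJac hp
  rw [covRep_apply, h3, ContinuousLinearMap.comp_assoc, e, ContinuousLinearMap.comp_id]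

/-- Naturality of the Lie bracket under pullback by the inverse chart reduces it to the bracket in a
vector space. -/
theorem vecRep_bracket (hU : IsOpen U) {X Y : VecField n M} (hX : SmoothVecOn U X)
    (hY : SmoothVecOn U Y) {x₀ : M} {p : EuclideanSpace ℝ (Fin n) × ℝ} (hp : p ∈ chartDom x₀ U) :
    vecRep x₀ (bracket X Y) p = fderiv ℝ (vecRep x₀ Y) p (vecRep x₀ X p, 0) -
      fderiv ℝ (vecRep x₀ X) p (vecRep x₀ Y p, 0) := by
  have : IsManifold (𝓡 n) (minSmoothness ℝ 3) M := by
    rw [minSmoothness_of_isRCLikeNormedField]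
    exact IsManifold.of_le (n := ∞) (by norm_cast)
  have h1 : ContMDiffAt 𝓘(ℝ, EuclideanSpace ℝ (Fin n)) (𝓡 n) ∞ (extChartAt (𝓡 n) x₀).symm p.1 :=
    (contMDiffOn_extChartAt_symm x₀).contMDiffAt ((isOpen_extChartAt_target x₀).mem_nhds hp.1)
  have key := VectorField.mpullback_mlieBracket (x₀ := p.1) (f := (extChartAt (𝓡 n) x₀).symm)
    (V := fun x => X (x, p.2)) (W := fun x => Y (x, p.2)) (hX.mdifferentiableAt_slice hU hp.2)
    (hY.mdifferentiableAt_slice hU hp.2) h1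
    (by rw [minSmoothness_of_isRCLikeNormedField]; norm_cast)
  have key' : vecRep x₀ (bracket X Y) p = VectorField.lieBracket ℝ
      (fun y => vecRep x₀ X (y, p.2)) (fun y => vecRep x₀ Y (y, p.2)) p.1 := by
    refine key.trans ?_
    rw [← VectorField.mlieBracketWithin_univ, VectorField.mlieBracketWithin_eq_lieBracketWithin]
    exact congrFun VectorField.lieBracketWithin_univ p.1
  rw [key']
  have e1 := fderiv_slice ((hX.contDiffAt hU hp).differentiableAt (by simp))
  have e2 := fderiv_slice ((hY.contDiffAt hU hp).differentiableAt (by simp))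
  have e1' := congrArg (fun A => A (vecRep x₀ Y p)) e1
  have e2' := congrArg (fun A => A (vecRep x₀ X p)) e2
  exact congrArg₂ (· - ·) e2' e1'

theorem vecRep_evolVec (hU : IsOpen U) {X Y : VecField n M} (hX : SmoothVecOn U X)
    (hY : SmoothVecOn U Y) (ε : ℝ) {x₀ : M} {p : EuclideanSpace ℝ (Fin n) × ℝ}
    (hp : p ∈ chartDom x₀ U) :
    vecRep x₀ (evolVec X ε Y) p = fderiv ℝ (vecRep x₀ Y) p (vecRep x₀ X p, ε) -
      fderiv ℝ (vecRep x₀ X) p (vecRep x₀ Y p, 0) := by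
  have h2 : ((vecRep x₀ X p, ε) : EuclideanSpace ℝ (Fin n) × ℝ) =
    (vecRep x₀ X p, 0) + ε • (0, 1) := by simp
  rw [h2, map_add, map_smul, evolVec, vecRep_add, Pi.add_apply, vecRep_bracket hU hX hY hp,
    ← vecRep_dtVec hU hY hp]
  have h3 : vecRep x₀ (ε • dtVec Y) p = ε • vecRep x₀ (dtVec Y) p :=
    congrFun (vecRep_smul x₀ (fun _ => ε) (dtVec Y)) p
  rw [h3]
  abel

/-- Only the chart centred at `z` itself is treated, because `lieCov` is defined in that chart; this
is enough to compare covectors at `z`. -/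
theorem covRep_evolCov (hU : IsOpen U) {X : VecField n M} (hX : SmoothVecOn U X)
    {θ : CovField n M} (ε : ℝ) {z : M × ℝ} (hz : z ∈ U) (hθ : CovDifferentiableAt θ z) :
    covRep z.1 (evolCov X ε θ) (toChart z.1 z) =
      fderiv ℝ (covRep z.1 θ) (toChart z.1 z) (vecRep z.1 X (toChart z.1 z), ε) +
      (covRep z.1 θ (toChart z.1 z)).comp ((fderiv ℝ (vecRep z.1 X) (toChart z.1 z)).comp
        (ContinuousLinearMap.inl ℝ _ ℝ)) := by
  have hp := toChart_mem_chartDom (n := n) hz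
  set p := toChart (n := n) z.1 z with hpdef
  have e1 := fderiv_slice ((hX.contDiffAt hU hp).differentiableAt (by simp))
  have e2 := fderiv_slice (p := p) hθ
  have h1 : covAt (lieCov X θ) z = (fderiv ℝ (covRep z.1 θ) p (vecRep z.1 X p, 0) +
      (covRep z.1 θ p).comp ((fderiv ℝ (vecRep z.1 X) p).comp
        (ContinuousLinearMap.inl ℝ _ ℝ))).comp (chartJac z.1 z.1) := by
    rw [← e1]
    have e3 : fderiv ℝ (covRep z.1 θ) p (vecRep z.1 X p, 0) =
      fderiv ℝ (fun y => covRep z.1 θ (y, p.2)) p.1 (vecRep z.1 X p) := by rw [e2]; rfl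
    rw [e3]
    rfl
  have hzz : ofChart z.1 p = z := ofChart_toChart z
  have e : (chartJac z.1 (ofChart z.1 p).1).comp (chartInvJac z.1 p.1) =
    ContinuousLinearMap.id ℝ _ := chartJac_comp_chartInvJac hp.1
  rw [hzz] at e
  have h4 : covRep z.1 (lieCov X θ) p = fderiv ℝ (covRep z.1 θ) p (vecRep z.1 X p, 0) +
      (covRep z.1 θ p).comp ((fderiv ℝ (vecRep z.1 X) p).comp
        (ContinuousLinearMap.inl ℝ _ ℝ)) := by
    rw [covRep_apply, hzz, h1, ContinuousLinearMap.comp_assoc, e, ContinuousLinearMap.comp_id]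
  have h2 : ((vecRep z.1 X p, ε) : EuclideanSpace ℝ (Fin n) × ℝ) =
    (vecRep z.1 X p, 0) + ε • (0, 1) := by simp
  have h5 : covRep z.1 (ε • dtCov θ) p = ε • covRep z.1 (dtCov θ) p := rfl
  rw [h2, map_add, map_smul, evolCov, covRep_add, Pi.add_apply, h4, h5, covRep_dtCov hp.1 hθ]
  abel

end Calculus

/-! ### Leibniz rules and commutation with the differential -/

section Leibniz

variable {n : ℕ} {M : Type*} [TopologicalSpace M] [ChartedSpace (EuclideanSpace ℝ (Fin n)) M]
  {U : Set (M × ℝ)}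

theorem eventually_mem_chartDom (hU : IsOpen U) {z : M × ℝ} (hz : z ∈ U) :
    ∀ᶠ p in 𝓝 (toChart (n := n) z.1 z), p ∈ chartDom z.1 U :=
  (isOpen_chartDom z.1 hU).mem_nhds (toChart_mem_chartDom hz)

theorem contDiffAt_fderiv_apply {E F : Type*} [NormedAddCommGroup E] [NormedSpace ℝ E]
    [NormedAddCommGroup F] [NormedSpace ℝ F] {f : E → F} {v : E → E} {p : E}
    (hf : ContDiffAt ℝ ∞ f p) (hv : ContDiffAt ℝ ∞ v p) :
    ContDiffAt ℝ ∞ (fun q => fderiv ℝ f q (v q)) p :=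
  (hf.fderiv_right (m := ∞) (by norm_cast)).clm_apply hv

theorem vecRep_eq_of_eqOn {X Y : VecField n M} (h : ∀ z ∈ U, X z = Y z) (x₀ : M)
    {p : EuclideanSpace ℝ (Fin n) × ℝ} (hp : p ∈ chartDom x₀ U) :
    vecRep x₀ X p = vecRep x₀ Y p := by
  rw [vecRep_apply, vecRep_apply]
  exact congrArg _ (h _ hp.2)

theorem covRep_eq_of_eqOn {θ η : CovField n M} (h : ∀ z ∈ U, θ z = η z) (x₀ : M)
    {p : EuclideanSpace ℝ (Fin n) × ℝ} (hp : p ∈ chartDom x₀ U) :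
    covRep x₀ θ p = covRep x₀ η p := by
  rw [covRep_apply, covRep_apply]
  exact congrArg (fun A : EuclideanSpace ℝ (Fin n) →L[ℝ] ℝ => A.comp _) (h _ hp.2)

theorem CovDifferentiableAt.add {θ η : CovField n M} {z : M × ℝ} (hθ : CovDifferentiableAt θ z)
    (hη : CovDifferentiableAt η z) : CovDifferentiableAt (θ + η) z := by
  unfold CovDifferentiableAt
  rw [covRep_add]
  exact DifferentiableAt.add hθ hη

theorem CovDifferentiableAt.congr (hU : IsOpen U) {θ η : CovField n M} {z : M × ℝ} (hz : z ∈ U)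
    (hθ : CovDifferentiableAt θ z) (h : ∀ z ∈ U, η z = θ z) : CovDifferentiableAt η z := by
  refine hθ.congr_of_eventuallyEq ?_
  filter_upwards [eventually_mem_chartDom hU hz] with q hq
  exact covRep_eq_of_eqOn h z.1 hq

variable [IsManifold (𝓡 n) ∞ M]

theorem SmoothScalarOn.evolScalar (hU : IsOpen U) {X : VecField n M} (hX : SmoothVecOn U X) (ε : ℝ)
    {h : ScalarField M} (hh : SmoothScalarOn n U h) : SmoothScalarOn n U (evolScalar X ε h) := by
  refine smoothScalarOn_of_contDiffAt fun z hz => ?_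
  have hp := toChart_mem_chartDom (n := n) hz
  refine (contDiffAt_fderiv_apply (hh.contDiffAt hU hp)
    ((hX.contDiffAt hU hp).prodMk (contDiffAt_const (c := ε)))).congr_of_eventuallyEq ?_
  filter_upwards [eventually_mem_chartDom hU hz] with q hq
  exact evolScalar_ofChart hU X ε hh hq

theorem SmoothVecOn.evolVec (hU : IsOpen U) {X Y : VecField n M} (hX : SmoothVecOn U X) (ε : ℝ)
    (hY : SmoothVecOn U Y) : SmoothVecOn U (evolVec X ε Y) := by
  refine smoothVecOn_of_contDiffAt fun z hz => ?_
  have hp := toChart_mem_chartDom (n := n) hz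
  refine ((contDiffAt_fderiv_apply (hY.contDiffAt hU hp)
    ((hX.contDiffAt hU hp).prodMk (contDiffAt_const (c := ε)))).sub
      (contDiffAt_fderiv_apply (hX.contDiffAt hU hp)
        ((hY.contDiffAt hU hp).prodMk (contDiffAt_const (c := 0))))).congr_of_eventuallyEq ?_
  filter_upwards [eventually_mem_chartDom hU hz] with q hq
  exact vecRep_evolVec hU hX hY ε hq

theorem SmoothVecOn.smul (hU : IsOpen U) {c : M × ℝ → ℝ} (hc : SmoothScalarOn n U c)
    {X : VecField n M} (hX : SmoothVecOn U X) : SmoothVecOn U (fun z => c z • X z) := by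
  refine smoothVecOn_of_contDiffAt fun z hz => ?_
  have hp := toChart_mem_chartDom (n := n) hz
  rw [vecRep_smul]
  exact (hc.contDiffAt hU hp).smul (hX.contDiffAt hU hp)

theorem SmoothVecOn.add (hU : IsOpen U) {X Y : VecField n M} (hX : SmoothVecOn U X)
    (hY : SmoothVecOn U Y) : SmoothVecOn U (X + Y) := by
  refine smoothVecOn_of_contDiffAt fun z hz => ?_
  have hp := toChart_mem_chartDom (n := n) hz
  rw [vecRep_add]
  exact (hX.contDiffAt hU hp).add (hY.contDiffAt hU hp)

theorem SmoothVecOn.congr (hU : IsOpen U) {X Y : VecField n M} (hX : SmoothVecOn U X)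
    (h : ∀ z ∈ U, Y z = X z) : SmoothVecOn U Y := by
  refine smoothVecOn_of_contDiffAt fun z hz => ?_
  refine (hX.contDiffAt hU (toChart_mem_chartDom hz)).congr_of_eventuallyEq ?_
  filter_upwards [eventually_mem_chartDom hU hz] with q hq
  exact vecRep_eq_of_eqOn h z.1 hq

theorem smoothVecOn_zero : SmoothVecOn U (0 : VecField n M) := by
  refine smoothVecOn_of_contDiffAt fun z hz => ?_
  have : vecRep z.1 (0 : VecField n M) = fun _ => 0 := by
    funext p; rw [vecRep_apply]; exact map_zero _
  rw [this]
  exact contDiffAt_const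

theorem SmoothVecOn.sum (hU : IsOpen U) {ι : Type*} (s : Finset ι) {X : ι → VecField n M}
    (hX : ∀ i, SmoothVecOn U (X i)) : SmoothVecOn U (fun z => ∑ i ∈ s, X i z) := by
  classical
  induction s using Finset.induction_on with
  | empty => exact smoothVecOn_zero
  | insert a s ha ih =>
    refine ((hX a).add hU ih).congr hU fun z _ => ?_
    simp [Finset.sum_insert ha]

theorem contDiffAt_covRep_grad (hU : IsOpen U) {h : ScalarField M} (hh : SmoothScalarOn n U h)
    {z : M × ℝ} (hz : z ∈ U) :
    ContDiffAt ℝ ∞ (covRep (n := n) z.1 (grad h)) (toChart z.1 z) := by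
  have h1 := (hh.contDiffAt hU (toChart_mem_chartDom (n := n) hz)).fderiv_right (m := ∞)
    (by norm_cast)
  refine (h1.clm_comp (contDiffAt_const
    (c := ContinuousLinearMap.inl ℝ (EuclideanSpace ℝ (Fin n)) ℝ))).congr_of_eventuallyEq ?_
  filter_upwards [eventually_mem_chartDom hU hz] with q hq
  exact covRep_grad hU hh hq

theorem covDifferentiableAt_grad (hU : IsOpen U) {h : ScalarField M} (hh : SmoothScalarOn n U h)
    {z : M × ℝ} (hz : z ∈ U) : CovDifferentiableAt (n := n) (grad h) z :=
  (contDiffAt_covRep_grad hU hh hz).differentiableAt (by simp)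

/-- Differentiation along a vector field commutes with the differential. -/
theorem evolCov_grad (hU : IsOpen U) {X : VecField n M} (hX : SmoothVecOn U X) (ε : ℝ)
    {h : ScalarField M} (hh : SmoothScalarOn n U h) {z : M × ℝ} (hz : z ∈ U) :
    evolCov X ε (grad h) z = grad (evolScalar X ε h) z := by
  have hp := toChart_mem_chartDom (n := n) hz
  apply eq_of_covRep_eq
  rw [covRep_evolCov hU hX ε hz (covDifferentiableAt_grad hU hh hz),
    covRep_grad hU (hh.evolScalar hU hX ε) hp]
  set p := toChart (n := n) z.1 z
  set H := h ∘ ofChart (n := n) z.1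
  have hH : ContDiffAt ℝ ∞ H p := hh.contDiffAt hU hp
  have hH' : DifferentiableAt ℝ (fderiv ℝ H) p :=
    (hH.fderiv_right (m := ∞) (by norm_cast)).differentiableAt (by simp)
  have hV : DifferentiableAt ℝ (vecRep z.1 X) p := (hX.contDiffAt hU hp).differentiableAt (by simp)
  have e1 : covRep z.1 (grad h) =ᶠ[𝓝 p] fun q => (fderiv ℝ H q).comp
      (ContinuousLinearMap.inl ℝ _ ℝ) := by
    filter_upwards [eventually_mem_chartDom hU hz] with q hq
    exact covRep_grad hU hh hq
  have e2 : evolScalar X ε h ∘ ofChart (n := n) z.1 =ᶠ[𝓝 p]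
      fun q => fderiv ℝ H q (vecRep z.1 X q, ε) := by
    filter_upwards [eventually_mem_chartDom hU hz] with q hq
    exact evolScalar_ofChart hU X ε hh hq
  rw [e1.fderiv_eq, e2.fderiv_eq, e1.eq_of_nhds]
  have d1 := (hH'.hasFDerivAt.clm_comp (hasFDerivAt_const
    (ContinuousLinearMap.inl ℝ (EuclideanSpace ℝ (Fin n)) ℝ) p)).fderiv
  have d2 := (hH'.hasFDerivAt.clm_apply
    (hV.hasFDerivAt.prodMk (hasFDerivAt_const ε p))).fderiv
  rw [d1, d2]
  -- In coordinates the two sides differ by exchanging the directions `(X, ε)` and `(w, 0)` in the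
  -- second derivative of `H` on space-time; `ε` is constant and contributes no derivative.
  have hsymm : IsSymmSndFDerivAt ℝ H p := hH.isSymmSndFDerivAt
    (by rw [minSmoothness_of_isRCLikeNormedField]; norm_cast)
  ext w
  have := hsymm (vecRep z.1 X p, ε) (w, 0)
  simp [this]
  ring

theorem CovDifferentiableAt.smul (hU : IsOpen U) {c : M × ℝ → ℝ} (hc : SmoothScalarOn n U c)
    {θ : CovField n M} {z : M × ℝ} (hz : z ∈ U) (hθ : CovDifferentiableAt θ z) :
    CovDifferentiableAt (fun z => c z • θ z) z := by
  unfold CovDifferentiableAt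
  rw [covRep_smul]
  exact ((hc.contDiffAt hU (toChart_mem_chartDom hz)).differentiableAt (by simp)).fun_smul hθ

theorem evolCov_congr (hU : IsOpen U) {X : VecField n M} (hX : SmoothVecOn U X) (ε : ℝ)
    {θ η : CovField n M} {z : M × ℝ} (hz : z ∈ U) (hθ : CovDifferentiableAt θ z)
    (h : ∀ z ∈ U, η z = θ z) : evolCov X ε η z = evolCov X ε θ z := by
  have e : covRep z.1 η =ᶠ[𝓝 (toChart z.1 z)] covRep z.1 θ := by
    filter_upwards [eventually_mem_chartDom hU hz] with q hq
    exact covRep_eq_of_eqOn h z.1 hq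
  apply eq_of_covRep_eq
  rw [covRep_evolCov hU hX ε hz (hθ.congr hU hz h), covRep_evolCov hU hX ε hz hθ, e.fderiv_eq,
    e.eq_of_nhds]

theorem evolCov_add (hU : IsOpen U) {X : VecField n M} (hX : SmoothVecOn U X) (ε : ℝ)
    {θ η : CovField n M} {z : M × ℝ} (hz : z ∈ U) (hθ : CovDifferentiableAt θ z)
    (hη : CovDifferentiableAt η z) :
    evolCov X ε (θ + η) z = evolCov X ε θ z + evolCov X ε η z := by
  refine eq_of_covRep_eq (θ' := evolCov X ε θ + evolCov X ε η) ?_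
  rw [covRep_add, Pi.add_apply, covRep_evolCov hU hX ε hz (hθ.add hη),
    covRep_evolCov hU hX ε hz hθ, covRep_evolCov hU hX ε hz hη, covRep_add, fderiv_add hθ hη]
  ext w
  simp
  ring

theorem evolCov_smul (hU : IsOpen U) {X : VecField n M} (hX : SmoothVecOn U X) (ε : ℝ)
    {c : M × ℝ → ℝ} (hc : SmoothScalarOn n U c) {θ : CovField n M} {z : M × ℝ} (hz : z ∈ U)
    (hθ : CovDifferentiableAt θ z) :
    evolCov X ε (fun z => c z • θ z) z = evolScalar X ε c z • θ z + c z • evolCov X ε θ z := by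
  have hp := toChart_mem_chartDom (n := n) hz
  refine eq_of_covRep_eq (θ' := (fun z => evolScalar X ε c z • θ z) +
    (fun z => c z • evolCov X ε θ z)) ?_
  rw [covRep_add, Pi.add_apply, covRep_evolCov hU hX ε hz (hθ.smul hU hc hz), covRep_smul,
    covRep_smul, covRep_smul]
  simp only []
  rw [covRep_evolCov hU hX ε hz hθ, evolScalar_ofChart hU X ε hc hp]
  have hc' := ((hc.contDiffAt hU hp).differentiableAt (by simp)).hasFDerivAt
  have := (hc'.fun_smul (DifferentiableAt.hasFDerivAt hθ)).fderiv
  simp only [Function.comp_apply] at this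
  rw [this]
  ext w
  simp
  ring

/-- The Leibniz rule for the pairing of a covector field with a vector field. -/
theorem evolScalar_pairing (hU : IsOpen U) {X Y : VecField n M} (hX : SmoothVecOn U X)
    (hY : SmoothVecOn U Y) (ε : ℝ) {θ : CovField n M} (hs : SmoothScalarOn n U (pairing θ Y))
    {z : M × ℝ} (hz : z ∈ U) (hθ : CovDifferentiableAt θ z) :
    evolScalar X ε (pairing θ Y) z =
      pairing (evolCov X ε θ) Y z + pairing θ (evolVec X ε Y) z := by
  have hp := toChart_mem_chartDom (n := n) hz
  have hzz : ofChart z.1 (toChart (n := n) z.1 z) = z := ofChart_toChart z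
  have h1 := evolScalar_ofChart hU X ε hs hp
  have h2 := covRep_vecRep (evolCov X ε θ) Y hp.1
  have h3 := covRep_vecRep θ (evolVec X ε Y) hp.1
  rw [hzz] at h1 h2 h3
  rw [h1, ← h2, ← h3, covRep_evolCov hU hX ε hz hθ, vecRep_evolVec hU hX hY ε hp]
  have e : pairing θ Y ∘ ofChart (n := n) z.1 =ᶠ[𝓝 (toChart z.1 z)]
      fun q => covRep z.1 θ q (vecRep z.1 Y q) := by
    filter_upwards [eventually_mem_chartDom hU hz] with q hq
    exact (covRep_vecRep θ Y hq.1).symm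
  have hY' := ((hY.contDiffAt hU hp).differentiableAt (by simp)).hasFDerivAt
  -- The terms containing the derivative of `X` have opposite signs in the derivatives of `θ` and of
  -- `Y`, and cancel.
  rw [e.fderiv_eq, ((DifferentiableAt.hasFDerivAt hθ).clm_apply hY').fderiv]
  simp
  ring

theorem evolVec_congr (hU : IsOpen U) {X : VecField n M} (hX : SmoothVecOn U X) (ε : ℝ)
    {Y Z : VecField n M} {z : M × ℝ} (hz : z ∈ U) (hY : SmoothVecOn U Y)
    (h : ∀ z ∈ U, Z z = Y z) : evolVec X ε Z z = evolVec X ε Y z := by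
  have e : vecRep z.1 Z =ᶠ[𝓝 (toChart z.1 z)] vecRep z.1 Y := by
    filter_upwards [eventually_mem_chartDom hU hz] with q hq
    exact vecRep_eq_of_eqOn h z.1 hq
  have hp := toChart_mem_chartDom (n := n) hz
  apply eq_of_vecRep_eq
  rw [vecRep_evolVec hU hX (hY.congr hU h) ε hp, vecRep_evolVec hU hX hY ε hp, e.fderiv_eq,
    e.eq_of_nhds]

theorem evolVec_add (hU : IsOpen U) {X : VecField n M} (hX : SmoothVecOn U X) (ε : ℝ)
    {Y Z : VecField n M} {z : M × ℝ} (hz : z ∈ U) (hY : SmoothVecOn U Y) (hZ : SmoothVecOn U Z) :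
    evolVec X ε (Y + Z) z = evolVec X ε Y z + evolVec X ε Z z := by
  have hp := toChart_mem_chartDom (n := n) hz
  refine eq_of_vecRep_eq (Y := evolVec X ε Y + evolVec X ε Z) ?_
  rw [vecRep_add, Pi.add_apply, vecRep_evolVec hU hX (hY.add hU hZ) ε hp,
    vecRep_evolVec hU hX hY ε hp, vecRep_evolVec hU hX hZ ε hp, vecRep_add,
    fderiv_add ((hY.contDiffAt hU hp).differentiableAt (by simp))
      ((hZ.contDiffAt hU hp).differentiableAt (by simp))]
  have : ((vecRep z.1 Y + vecRep z.1 Z) (toChart z.1 z), (0 : ℝ)) =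
    (vecRep z.1 Y (toChart z.1 z), 0) + (vecRep z.1 Z (toChart z.1 z), 0) := by simp
  rw [this, map_add, add_apply]
  abel

theorem evolVec_smul (hU : IsOpen U) {X : VecField n M} (hX : SmoothVecOn U X) (ε : ℝ)
    {c : M × ℝ → ℝ} (hc : SmoothScalarOn n U c) {Y : VecField n M} {z : M × ℝ} (hz : z ∈ U)
    (hY : SmoothVecOn U Y) :
    evolVec X ε (fun z => c z • Y z) z = evolScalar X ε c z • Y z + c z • evolVec X ε Y z := by
  have hp := toChart_mem_chartDom (n := n) hz
  refine eq_of_vecRep_eq (Y := (fun z => evolScalar X ε c z • Y z) +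
    (fun z => c z • evolVec X ε Y z)) ?_
  rw [vecRep_add, Pi.add_apply, vecRep_evolVec hU hX (hY.smul hU hc) ε hp, vecRep_smul,
    vecRep_smul, vecRep_smul]
  simp only []
  rw [vecRep_evolVec hU hX hY ε hp, evolScalar_ofChart hU X ε hc hp]
  have hc' := ((hc.contDiffAt hU hp).differentiableAt (by simp)).hasFDerivAt
  have hY' := ((hY.contDiffAt hU hp).differentiableAt (by simp)).hasFDerivAt
  have := (hc'.fun_smul hY').fderiv
  simp only [Function.comp_apply] at this
  rw [this]
  have e : (c (ofChart (n := n) z.1 (toChart z.1 z)) • vecRep z.1 Y (toChart z.1 z), (0 : ℝ)) =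
    c (ofChart (n := n) z.1 (toChart z.1 z)) • (vecRep z.1 Y (toChart z.1 z), 0) := by simp
  rw [e, map_smul]
  simp [smul_sub]
  abel

end Leibniz

/-! ### Smooth coefficients of minimal norm; compressions of a matrix -/

section LinearAlgebra

open Matrix

theorem contDiffAt_det {G : Type*} [NormedAddCommGroup G] [NormedSpace ℝ G] {κ : Type*} [Fintype κ]
    [DecidableEq κ] {A : G → Matrix κ κ ℝ} {p : G} (hA : ∀ i j, ContDiffAt ℝ ∞ (fun q => A q i j) p) :
    ContDiffAt ℝ ∞ (fun q => (A q).det) p := by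
  simp only [Matrix.det_apply]
  refine ContDiffAt.sum fun τ _ => ?_
  refine ContDiffAt.const_smul _ ?_
  exact contDiffAt_prod fun i _ => hA _ _

theorem contDiffAt_inv_apply {G : Type*} [NormedAddCommGroup G] [NormedSpace ℝ G] {κ : Type*}
    [Fintype κ] [DecidableEq κ] {A : G → Matrix κ κ ℝ} {p : G}
    (hA : ∀ i j, ContDiffAt ℝ ∞ (fun q => A q i j) p) (hp : (A p).det ≠ 0) (i j : κ) :
    ContDiffAt ℝ ∞ (fun q => (A q)⁻¹ i j) p := by
  simp only [Matrix.inv_def, Matrix.smul_apply, Ring.inverse_eq_inv', Matrix.adjugate_apply]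
  refine ContDiffAt.smul ((contDiffAt_det hA).inv hp) (contDiffAt_det fun k l => ?_)
  by_cases h : k = j
  · subst h
    simpa using contDiffAt_const
  · simpa [Matrix.updateRow_ne h] using hA k l

/-- Where the vectors `a i` span a space of constant dimension, a vector of this space is their
combination with coefficients of minimal norm, and these depend smoothly on the data. -/
theorem exists_contDiffAt_coeff {G F : Type*} [NormedAddCommGroup G] [NormedSpace ℝ G]
    [NormedAddCommGroup F] [NormedSpace ℝ F] [FiniteDimensional ℝ F] {ι : Type*} [Fintype ι]
    {a : ι → G → F} {b : G → F} {p₀ : G} (ha : ∀ i, ContDiffAt ℝ ∞ (a i) p₀)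
    (hb : ContDiffAt ℝ ∞ b p₀) {d : ℕ}
    (hd : ∀ᶠ p in 𝓝 p₀, Module.finrank ℝ (Submodule.span ℝ (range fun i => a i p)) = d) :
    ∃ c : ι → G → ℝ, (∀ i, ContDiffAt ℝ ∞ (c i) p₀) ∧ ∀ᶠ p in 𝓝 p₀,
      b p ∈ Submodule.span ℝ (range fun i => a i p) →
        ∑ i, c i p • a i p = b p ∧ ∀ k : ι → ℝ, ∑ i, k i • a i p = 0 → ∑ i, k i * c i p = 0 := by
  classical
  set W₀ := Submodule.span ℝ (range fun i => a i p₀)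
  have hd₀ : Module.finrank ℝ W₀ = d := hd.self_of_nhds
  let e : W₀ ≃ₗ[ℝ] (Fin d → ℝ) := LinearEquiv.ofFinrankEq _ _ (by simp [hd₀])
  -- `L` is a fixed linear map to ℝ^d that is an isomorphism on the span at `p₀`. It replaces the
  -- moving spans by ℝ^d, where `B p` is the matrix of the images of the `a i p`.
  obtain ⟨L, hL⟩ := LinearMap.exists_extend e.toLinearMap
  let B : G → Matrix (Fin d) ι ℝ := fun p => Matrix.of fun j i => L (a i p) j
  have hBmul : ∀ p (k : ι → ℝ), B p *ᵥ k = L (∑ i, k i • a i p) := by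
    intro p k
    funext j
    simp [B, Matrix.mulVec, dotProduct, mul_comm]
  have hLsm : ∀ j, ContDiff ℝ ∞ (fun v => L v j) := fun j =>
    ((LinearMap.proj j).comp L).toContinuousLinearMap.contDiff
  have hB : ∀ j i, ContDiffAt ℝ ∞ (fun p => B p j i) p₀ := fun j i =>
    (hLsm j).contDiffAt.comp p₀ (ha i)
  let K : G → Matrix (Fin d) (Fin d) ℝ := fun p => B p * (B p).transpose
  have hK : ∀ i j, ContDiffAt ℝ ∞ (fun p => K p i j) p₀ := fun i j => by
    simp only [K, Matrix.mul_apply, Matrix.transpose_apply]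
    exact ContDiffAt.sum fun l _ => (hB i l).mul (hB j l)
  have hK₀ : (K p₀).det ≠ 0 := by
    have hsurj : Function.Surjective (B p₀).mulVecLin := by
      intro v
      obtain ⟨k, hk⟩ := (Submodule.mem_span_range_iff_exists_fun ℝ).1 (e.symm v).2
      refine ⟨k, ?_⟩
      rw [Matrix.mulVecLin_apply, hBmul, hk]
      have := congrArg (fun f => f (e.symm v)) hL
      simpa using this
    have hr : Function.Surjective (K p₀).mulVecLin := by
      rw [← LinearMap.range_eq_top]
      refine Submodule.eq_top_of_finrank_eq ?_
      change (K p₀).rank = _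
      simp only [K]
      rw [Matrix.rank_self_mul_transpose, Matrix.rank, LinearMap.range_eq_top.2 hsurj]
      simp
    have : IsUnit (K p₀) := Matrix.mulVec_surjective_iff_isUnit.1 hr
    exact ((Matrix.isUnit_iff_isUnit_det _).1 this).ne_zero
  -- Bᵀ(BBᵀ)⁻¹ L b is the solution c of B c = L b that is orthogonal to the kernel of B. It is
  -- smooth because BBᵀ is invertible at `p₀`.
  refine ⟨fun i p => ((B p).transpose *ᵥ ((K p)⁻¹ *ᵥ L (b p))) i, fun i => ?_, ?_⟩
  · simp only [Matrix.mulVec, dotProduct, Matrix.transpose_apply]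
    exact ContDiffAt.sum fun j _ => (hB j i).mul (ContDiffAt.sum fun l _ =>
      (contDiffAt_inv_apply hK hK₀ j l).mul ((hLsm l).contDiffAt.comp p₀ hb))
  · filter_upwards [hd, (contDiffAt_det hK).continuousAt.eventually_ne hK₀] with p hdp hKp hbp
    have hKK : K p * (K p)⁻¹ = 1 := Matrix.mul_nonsing_inv _ (isUnit_iff_ne_zero.2 hKp)
    have hBc : ∀ w, B p *ᵥ ((B p).transpose *ᵥ ((K p)⁻¹ *ᵥ w)) = w := fun w => by
      rw [Matrix.mulVec_mulVec, Matrix.mulVec_mulVec, hKK, Matrix.one_mulVec]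
    set W := Submodule.span ℝ (range fun i => a i p)
    -- Near `p₀` the map `L` still sends the span onto ℝ^d; the span has dimension `d`, so `L` is
    -- injective on it and equations may be checked after applying `L`.
    have hinj : Function.Injective (L.domRestrict W) := by
      rw [LinearMap.injective_iff_surjective_of_finrank_eq_finrank (by simp [hdp])]
      intro w
      refine ⟨⟨∑ i, ((B p).transpose *ᵥ ((K p)⁻¹ *ᵥ w)) i • a i p,
        (Submodule.mem_span_range_iff_exists_fun ℝ).2 ⟨_, rfl⟩⟩, ?_⟩
      rw [LinearMap.domRestrict_apply, ← hBmul, hBc]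
    constructor
    · have h1 := @hinj ⟨∑ i, ((B p).transpose *ᵥ ((K p)⁻¹ *ᵥ L (b p))) i • a i p,
        (Submodule.mem_span_range_iff_exists_fun ℝ).2 ⟨_, rfl⟩⟩ ⟨b p, hbp⟩ (by
          rw [LinearMap.domRestrict_apply, LinearMap.domRestrict_apply]
          simp only []
          rw [← hBmul, hBc])
      exact congrArg Subtype.val h1
    -- A relation among the `a i p` lies in the kernel of B, and the coefficients lie in the range
    -- of Bᵀ.
    · intro k hk
      have h0 : B p *ᵥ k = 0 := by rw [hBmul, hk, map_zero]
      change k ⬝ᵥ ((B p).transpose *ᵥ ((K p)⁻¹ *ᵥ L (b p))) = 0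
      rw [Matrix.dotProduct_mulVec, Matrix.vecMul_transpose, h0, zero_dotProduct]

/-- A matrix of rank at most `d` is recovered from an invertible compression of size `d`. -/
theorem det_smul_eq_of_rank_le {I J : Type*} [Fintype I] [Fintype J] [DecidableEq J] {d : ℕ}
    {P : Matrix I J ℝ} {L : Matrix (Fin d) I ℝ} {N : Matrix J (Fin d) ℝ}
    (hdet : (L * P * N).det ≠ 0) (hrank : P.rank ≤ d) :
    (L * P * N).det • P = P * N * (L * P * N).adjugate * L * P := by
  have h1 : (P * N).rank = d := by
    refine le_antisymm (by simpa using Matrix.rank_le_card_width (P * N)) ?_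
    have h2 : (L * P * N).rank = d := by
      simpa using (Matrix.rank_of_isUnit _
        ((Matrix.isUnit_iff_isUnit_det _).2 (isUnit_iff_ne_zero.2 hdet)))
    calc d = (L * (P * N)).rank := by rw [← Matrix.mul_assoc, h2]
      _ ≤ _ := Matrix.rank_mul_le_right _ _
  -- P and PN have the same range, so each column of P is PN applied to some vector. It then
  -- suffices to check the identity with its last factor P replaced by PN, where it is
  -- adj(LPN)·(LPN) = det(LPN).
  have h3 : LinearMap.range (P * N).mulVecLin = LinearMap.range P.mulVecLin := by
    refine Submodule.eq_of_le_of_finrank_le ?_ ?_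
    · rintro _ ⟨v, rfl⟩
      exact ⟨N *ᵥ v, by simp⟩
    · change P.rank ≤ (P * N).rank
      rw [h1]; exact hrank
  apply Matrix.ext_of_mulVec_single
  intro j
  have h4 : P *ᵥ (Pi.single j 1) ∈ LinearMap.range (P * N).mulVecLin := by
    rw [h3]; exact ⟨_, rfl⟩
  obtain ⟨y, hy⟩ := h4
  rw [Matrix.mulVecLin_apply] at hy
  rw [← Matrix.mulVec_mulVec, Matrix.smul_mulVec, ← hy, Matrix.mulVec_mulVec]
  have : P * N * (L * P * N).adjugate * L * (P * N) = (L * P * N).det • (P * N) := by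
    calc _ = P * N * ((L * P * N).adjugate * (L * P * N)) := by simp only [Matrix.mul_assoc]
      _ = _ := by rw [Matrix.adjugate_mul, Matrix.mul_smul, Matrix.mul_one]
  rw [this, Matrix.smul_mulVec]

/-- `L` extends an identification of the range of `P` with ℝ^rank to the whole space, and the
columns of `N` are preimages under `P` of the corresponding basis. -/
theorem exists_compression {I J : Type*} [Fintype I] [Fintype J] [DecidableEq I] [DecidableEq J]
    (P : Matrix I J ℝ) :
    ∃ (L : Matrix (Fin P.rank) I ℝ) (N : Matrix J (Fin P.rank) ℝ), L * P * N = 1 := by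
  let e : LinearMap.range P.mulVecLin ≃ₗ[ℝ] (Fin P.rank → ℝ) :=
    LinearEquiv.ofFinrankEq _ _ (by rw [Module.finrank_fin_fun]; rfl)
  obtain ⟨L, hL⟩ := LinearMap.exists_extend e.toLinearMap
  choose w hw using fun k => (e.symm (Pi.single k 1)).2
  refine ⟨LinearMap.toMatrix' L, Matrix.of fun j k => w k j, ?_⟩
  apply Matrix.ext_of_mulVec_single
  intro k
  have h1 : (Matrix.of fun j k => w k j) *ᵥ Pi.single k (1 : ℝ) = w k := by
    funext j; simp
  rw [← Matrix.mulVec_mulVec, h1, ← Matrix.mulVec_mulVec, Matrix.one_mulVec]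
  have h2 : P *ᵥ w k = (e.symm (Pi.single k 1) : I → ℝ) := hw k
  rw [h2, LinearMap.toMatrix'_mulVec]
  have := congrArg (fun f => f (e.symm (Pi.single k 1))) hL
  simpa using this

/-- Near some point of any open set, a continuous matrix is recovered from a compression by
constant matrices. -/
theorem exists_eventually_det_smul_eq {Z : Type*} [TopologicalSpace Z] {I J : Type*} [Fintype I]
    [Fintype J] [DecidableEq I] [DecidableEq J] {P : Z → Matrix I J ℝ} {V : Set Z} (hV : IsOpen V)
    (hne : V.Nonempty) (hP : ContinuousOn P V) :
    ∃ z ∈ V, ∃ (d : ℕ) (L : Matrix (Fin d) I ℝ) (N : Matrix J (Fin d) ℝ),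
      (L * P z * N).det ≠ 0 ∧ ∀ᶠ w in 𝓝 z,
        (L * P w * N).det • P w = P w * N * (L * P w * N).adjugate * L * P w := by
  -- At a point where the rank is maximal on `V`, a compression of that size stays invertible nearby
  -- while the rank cannot exceed it, so `det_smul_eq_of_rank_le` applies in a neighbourhood.
  obtain ⟨z, hz, hmax⟩ : ∃ z ∈ V, ∀ w ∈ V, (P w).rank ≤ (P z).rank := by
    have hfin : ((fun w => (P w).rank) '' V).Finite :=
      (Set.finite_le_nat (Fintype.card J)).subset (by
        rintro _ ⟨w, _, rfl⟩; exact Matrix.rank_le_card_width _)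
    obtain ⟨_, ⟨z, hz, rfl⟩, h⟩ := hfin.exists_maximal (hne.image _)
    exact ⟨z, hz, fun w hw => (le_total _ _).elim id fun h' => h ⟨w, hw, rfl⟩ h'⟩
  obtain ⟨L, N, hLN⟩ := exists_compression (P z)
  have hdet : (L * P z * N).det ≠ 0 := by rw [hLN]; simp
  refine ⟨z, hz, _, L, N, hdet, ?_⟩
  have hc : ContinuousAt (fun w => (L * P w * N).det) z := by
    have h1 : ContinuousAt P z := hP.continuousAt (hV.mem_nhds hz)
    have h2 : Continuous fun A : Matrix I J ℝ => (L * A * N).det := by fun_prop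
    exact h2.continuousAt.comp h1
  filter_upwards [hc.eventually_ne hdet, hV.mem_nhds hz] with w hw hwV
  exact det_smul_eq_of_rank_le hw (hmax w hwV)

end LinearAlgebra

/-! ### Modules of fields of constant rank -/

section Fields

variable {n : ℕ} {M : Type*} [TopologicalSpace M] [ChartedSpace (EuclideanSpace ℝ (Fin n)) M]
  {F : Type*} [NormedAddCommGroup F] [NormedSpace ℝ F]

/-- The span on `U` of a set of fields with values in a fixed vector space. -/
def fieldSpan (n : ℕ) {M : Type*} [TopologicalSpace M] [ChartedSpace (EuclideanSpace ℝ (Fin n)) M]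
    (U : Set (M × ℝ)) (A : Set (M × ℝ → F)) : Submodule (smoothRing n U) (M × ℝ → F) :=
  Submodule.span (smoothRing n U) (A ∪ {X | ∀ z ∈ U, X z = 0})

/-- The values at `z` of the fields in a module. -/
def fiber {U : Set (M × ℝ)} (W : Submodule (smoothRing n U) (M × ℝ → F)) (z : M × ℝ) :
    Submodule ℝ F :=
  Submodule.span ℝ ((fun X : M × ℝ → F => X z) '' (W : Set (M × ℝ → F)))

variable {U : Set (M × ℝ)}

theorem subset_fieldSpan (A : Set (M × ℝ → F)) : A ⊆ fieldSpan n U A :=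
  fun _ ha => Submodule.subset_span (Or.inl ha)

theorem mem_fieldSpan_of_eqOn_zero (A : Set (M × ℝ → F)) {X : M × ℝ → F}
    (hX : ∀ z ∈ U, X z = 0) : X ∈ fieldSpan n U A :=
  Submodule.subset_span (Or.inr hX)

theorem fieldSpan_le {A : Set (M × ℝ → F)} {W : Submodule (smoothRing n U) (M × ℝ → F)}
    (hA : A ⊆ W) (hW : fieldSpan n U ∅ ≤ W) : fieldSpan n U A ≤ W :=
  Submodule.span_le.2 (union_subset hA fun _ hX => hW (mem_fieldSpan_of_eqOn_zero _ hX))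

theorem fieldSpan_mono {A B : Set (M × ℝ → F)} (h : A ⊆ B) : fieldSpan n U A ≤ fieldSpan n U B :=
  Submodule.span_mono (union_subset_union_left _ h)

theorem fieldSpan_union (A B : Set (M × ℝ → F)) :
    fieldSpan n U (A ∪ B) = fieldSpan n U A ⊔ fieldSpan n U B :=
  le_antisymm (fieldSpan_le (union_subset ((subset_fieldSpan A).trans (SetLike.coe_subset_coe.2
      le_sup_left)) ((subset_fieldSpan B).trans (SetLike.coe_subset_coe.2 le_sup_right)))
      ((fieldSpan_mono (empty_subset A)).trans le_sup_left))
    (sup_le (fieldSpan_mono subset_union_left) (fieldSpan_mono subset_union_right))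

theorem mem_of_eqOn {W : Submodule (smoothRing n U) (M × ℝ → F)} (hW : fieldSpan n U ∅ ≤ W)
    {X Y : M × ℝ → F} (hX : X ∈ W) (h : ∀ z ∈ U, Y z = X z) : Y ∈ W := by
  have h1 : Y - X ∈ W := hW (mem_fieldSpan_of_eqOn_zero _ fun z hz => by simp [h z hz])
  simpa using W.add_mem h1 hX

theorem fiber_mono {W W' : Submodule (smoothRing n U) (M × ℝ → F)} (h : W ≤ W') (z : M × ℝ) :
    fiber W z ≤ fiber W' z :=
  Submodule.span_mono (image_mono h)

theorem apply_mem_fiber {W : Submodule (smoothRing n U) (M × ℝ → F)} {X : M × ℝ → F} (hX : X ∈ W)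
    (z : M × ℝ) : X z ∈ fiber W z :=
  Submodule.subset_span ⟨X, hX, rfl⟩

theorem fiber_fieldSpan (A : Set (M × ℝ → F)) {z : M × ℝ} (hz : z ∈ U) :
    fiber (fieldSpan n U A) z = Submodule.span ℝ ((fun X : M × ℝ → F => X z) '' A) := by
  refine le_antisymm (Submodule.span_le.2 ?_) (Submodule.span_mono (image_mono (subset_fieldSpan A)))
  rintro _ ⟨X, hX, rfl⟩
  refine Submodule.span_induction (p := fun X _ => X z ∈
    Submodule.span ℝ ((fun X : M × ℝ → F => X z) '' A)) ?_ ?_ ?_ ?_ hX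
  · rintro Y (hY | hY)
    · exact Submodule.subset_span ⟨Y, hY, rfl⟩
    · rw [hY z hz]; exact Submodule.zero_mem _
  · exact Submodule.zero_mem _
  · intro Y Z _ _ hY hZ
    exact Submodule.add_mem _ hY hZ
  · intro c Y _ hY
    exact Submodule.smul_mem _ (c.1 z) hY

/-- A field is smooth on `U` when read through the transformations `T`. -/
def SmoothVia (T : M → EuclideanSpace ℝ (Fin n) × ℝ → F →ₗ[ℝ] F) (U : Set (M × ℝ))
    (v : M × ℝ → F) : Prop :=
  ∀ z ∈ U, ContDiffAt ℝ ∞ (fun q => T z.1 q (v (ofChart z.1 q))) (toChart z.1 z)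

variable [FiniteDimensional ℝ F] {T : M → EuclideanSpace ℝ (Fin n) × ℝ → F →ₗ[ℝ] F}
  {ι : Type*} [Fintype ι] {v : ι → M × ℝ → F} {w : M × ℝ → F}

/-- The injective maps `T`, the passage to coordinates, preserve dimensions and linear relations, so
the coefficients found in the chart serve for the fields themselves. -/
theorem exists_local_coeff
    (hT : ∀ x₀ q, q.1 ∈ (extChartAt (𝓡 n) x₀).target → Function.Injective (T x₀ q))
    (hU : IsOpen U) (hv : ∀ i, SmoothVia T U (v i)) (hw : SmoothVia T U w)
    {d : ℕ} (hd : ∀ z ∈ U, Module.finrank ℝ (Submodule.span ℝ (range fun i => v i z)) = d)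
    {z : M × ℝ} (hz : z ∈ U) :
    ∃ c : ι → EuclideanSpace ℝ (Fin n) × ℝ → ℝ, (∀ i, ContDiffAt ℝ ∞ (c i) (toChart z.1 z)) ∧
      ∀ᶠ q in 𝓝 (toChart (n := n) z.1 z),
        w (ofChart z.1 q) ∈ Submodule.span ℝ (range fun i => v i (ofChart z.1 q)) →
          ∑ i, c i q • v i (ofChart z.1 q) = w (ofChart z.1 q) ∧
            ∀ k : ι → ℝ, ∑ i, k i • v i (ofChart z.1 q) = 0 → ∑ i, k i * c i q = 0 := by
  have hspan : ∀ q, Submodule.span ℝ (range fun i => T z.1 q (v i (ofChart z.1 q))) =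
      (Submodule.span ℝ (range fun i => v i (ofChart z.1 q))).map (T z.1 q) := fun q => by
    rw [Submodule.map_span, ← range_comp]; rfl
  obtain ⟨c, hc, h⟩ := exists_contDiffAt_coeff (fun i => hv i z hz) (hw z hz) (d := d) (by
    filter_upwards [eventually_mem_chartDom hU hz] with q hq
    rw [hspan, ← hd _ hq.2]
    exact (Submodule.equivMapOfInjective (T z.1 q) (hT _ _ hq.1) _).symm.finrank_eq)
  refine ⟨c, hc, ?_⟩
  filter_upwards [h, eventually_mem_chartDom hU hz] with q hq hqU hmem
  obtain ⟨h1, h2⟩ := hq (by rw [hspan]; exact Submodule.mem_map_of_mem hmem)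
  refine ⟨hT _ _ hqU.1 ?_, fun k hk => h2 k ?_⟩
  · rw [← h1, map_sum]; simp
  · rw [← map_zero (T z.1 q), ← hk, map_sum]; simp

/-- Membership of a smooth field in the span of smooth fields of constant rank is a closed
condition. -/
theorem mem_span_of_frequently
    (hT : ∀ x₀ q, q.1 ∈ (extChartAt (𝓡 n) x₀).target → Function.Injective (T x₀ q))
    (hU : IsOpen U) (hv : ∀ i, SmoothVia T U (v i))
    (hw : SmoothVia T U w) {d : ℕ}
    (hd : ∀ z ∈ U, Module.finrank ℝ (Submodule.span ℝ (range fun i => v i z)) = d)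
    {z : M × ℝ} (hz : z ∈ U)
    (hfreq : ∃ᶠ y in 𝓝 z, w y ∈ Submodule.span ℝ (range fun i => v i y)) :
    w z ∈ Submodule.span ℝ (range fun i => v i z) := by
  obtain ⟨c, hc, h⟩ := exists_local_coeff hT hU hv hw hd hz
  -- The defect between `w` and the combination with the local smooth coefficients is continuous,
  -- and it vanishes wherever membership holds, hence at points arbitrarily near `z`.
  have hcont : ContinuousAt (fun q => ∑ i, c i q • T z.1 q (v i (ofChart z.1 q)) -
      T z.1 q (w (ofChart z.1 q))) (toChart z.1 z) := by
    refine ContinuousAt.sub ?_ (hw z hz).continuousAt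
    exact tendsto_finsetSum _ fun i _ => (hc i).continuousAt.smul (hv i z hz).continuousAt
  have hsrc : ∀ᶠ y in 𝓝 z, ofChart z.1 (toChart (n := n) z.1 y) = y := by
    have : Prod.fst ⁻¹' (extChartAt (𝓡 n) z.1).source ∈ 𝓝 z :=
      continuousAt_fst (extChartAt_source_mem_nhds z.1)
    filter_upwards [this] with y hy
    exact ofChart_toChart' hy
  have hzero : ∃ᶠ q in 𝓝 (toChart (n := n) z.1 z), ∑ i, c i q • T z.1 q (v i (ofChart z.1 q)) -
      T z.1 q (w (ofChart z.1 q)) = 0 := by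
    refine (continuousAt_toChart z).frequently ?_
    refine (hfreq.and_eventually (hsrc.and ((continuousAt_toChart z).eventually h))).mono ?_
    rintro y ⟨hy, hsy, hloc⟩
    rw [hsy] at hloc
    rw [hsy, ← (hloc hy).1, map_sum]
    simp
  have h0 : ∑ i, c i (toChart z.1 z) • T z.1 (toChart z.1 z) (v i (ofChart (n := n) z.1 (toChart z.1 z))) -
      T z.1 (toChart z.1 z) (w (ofChart (n := n) z.1 (toChart z.1 z))) = 0 := by
    by_contra hne
    exact hzero (hcont.eventually_ne hne)
  rw [ofChart_toChart, sub_eq_zero] at h0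
  have h1 : ∑ i, c i (toChart z.1 z) • v i z = w z := by
    apply hT z.1 (toChart z.1 z) (mem_extChartAt_target z.1)
    rw [← h0, map_sum]
    simp
  exact (Submodule.mem_span_range_iff_exists_fun ℝ).2 ⟨_, h1⟩

theorem mem_fiber_of_frequently
    (hT : ∀ x₀ q, q.1 ∈ (extChartAt (𝓡 n) x₀).target → Function.Injective (T x₀ q))
    (hU : IsOpen U) {A : Set (M × ℝ → F)} (hfin : A.Finite)
    (hA : ∀ v ∈ A, SmoothVia T U v) (hw : SmoothVia T U w) {d : ℕ}
    (hd : ∀ z ∈ U, Module.finrank ℝ (fiber (fieldSpan n U A) z) = d) {z : M × ℝ} (hz : z ∈ U)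
    (hfreq : ∃ᶠ y in 𝓝 z, w y ∈ fiber (fieldSpan n U A) y) : w z ∈ fiber (fieldSpan n U A) z := by
  have := hfin.fintype
  have hfib : ∀ z ∈ U, fiber (fieldSpan n U A) z =
      Submodule.span ℝ (range fun a : A => a.1 z) := fun z hz => by
    rw [fiber_fieldSpan A hz, image_eq_range]
  rw [hfib z hz]
  refine mem_span_of_frequently (v := fun a : A => a.1) hT hU (fun a => hA a.1 a.2) hw (d := d)
    (fun z hz => by rw [← hfib z hz]; exact hd z hz) hz ?_
  refine (hfreq.and_eventually (hU.mem_nhds hz)).mono fun y hy => ?_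
  rw [← hfib y hy.2]
  exact hy.1

variable [IsManifold (𝓡 n) ∞ M]

/-- A smooth field with values in the span of smooth fields of constant rank is a combination of
these with smooth coefficients. -/
theorem exists_smooth_coeff
    (hT : ∀ x₀ q, q.1 ∈ (extChartAt (𝓡 n) x₀).target → Function.Injective (T x₀ q))
    (hU : IsOpen U) (hv : ∀ i, SmoothVia T U (v i)) (hw : SmoothVia T U w)
    {d : ℕ} (hd : ∀ z ∈ U, Module.finrank ℝ (Submodule.span ℝ (range fun i => v i z)) = d)
    (hmem : ∀ z ∈ U, w z ∈ Submodule.span ℝ (range fun i => v i z)) :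
    ∃ c : ι → M × ℝ → ℝ, (∀ i, SmoothScalarOn n U (c i)) ∧ ∀ z ∈ U, ∑ i, c i z • v i z = w z := by
  have hex : ∀ z, ∃ c : ι → ℝ, z ∈ U → ∑ i, c i • v i z = w z ∧
      ∀ k : ι → ℝ, ∑ i, k i • v i z = 0 → ∑ i, k i * c i = 0 := by
    intro z
    by_cases hz : z ∈ U
    · obtain ⟨c, -, h⟩ := exists_local_coeff hT hU hv hw hd hz
      have := h.self_of_nhds
      rw [ofChart_toChart] at this
      exact ⟨fun i => c i (toChart z.1 z), fun _ => this (hmem z hz)⟩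
    · exact ⟨0, fun h => absurd h hz⟩
  choose c hc using hex
  refine ⟨fun i z => c z i, fun i => smoothScalarOn_of_contDiffAt fun z hz => ?_,
    fun z hz => (hc z hz).1⟩
  obtain ⟨c', hc', h⟩ := exists_local_coeff hT hU hv hw hd hz
  refine (hc' i).congr_of_eventuallyEq ?_
  filter_upwards [h, eventually_mem_chartDom hU hz] with q hq hqU
  obtain ⟨a1, a2⟩ := hq (hmem _ hqU.2)
  obtain ⟨b1, b2⟩ := hc _ hqU.2
  -- The difference of the two coefficient vectors is a relation among the `v j`, hence orthogonal
  -- to both vectors and so to itself. Thus the pointwise choice `c` agrees with the local smooth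
  -- one `c'`.
  have hk : ∑ j, (c (ofChart z.1 q) j - c' j q) • v j (ofChart z.1 q) = 0 := by
    simp only [sub_smul, Finset.sum_sub_distrib, a1, b1, sub_self]
  have h0 : ∑ j, (c (ofChart z.1 q) j - c' j q) * (c (ofChart z.1 q) j - c' j q) = 0 := by
    have e1 := a2 _ hk
    have e2 := b2 _ hk
    have : ∀ j, (c (ofChart z.1 q) j - c' j q) * (c (ofChart z.1 q) j - c' j q) =
      (c (ofChart z.1 q) j - c' j q) * c (ofChart z.1 q) j -
        (c (ofChart z.1 q) j - c' j q) * c' j q := fun j => by ring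
    simp only [this, Finset.sum_sub_distrib, e1, e2, sub_self]
  have h1 := (Finset.sum_eq_zero_iff_of_nonneg fun j _ => mul_self_nonneg _).1 h0 i
    (Finset.mem_univ i)
  exact sub_eq_zero.1 (mul_self_eq_zero.1 h1)

/-- The passage from pointwise membership to membership over the ring of smooth functions: the
coefficients are smooth on all of `U`, thanks to the constant dimension. -/
theorem mem_fieldSpan_of_forall_mem_fiber
    (hT : ∀ x₀ q, q.1 ∈ (extChartAt (𝓡 n) x₀).target → Function.Injective (T x₀ q))
    (hU : IsOpen U) {A : Set (M × ℝ → F)} (hfin : A.Finite)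
    (hA : ∀ v ∈ A, SmoothVia T U v) (hw : SmoothVia T U w) {d : ℕ}
    (hd : ∀ z ∈ U, Module.finrank ℝ (fiber (fieldSpan n U A) z) = d)
    (hmem : ∀ z ∈ U, w z ∈ fiber (fieldSpan n U A) z) : w ∈ fieldSpan n U A := by
  have := hfin.fintype
  have hfib : ∀ z ∈ U, fiber (fieldSpan n U A) z =
      Submodule.span ℝ (range fun a : A => a.1 z) := fun z hz => by
    rw [fiber_fieldSpan A hz, image_eq_range]
  obtain ⟨c, hc, h⟩ := exists_smooth_coeff (v := fun a : A => a.1) hT hU (fun a => hA a.1 a.2) hw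
    (d := d) (fun z hz => by rw [← hfib z hz]; exact hd z hz)
    (fun z hz => by rw [← hfib z hz]; exact hmem z hz)
  have hsum : ∑ a : A, (⟨c a, hc a⟩ : smoothRing n U) • a.1 ∈ fieldSpan n U A :=
    Submodule.sum_mem _ fun a _ => Submodule.smul_mem _ _ (subset_fieldSpan A a.2)
  refine mem_of_eqOn (fieldSpan_mono (empty_subset A)) hsum fun z hz => ?_
  rw [← h z hz, Finset.sum_apply]
  rfl

/-- Nested modules of fields whose dimensions agree are equal. -/
theorem fieldSpan_eq_of_finrank_eq
    (hT : ∀ x₀ q, q.1 ∈ (extChartAt (𝓡 n) x₀).target → Function.Injective (T x₀ q))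
    (hU : IsOpen U) {A B : Set (M × ℝ → F)} (hfin : A.Finite)
    (hA : ∀ v ∈ A, SmoothVia T U v) (hB : ∀ v ∈ B, SmoothVia T U v)
    (hle : fieldSpan n U A ≤ fieldSpan n U B) {d : ℕ}
    (hdA : ∀ z ∈ U, Module.finrank ℝ (fiber (fieldSpan n U A) z) = d)
    (hdB : ∀ z ∈ U, Module.finrank ℝ (fiber (fieldSpan n U B) z) = d) :
    fieldSpan n U B = fieldSpan n U A := by
  refine le_antisymm (fieldSpan_le (fun w hw => ?_) (fieldSpan_mono (empty_subset A))) hle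
  refine mem_fieldSpan_of_forall_mem_fiber hT hU hfin hA (hB w hw) hdA fun z hz => ?_
  rw [Submodule.eq_of_le_of_finrank_eq (fiber_mono hle z) (by rw [hdA z hz, hdB z hz])]
  exact apply_mem_fiber (subset_fieldSpan B hw) z

end Fields

/-! ### Finitely generated codistributions and distributions; stationary chains -/

section Spans

variable {n : ℕ} {M : Type*} [TopologicalSpace M] [ChartedSpace (EuclideanSpace ℝ (Fin n)) M]
  {U : Set (M × ℝ)}

theorem subset_covSpan (A : Set (CovField n M)) : A ⊆ covSpan U A :=
  subset_fieldSpan (F := EuclideanSpace ℝ (Fin n) →L[ℝ] ℝ) A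

theorem subset_vecSpan (A : Set (VecField n M)) : A ⊆ vecSpan U A := subset_fieldSpan A

theorem covSpan_mono {A B : Set (CovField n M)} (h : A ⊆ B) : covSpan U A ≤ covSpan U B :=
  fieldSpan_mono (F := EuclideanSpace ℝ (Fin n) →L[ℝ] ℝ) h

theorem vecSpan_mono {A B : Set (VecField n M)} (h : A ⊆ B) : vecSpan U A ≤ vecSpan U B :=
  fieldSpan_mono h

theorem covSpan_le {A : Set (CovField n M)} {W : Codist n U} (hA : A ⊆ W)
    (hW : covSpan U ∅ ≤ W) : covSpan U A ≤ W :=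
  fieldSpan_le (F := EuclideanSpace ℝ (Fin n) →L[ℝ] ℝ) hA hW

theorem vecSpan_le {A : Set (VecField n M)} {W : Dist n U} (hA : A ⊆ W)
    (hW : vecSpan U ∅ ≤ W) : vecSpan U A ≤ W := fieldSpan_le hA hW

theorem covSpan_union (A B : Set (CovField n M)) :
    covSpan U (A ∪ B) = covSpan U A ⊔ covSpan U B :=
  fieldSpan_union (F := EuclideanSpace ℝ (Fin n) →L[ℝ] ℝ) A B

theorem cov_mem_of_eqOn {W : Codist n U} (hW : covSpan U ∅ ≤ W) {θ η : CovField n M}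
    (hθ : θ ∈ W) (h : ∀ z ∈ U, η z = θ z) : η ∈ W :=
  mem_of_eqOn (F := EuclideanSpace ℝ (Fin n) →L[ℝ] ℝ) hW hθ h

theorem vec_mem_of_eqOn {W : Dist n U} (hW : vecSpan U ∅ ≤ W) {X Y : VecField n M}
    (hX : X ∈ W) (h : ∀ z ∈ U, Y z = X z) : Y ∈ W :=
  mem_of_eqOn (F := EuclideanSpace ℝ (Fin n)) hW hX h

/-- The values at `z` of a codistribution. -/
def covFiber (W : Codist n U) (z : M × ℝ) : Submodule ℝ (EuclideanSpace ℝ (Fin n) →L[ℝ] ℝ) :=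
  fiber W z

/-- The values at `z` of a distribution. -/
def vecFiber (D : Dist n U) (z : M × ℝ) : Submodule ℝ (EuclideanSpace ℝ (Fin n)) :=
  fiber D z

theorem codistDim_eq (W : Codist n U) (z : M × ℝ) :
    codistDim W z = Module.finrank ℝ (covFiber W z) := rfl

theorem distDim_eq (D : Dist n U) (z : M × ℝ) :
    distDim D z = Module.finrank ℝ (vecFiber D z) := rfl

theorem covAt_mem_covFiber {W : Codist n U} {θ : CovField n M} (hθ : θ ∈ W) (z : M × ℝ) :
    covAt θ z ∈ covFiber W z :=
  apply_mem_fiber (F := EuclideanSpace ℝ (Fin n) →L[ℝ] ℝ) hθ z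

theorem vecAt_mem_vecFiber {D : Dist n U} {X : VecField n M} (hX : X ∈ D) (z : M × ℝ) :
    vecAt X z ∈ vecFiber D z :=
  apply_mem_fiber (F := EuclideanSpace ℝ (Fin n)) hX z

theorem covFiber_mono {W W' : Codist n U} (h : W ≤ W') (z : M × ℝ) :
    covFiber W z ≤ covFiber W' z :=
  fiber_mono h z

theorem vecFiber_mono {W W' : Dist n U} (h : W ≤ W') (z : M × ℝ) :
    vecFiber W z ≤ vecFiber W' z :=
  fiber_mono h z

theorem codistDim_mono {W W' : Codist n U} (h : W ≤ W') (z : M × ℝ) :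
    codistDim W z ≤ codistDim W' z := by
  rw [codistDim_eq, codistDim_eq]
  exact Submodule.finrank_mono (covFiber_mono h z)

theorem distDim_mono {D D' : Dist n U} (h : D ≤ D') (z : M × ℝ) :
    distDim D z ≤ distDim D' z := by
  rw [distDim_eq, distDim_eq]
  exact Submodule.finrank_mono (vecFiber_mono h z)

theorem covFiber_covSpan (A : Set (CovField n M)) {z : M × ℝ} (hz : z ∈ U) :
    covFiber (covSpan U A) z = Submodule.span ℝ ((fun θ => covAt θ z) '' A) :=
  fiber_fieldSpan (F := EuclideanSpace ℝ (Fin n) →L[ℝ] ℝ) A hz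

theorem vecFiber_vecSpan (A : Set (VecField n M)) {z : M × ℝ} (hz : z ∈ U) :
    vecFiber (vecSpan U A) z = Submodule.span ℝ ((fun X => vecAt X z) '' A) :=
  fiber_fieldSpan (F := EuclideanSpace ℝ (Fin n)) A hz

theorem codistDim_le (W : Codist n U) (z : M × ℝ) : codistDim W z ≤ n := by
  rw [codistDim_eq]
  refine (Submodule.finrank_le _).trans (le_of_eq ?_)
  have h : Module.finrank ℝ (EuclideanSpace ℝ (Fin n) →L[ℝ] ℝ) =
      Module.finrank ℝ (Module.Dual ℝ (EuclideanSpace ℝ (Fin n))) :=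
    LinearMap.toContinuousLinearMap.symm.finrank_eq
  rw [h, Subspace.dual_finrank_eq, finrank_euclideanSpace_fin]

theorem distDim_le (D : Dist n U) (z : M × ℝ) : distDim D z ≤ n := by
  rw [distDim_eq]
  exact (Submodule.finrank_le _).trans (le_of_eq finrank_euclideanSpace_fin)

/-- The passage to coordinates of vectors, at the point with coordinates `q`. -/
def vecCoords (x₀ : M) (q : EuclideanSpace ℝ (Fin n) × ℝ) :
    EuclideanSpace ℝ (Fin n) →ₗ[ℝ] EuclideanSpace ℝ (Fin n) :=
  (chartInvJac x₀ q.1).inverse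

/-- The passage to coordinates of covectors, at the point with coordinates `q`. -/
def covCoords (x₀ : M) (q : EuclideanSpace ℝ (Fin n) × ℝ) :
    (EuclideanSpace ℝ (Fin n) →L[ℝ] ℝ) →ₗ[ℝ] (EuclideanSpace ℝ (Fin n) →L[ℝ] ℝ) where
  toFun A := A.comp (chartInvJac x₀ q.1)
  map_add' _ _ := ContinuousLinearMap.add_comp _ _ _
  map_smul' _ _ := ContinuousLinearMap.smul_comp _ _ _

/-- The codistributions generated by the differentials of finitely many smooth functions. -/
def GradGenerated (W : Codist n U) : Prop :=
  ∃ Λ : Set (ScalarField M), Λ.Finite ∧ (∀ h ∈ Λ, SmoothScalarOn n U h) ∧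
    W = covSpan U (grad '' Λ)

/-- The distributions generated by finitely many smooth vector fields. -/
def VecGenerated [IsManifold (𝓡 n) ∞ M] (D : Dist n U) : Prop :=
  ∃ A : Set (VecField n M), A.Finite ∧ (∀ X ∈ A, SmoothVecOn U X) ∧ D = vecSpan U A

theorem GradGenerated.null_le {W : Codist n U} (hW : GradGenerated W) : covSpan U ∅ ≤ W := by
  obtain ⟨Λ, -, -, rfl⟩ := hW
  exact covSpan_mono (empty_subset _)

/-- One step of a recursion that adds to a codistribution its derivatives along vector fields. -/
def codistStep {κ : Type*} (X : κ → VecField n M) (ε : κ → ℝ) (W : Codist n U) : Codist n U :=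
  W ⊔ ⨆ k, covSpan U ((fun θ => evolCov (X k) (ε k) θ) '' (W : Set (CovField n M)))

theorem le_codistStep {κ : Type*} (X : κ → VecField n M) (ε : κ → ℝ) (W : Codist n U) :
    W ≤ codistStep X ε W := le_sup_left

theorem evolCov_mem_codistStep {κ : Type*} (X : κ → VecField n M) (ε : κ → ℝ) {W : Codist n U}
    (k : κ) {θ : CovField n M} (hθ : θ ∈ W) : evolCov (X k) (ε k) θ ∈ codistStep X ε W :=
  le_sup_right (a := W) (le_iSup (fun k => covSpan U ((fun θ => evolCov (X k) (ε k) θ) ''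
    (W : Set (CovField n M)))) k (subset_covSpan _ ⟨θ, hθ, rfl⟩))

theorem codistStep_le {κ : Type*} {X : κ → VecField n M} {ε : κ → ℝ} {W W' : Codist n U}
    (hnull : covSpan U ∅ ≤ W') (hle : W ≤ W')
    (h : ∀ k, ∀ θ ∈ W, evolCov (X k) (ε k) θ ∈ W') : codistStep X ε W ≤ W' := by
  refine sup_le hle (iSup_le fun k => covSpan_le ?_ hnull)
  rintro _ ⟨θ, hθ, rfl⟩
  exact h k θ hθ

theorem codistStep_mono {κ : Type*} (X : κ → VecField n M) (ε : κ → ℝ) {W W' : Codist n U}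
    (hle : W ≤ W') : codistStep X ε W ≤ codistStep X ε W' :=
  sup_le_sup hle (iSup_mono fun _ => covSpan_mono (image_mono hle))

theorem lieCodist_eq (X : VecField n M) (W : Codist n U) :
    lieCodist X W = covSpan U ((fun θ => evolCov X 0 θ) '' (W : Set (CovField n M))) := by
  have : ∀ θ, evolCov X 0 θ = lieCov X θ := fun θ => by simp [evolCov]
  simp only [this]
  rfl

theorem lieDtCodist_eq (X : VecField n M) (W : Codist n U) :
    lieDtCodist X W = covSpan U ((fun θ => evolCov X 1 θ) '' (W : Set (CovField n M))) := by
  have : ∀ θ, evolCov X 1 θ = lieCov X θ + dtCov θ := fun θ => by simp [evolCov]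
  simp only [this]
  rfl

/-- The coefficient of `∂/∂t` in the operator of index `β`. -/
def timeCoeff {mw : ℕ} (β : Fin (mw + 1)) : ℝ := if β = 0 then 1 else 0

/-- `timeCoeff` absorbs the exceptional index 0, so that the step is a single supremum over all
indices. -/
theorem sup_lieCodistSum {mw : ℕ} (X : Fin (mw + 1) → VecField n M) (W : Codist n U) :
    W ⊔ lieCodistSum X W = codistStep X timeCoeff W := by
  rw [codistStep, lieCodistSum, lieDtCodist_eq]
  simp only [lieCodist_eq]
  congr 1
  refine le_antisymm (sup_le ?_ (iSup_le fun j => ?_)) (iSup_le fun β => ?_)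
  · exact le_iSup (fun k => covSpan U ((fun θ => evolCov (X k) (timeCoeff k) θ) '' _)) 0 |>.trans'
      (by simp [timeCoeff])
  · exact le_iSup (fun k => covSpan U ((fun θ => evolCov (X k) (timeCoeff k) θ) '' _)) j.succ
      |>.trans' (by simp [timeCoeff])
  · refine Fin.cases ?_ (fun j => ?_) β
    · simp [timeCoeff]
    · refine le_sup_of_le_right (le_iSup_of_le j ?_)
      simp [timeCoeff]

theorem sup_lieCodist_sup_lieCodistSum {mu mw : ℕ} (Y : Fin mu → VecField n M)
    (X : Fin (mw + 1) → VecField n M) (W : Codist n U) :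
    W ⊔ (⨆ i, lieCodist (Y i) W) ⊔ lieCodistSum X W =
      codistStep (Sum.elim Y X) (Sum.elim 0 timeCoeff) W := by
  have h := sup_lieCodistSum X W
  rw [sup_right_comm, h, codistStep, codistStep, sup_assoc, iSup_sum,
    sup_comm (⨆ k, covSpan U _) (⨆ i, lieCodist (Y i) W)]
  simp only [lieCodist_eq]
  rfl

variable [IsManifold (𝓡 n) ∞ M]

theorem vecCoords_injective (x₀ : M) (q : EuclideanSpace ℝ (Fin n) × ℝ)
    (hq : q.1 ∈ (extChartAt (𝓡 n) x₀).target) : Function.Injective (vecCoords x₀ q) := by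
  intro v w h
  have h' : (chartInvJac x₀ q.1).inverse v = (chartInvJac x₀ q.1).inverse w := h
  rw [chartInvJac_inverse hq] at h'
  have e := fun v => congrArg (fun A => A v) (chartInvJac_comp_chartJac hq)
  exact (e v).symm.trans ((congrArg (chartInvJac x₀ q.1) h').trans (e w))

theorem covCoords_injective (x₀ : M) (q : EuclideanSpace ℝ (Fin n) × ℝ)
    (hq : q.1 ∈ (extChartAt (𝓡 n) x₀).target) : Function.Injective (covCoords x₀ q) := by
  intro A B h
  have h' : A.comp (chartInvJac x₀ q.1) = B.comp (chartInvJac x₀ q.1) := h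
  have e := congrArg (fun C => C.comp (chartJac x₀ ((extChartAt (𝓡 n) x₀).symm q.1))) h'
  simpa only [ContinuousLinearMap.comp_assoc, chartInvJac_comp_chartJac hq,
    ContinuousLinearMap.comp_id] using e

theorem SmoothVecOn.smoothVia (hU : IsOpen U) {X : VecField n M} (hX : SmoothVecOn U X) :
    SmoothVia (n := n) vecCoords U (vecAt X) :=
  fun _ hz => hX.contDiffAt hU (toChart_mem_chartDom hz)

theorem SmoothScalarOn.smoothVia_grad (hU : IsOpen U) {h : ScalarField M}
    (hh : SmoothScalarOn n U h) : SmoothVia (n := n) covCoords U (covAt (grad h)) :=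
  fun _ hz => contDiffAt_covRep_grad hU hh hz

theorem GradGenerated.grad_mem (hU : IsOpen U) {W : Codist n U} (hW : GradGenerated W)
    {d : ℕ} (hd : ∀ z ∈ U, codistDim W z = d) {h : ScalarField M} (hh : SmoothScalarOn n U h)
    (hmem : ∀ z ∈ U, covAt (grad h) z ∈ covFiber W z) : grad h ∈ W := by
  obtain ⟨Λ, hfin, hΛ, rfl⟩ := hW
  exact mem_fieldSpan_of_forall_mem_fiber (F := EuclideanSpace ℝ (Fin n) →L[ℝ] ℝ)
    covCoords_injective hU (hfin.image _)
    (by rintro _ ⟨h, hh, rfl⟩; exact (hΛ h hh).smoothVia_grad hU) (hh.smoothVia_grad hU) hd hmem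

theorem GradGenerated.mem_covFiber_of_frequently (hU : IsOpen U) {W : Codist n U}
    (hW : GradGenerated W) {d : ℕ} (hd : ∀ z ∈ U, codistDim W z = d) {h : ScalarField M}
    (hh : SmoothScalarOn n U h) {z : M × ℝ} (hz : z ∈ U)
    (hfreq : ∃ᶠ y in 𝓝 z, covAt (grad h) y ∈ covFiber W y) :
    covAt (grad h) z ∈ covFiber W z := by
  obtain ⟨Λ, hfin, hΛ, rfl⟩ := hW
  exact mem_fiber_of_frequently (F := EuclideanSpace ℝ (Fin n) →L[ℝ] ℝ)
    covCoords_injective hU (hfin.image _)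
    (by rintro _ ⟨h, hh, rfl⟩; exact (hΛ h hh).smoothVia_grad hU) (hh.smoothVia_grad hU) hd hz hfreq

theorem GradGenerated.eq_of_codistDim_eq (hU : IsOpen U) {W W' : Codist n U}
    (hW : GradGenerated W) (hW' : GradGenerated W') (hle : W ≤ W') {d : ℕ}
    (hd : ∀ z ∈ U, codistDim W z = d) (hd' : ∀ z ∈ U, codistDim W' z = d) : W' = W := by
  obtain ⟨Λ, hfin, hΛ, rfl⟩ := hW
  obtain ⟨Λ', hfin', hΛ', rfl⟩ := hW'
  exact fieldSpan_eq_of_finrank_eq (F := EuclideanSpace ℝ (Fin n) →L[ℝ] ℝ)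
    covCoords_injective hU (hfin.image _)
    (by rintro _ ⟨h, hh, rfl⟩; exact (hΛ h hh).smoothVia_grad hU)
    (by rintro _ ⟨h, hh, rfl⟩; exact (hΛ' h hh).smoothVia_grad hU) hle hd hd'

theorem VecGenerated.eq_of_distDim_eq (hU : IsOpen U) {D D' : Dist n U}
    (hD : VecGenerated D) (hD' : VecGenerated D') (hle : D ≤ D') {d : ℕ}
    (hd : ∀ z ∈ U, distDim D z = d) (hd' : ∀ z ∈ U, distDim D' z = d) : D' = D := by
  obtain ⟨A, hfin, hA, rfl⟩ := hD
  obtain ⟨A', hfin', hA', rfl⟩ := hD'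
  exact fieldSpan_eq_of_finrank_eq (F := EuclideanSpace ℝ (Fin n))
    vecCoords_injective hU hfin (fun X hX => (hA X hX).smoothVia hU)
    (fun X hX => (hA' X hX).smoothVia hU) hle hd hd'

/-- If a chain stops whenever its dimension does, it stops in time. -/
theorem exists_eq_succ_of_dim {α : Type*} (W : ℕ → α) (D : ℕ → ℕ) {n : ℕ} (hn : ∀ k, D k ≤ n)
    (h : ∀ k, W (k + 1) ≠ W k → D k < D (k + 1)) : ∃ k, W (k + 1) = W k ∧ D 0 + k ≤ n := by
  by_contra! hcon
  have : ∀ k, D 0 + k ≤ D k := by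
    intro k
    induction k with
    | zero => simp
    | succ k ih =>
      have h1 : W (k + 1) ≠ W k := fun he => by
        have := hcon k he
        have := hn k
        omega
      have := h k h1
      omega
  have h1 := this (n + 1)
  have h2 := hn (n + 1)
  omega

/-- Two nested members of equal dimension coincide, so each proper step raises the dimension, which
is at most `n`. As it is constant on `U`, watching it at `z₀` is enough; the starting dimension
sharpens the bound on `k`. -/
theorem exists_codist_eq_succ (hU : IsOpen U) {z₀ : M × ℝ} (hz₀ : z₀ ∈ U) (W : ℕ → Codist n U)
    (hW : ∀ k, GradGenerated (W k)) (hmono : ∀ k, W k ≤ W (k + 1))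
    (hd : ∀ k, ∃ d, ∀ z ∈ U, codistDim (W k) z = d) :
    ∃ k, W (k + 1) = W k ∧ codistDim (W 0) z₀ + k ≤ n := by
  refine exists_eq_succ_of_dim W (fun k => codistDim (W k) z₀) (fun k => codistDim_le _ _) ?_
  intro k hk
  obtain ⟨d, hd₀⟩ := hd k
  obtain ⟨d', hd₁⟩ := hd (k + 1)
  refine lt_of_le_of_ne (codistDim_mono (hmono k) z₀) fun he => hk ?_
  refine (hW k).eq_of_codistDim_eq hU (hW (k + 1)) (hmono k) hd₀ fun z hz => ?_
  rw [hd₁ z hz, ← hd₁ z₀ hz₀, ← hd₀ z₀ hz₀, he]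

theorem exists_dist_eq_succ (hU : IsOpen U) {z₀ : M × ℝ} (hz₀ : z₀ ∈ U) (W : ℕ → Dist n U)
    (hW : ∀ k, VecGenerated (W k)) (hmono : ∀ k, W k ≤ W (k + 1))
    (hd : ∀ k, ∃ d, ∀ z ∈ U, distDim (W k) z = d) : ∃ k, W (k + 1) = W k := by
  refine (exists_eq_succ_of_dim W (fun k => distDim (W k) z₀) (fun k => distDim_le _ _) ?_).imp
    fun k hk => hk.1
  intro k hk
  obtain ⟨d, hd₀⟩ := hd k
  obtain ⟨d', hd₁⟩ := hd (k + 1)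
  refine lt_of_le_of_ne (distDim_mono (hmono k) z₀) fun he => hk ?_
  refine (hW k).eq_of_distDim_eq hU (hW (k + 1)) (hmono k) hd₀ fun z hz => ?_
  rw [hd₁ z hz, ← hd₁ z₀ hz₀, ← hd₀ z₀ hz₀, he]

/-- The members of a span of differentiable fields are differentiable, and if the derivatives of
the generators lie in `W`, so do those of all the members. -/
theorem evolCov_mem_of_mem_covSpan (hU : IsOpen U) {X : VecField n M} (hX : SmoothVecOn U X) (ε : ℝ)
    {A : Set (CovField n M)} (hA : ∀ θ ∈ A, ∀ z ∈ U, CovDifferentiableAt θ z) {W : Codist n U}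
    (hAW : covSpan U A ≤ W) (hW : ∀ θ ∈ A, evolCov X ε θ ∈ W) {θ : CovField n M}
    (hθ : θ ∈ covSpan U A) :
    (∀ z ∈ U, CovDifferentiableAt θ z) ∧ evolCov X ε θ ∈ W := by
  have hnull : covSpan U ∅ ≤ W := (covSpan_mono (empty_subset A)).trans hAW
  have hzero : ∀ z ∈ U, CovDifferentiableAt (0 : CovField n M) z := fun z _ =>
    differentiableAt_const (0 : EuclideanSpace ℝ (Fin n) →L[ℝ] ℝ)
  have hevol0 : ∀ z ∈ U, evolCov X ε (0 : CovField n M) z = 0 := fun z hz => by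
    -- The Leibniz rule for 0 • 0 gives the derivative of the zero field.
    have h := evolCov_smul hU hX ε (c := fun _ => 0) contMDiffOn_const hz (hzero z hz)
    have h1 : evolScalar X ε (fun _ : M × ℝ => (0 : ℝ)) z = 0 := by
      have := evolScalar_ofChart hU X ε (h := fun _ : M × ℝ => (0 : ℝ)) contMDiffOn_const
        (toChart_mem_chartDom (n := n) hz)
      rw [ofChart_toChart] at this
      rw [this]
      have h2 : (fun _ : M × ℝ => (0 : ℝ)) ∘ ofChart (n := n) z.1 = fun _ => 0 := rfl
      rw [h2, fderiv_fun_const]; rfl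
    have h3 : (fun z => (0 : ℝ) • (0 : CovField n M) z) = 0 := by funext z; simp
    rw [h1, h3] at h
    simpa using h
  refine Submodule.span_induction (p := fun θ _ => (∀ z ∈ U, CovDifferentiableAt θ z) ∧
    evolCov X ε θ ∈ W) ?_ ?_ ?_ ?_ hθ
  · rintro η (hη | hη)
    · exact ⟨hA η hη, hW η hη⟩
    · refine ⟨fun z hz => (hzero z hz).congr hU hz hη, cov_mem_of_eqOn hnull W.zero_mem ?_⟩
      intro z hz
      rw [evolCov_congr hU hX ε hz (hzero z hz) hη, hevol0 z hz]; rfl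
  · exact ⟨hzero, cov_mem_of_eqOn hnull W.zero_mem hevol0⟩
  · intro η η' _ _ h h'
    refine ⟨fun z hz => (h.1 z hz).add (h'.1 z hz), cov_mem_of_eqOn hnull (W.add_mem h.2 h'.2) ?_⟩
    intro z hz
    exact evolCov_add hU hX ε hz (h.1 z hz) (h'.1 z hz)
  · intro c η hη h
    refine ⟨fun z hz => (h.1 z hz).smul hU c.2 hz, cov_mem_of_eqOn hnull
      (W.add_mem (W.smul_mem ⟨_, SmoothScalarOn.evolScalar hU hX ε c.2⟩ (hAW hη))
        (W.smul_mem c h.2)) ?_⟩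
    intro z hz
    exact evolCov_smul hU hX ε c.2 hz (h.1 z hz)

/-- Since differentiation along `X k` commutes with `grad`, it suffices to adjoin the derivatives of
the generating functions; by Leibniz, non-constant coefficients produce nothing new. -/
theorem GradGenerated.codistStep (hU : IsOpen U) {κ : Type*} [Finite κ] {X : κ → VecField n M}
    (hX : ∀ k, SmoothVecOn U (X k)) (ε : κ → ℝ) {W : Codist n U} (hW : GradGenerated W) :
    GradGenerated (codistStep X ε W) := by
  have hnull := hW.null_le
  obtain ⟨Λ, hfin, hΛ, rfl⟩ := hW
  refine ⟨Λ ∪ ⋃ k, evolScalar (X k) (ε k) '' Λ, hfin.union (finite_iUnion fun k => hfin.image _),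
    ?_, ?_⟩
  · rintro h (hh | hh)
    · exact hΛ h hh
    · obtain ⟨k, h', hh', rfl⟩ := mem_iUnion.1 hh
      exact (hΛ h' hh').evolScalar hU (hX k) (ε k)
  · refine le_antisymm (codistStep_le (covSpan_mono (empty_subset _))
      (covSpan_mono (image_mono subset_union_left)) fun k θ hθ => ?_) (covSpan_le ?_
        (hnull.trans le_sup_left))
    · refine (evolCov_mem_of_mem_covSpan hU (hX k) (ε k) ?_
        (covSpan_mono (image_mono subset_union_left)) ?_ hθ).2
      · rintro _ ⟨h, hh, rfl⟩ z hz
        exact covDifferentiableAt_grad hU (hΛ h hh) hz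
      · rintro _ ⟨h, hh, rfl⟩
        refine cov_mem_of_eqOn (covSpan_mono (empty_subset _)) (subset_covSpan _
          ⟨evolScalar (X k) (ε k) h, Or.inr (mem_iUnion.2 ⟨k, h, hh, rfl⟩), rfl⟩) fun z hz => ?_
        exact evolCov_grad hU (hX k) (ε k) (hΛ h hh) hz
    · rintro _ ⟨h, hh | hh, rfl⟩
      · exact le_codistStep X ε _ (subset_covSpan _ ⟨h, hh, rfl⟩)
      · obtain ⟨k, h', hh', rfl⟩ := mem_iUnion.1 hh
        refine cov_mem_of_eqOn (hnull.trans le_sup_left) (evolCov_mem_codistStep X ε k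
          (subset_covSpan (U := U) (grad '' Λ) ⟨h', hh', rfl⟩)) fun z hz => ?_
        exact (evolCov_grad hU (hX k) (ε k) (hΛ h' hh') hz).symm

end Spans

/-! ### Autobrackets, the tensors `μ` and `ν`, and generators of the recursions -/

namespace System

variable {n mu mw p : ℕ} {M : Type*} [TopologicalSpace M]
  [ChartedSpace (EuclideanSpace ℝ (Fin n)) M]

/-- The autobracket of a covector field, dual to that of vector fields. -/
def covAutobracket (S : System n mu mw p M) (σ : Fin mw → Fin p) (θ : CovField n M)
    (α : Fin (mw + 1)) : CovField n M :=
  fun z => ∑ β, S.nuTensor σ z α β • evolCov (S.g β) (timeCoeff β) θ z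

/-- The iterated autobracket of the differential of `h̃_q`. -/
def covIter (S : System n mu mw p M) (σ : Fin mw → Fin p) (q : Fin mw)
    (l : List (Fin (mw + 1))) : CovField n M :=
  l.foldl (S.covAutobracket σ) (grad (S.htilde σ q))

/-- The pairings of the iterated autobrackets of the `f^i` and of the differentials of the
`h̃_q`. -/
def pairIter (S : System n mu mw p M) (σ : Fin mw → Fin p) (i : Fin mu) (w : List (Fin (mw + 1)))
    (q : Fin mw) (v : List (Fin (mw + 1))) : ScalarField M :=
  pairing (S.covIter σ q v) (S.autobracketIter σ (S.f i) w)

/-- The standing assumptions on the system: smoothness on an open set and invertibility of the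
reconstructability matrix of the `h̃_q`. -/
structure Regular [IsManifold (𝓡 n) ∞ M] (S : System n mu mw p M) (U : Set (M × ℝ))
    (σ : Fin mw → Fin p) : Prop where
  isOpen : IsOpen U
  smooth : S.SmoothOn U
  rank_eq : ∀ z ∈ U, (S.reconstructabilityMatrix (S.htilde σ) z).rank = mw

variable {S : System n mu mw p M} {U : Set (M × ℝ)} {σ : Fin mw → Fin p}

theorem muTensor_zero (z : M × ℝ) (α : Fin (mw + 1)) : S.muTensor σ z α 0 = timeCoeff α := rfl

theorem muTensor_succ (z : M × ℝ) (α : Fin (mw + 1)) (j : Fin mw) :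
    S.muTensor σ z α j.succ = evolScalar (S.g α) (timeCoeff α) (S.htilde σ j) z := by
  change (if α = 0 then dtScalar (S.htilde σ j) z else 0) + lieScalar (S.g α) (S.htilde σ j) z =
    lieScalar (S.g α) (S.htilde σ j) z + timeCoeff α * dtScalar (S.htilde σ j) z
  by_cases h : α = 0 <;> simp [timeCoeff, h, add_comm]

theorem autobracketIter_append (φ : VecField n M) (w : List (Fin (mw + 1))) (α : Fin (mw + 1)) :
    S.autobracketIter σ φ (w ++ [α]) = S.autobracket σ (S.autobracketIter σ φ w) α := by
  simp [autobracketIter]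

theorem covIter_append (q : Fin mw) (v : List (Fin (mw + 1))) (α : Fin (mw + 1)) :
    S.covIter σ q (v ++ [α]) = S.covAutobracket σ (S.covIter σ q v) α := by
  simp [covIter]

theorem omegaG_succ (k : ℕ) :
    S.OmegaG U σ (k + 1) = codistStep S.g timeCoeff (S.OmegaG U σ k) :=
  sup_lieCodistSum S.g (S.OmegaG U σ k)

theorem obs_succ (k : ℕ) : S.Obs U σ (k + 1) =
    codistStep (Sum.elim S.f (S.ghat σ)) (Sum.elim 0 timeCoeff) (S.Obs U σ k) :=
  sup_lieCodist_sup_lieCodistSum S.f (S.ghat σ) (S.Obs U σ k)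

theorem omega_succ (k : ℕ) : S.Omega U σ (k + 1) =
    codistStep (Sum.elim S.f (S.ghat σ)) (Sum.elim 0 timeCoeff) (S.Omega U σ k) ⊔
      covSpan U {θ | ∃ (q : Fin mw) (i : Fin mu) (l : List (Fin (mw + 1))),
        l.length = k ∧ θ = lieCov (S.autobracketIter σ (S.f i) l) (grad (S.htilde σ q))} := by
  rw [← sup_lieCodist_sup_lieCodistSum S.f (S.ghat σ) (S.Omega U σ k)]
  rfl

theorem omegaG_le_succ (k : ℕ) : S.OmegaG U σ k ≤ S.OmegaG U σ (k + 1) := le_sup_left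

theorem delta_le_succ (k : ℕ) : S.Delta U σ k ≤ S.Delta U σ (k + 1) := le_sup_left

theorem obs_le_succ (k : ℕ) : S.Obs U σ k ≤ S.Obs U σ (k + 1) := by
  rw [obs_succ]; exact le_codistStep _ _ _

theorem omega_le_succ (k : ℕ) : S.Omega U σ k ≤ S.Omega U σ (k + 1) := by
  rw [omega_succ]; exact (le_codistStep _ _ _).trans le_sup_left

theorem omegaG_mono : Monotone (S.OmegaG U σ) := monotone_nat_of_le_succ omegaG_le_succ

theorem delta_mono : Monotone (S.Delta U σ) := monotone_nat_of_le_succ delta_le_succ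

theorem obs_mono : Monotone (S.Obs U σ) := monotone_nat_of_le_succ obs_le_succ

theorem omega_mono : Monotone (S.Omega U σ) := monotone_nat_of_le_succ omega_le_succ

theorem null_le_delta (k : ℕ) : vecSpan U ∅ ≤ S.Delta U σ k :=
  (vecSpan_mono (empty_subset _)).trans (delta_mono (Nat.zero_le k))

theorem null_le_omega (k : ℕ) : covSpan U ∅ ≤ S.Omega U σ k :=
  (covSpan_mono (empty_subset _)).trans (omega_mono (Nat.zero_le k))

/-- Each term is determined by the preceding one, so a single coincidence makes the sequence
stationary. This argument fails for `Omega`, whose step also depends on `k`. -/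
theorem omegaG_eq_of_le {k₀ : ℕ} (h : S.OmegaG U σ (k₀ + 1) = S.OmegaG U σ k₀) {k : ℕ}
    (hk : k₀ ≤ k) : S.OmegaG U σ k = S.OmegaG U σ k₀ := by
  induction k, hk using Nat.le_induction with
  | base => rfl
  | succ k _ ih => rw [omegaG_succ, ih, ← omegaG_succ, h]

theorem delta_eq_of_le {k₀ : ℕ} (h : S.Delta U σ (k₀ + 1) = S.Delta U σ k₀) {k : ℕ}
    (hk : k₀ ≤ k) : S.Delta U σ k = S.Delta U σ k₀ := by
  induction k, hk using Nat.le_induction with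
  | base => rfl
  | succ k _ ih =>
    refine Eq.trans ?_ h
    simp only [Delta, ih]

theorem obs_eq_of_le {k₀ : ℕ} (h : S.Obs U σ (k₀ + 1) = S.Obs U σ k₀) {k : ℕ}
    (hk : k₀ ≤ k) : S.Obs U σ k = S.Obs U σ k₀ := by
  induction k, hk using Nat.le_induction with
  | base => rfl
  | succ k _ ih => rw [obs_succ, ih, ← obs_succ, h]

theorem autobracketIter_mem_delta (i : Fin mu) (w : List (Fin (mw + 1))) :
    S.autobracketIter σ (S.f i) w ∈ S.Delta U σ w.length := by
  induction w using List.reverseRecOn with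
  | nil => exact subset_vecSpan _ ⟨i, rfl⟩
  | append_singleton w α ih =>
    rw [autobracketIter_append, List.length_append, List.length_singleton]
    refine le_sup_right (a := S.Delta U σ w.length) (le_iSup (fun β => S.autobracketDist σ
      (S.Delta U σ w.length) β) α (subset_vecSpan _ ⟨_, ih, rfl⟩))

variable [IsManifold (𝓡 n) ∞ M]

theorem Regular.smooth_g (hS : S.Regular U σ) (β : Fin (mw + 1)) : SmoothVecOn U (S.g β) :=
  hS.smooth.1 β

theorem Regular.smooth_f (hS : S.Regular U σ) (i : Fin mu) : SmoothVecOn U (S.f i) :=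
  hS.smooth.2.1 i

theorem Regular.smooth_h (hS : S.Regular U σ) (j : Fin p) : SmoothScalarOn n U (S.h j) :=
  hS.smooth.2.2 j

theorem Regular.smooth_htilde (hS : S.Regular U σ) (q : Fin mw) :
    SmoothScalarOn n U (S.htilde σ q) := hS.smooth.2.2 (σ q)

theorem Regular.smooth_muTensor (hS : S.Regular U σ) (α γ : Fin (mw + 1)) :
    SmoothScalarOn n U (fun z => S.muTensor σ z α γ) := by
  refine Fin.cases ?_ (fun j => ?_) γ
  · exact contMDiffOn_const
  · simp only [muTensor_succ]
    exact (hS.smooth_htilde j).evolScalar hS.isOpen (hS.smooth_g α) _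

/-- The column of index 0 of `μ` is the first basis vector, so the determinant is that of the
remaining block, the transposed reconstructability matrix of the `h̃_q`. -/
theorem Regular.det_muTensor_ne_zero (hS : S.Regular U σ) {z : M × ℝ} (hz : z ∈ U) :
    (S.muTensor σ z).det ≠ 0 := by
  rw [Matrix.det_succ_column_zero, Fin.sum_univ_succ]
  have h0 : ∀ i : Fin mw, S.muTensor σ z i.succ 0 = 0 := fun i => by
    rw [muTensor_zero]; simp [timeCoeff]
  have h1 : S.muTensor σ z 0 0 = 1 := by rw [muTensor_zero]; simp [timeCoeff]
  have h2 : (S.muTensor σ z).submatrix (Fin.succAbove 0) Fin.succ =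
      (S.reconstructabilityMatrix (S.htilde σ) z).transpose := by
    ext i j
    rw [Matrix.submatrix_apply, muTensor_succ]
    simp [reconstructabilityMatrix, evolScalar, timeCoeff]
  have h3 : Function.Surjective (S.reconstructabilityMatrix (S.htilde σ) z).mulVecLin := by
    rw [← LinearMap.range_eq_top]
    refine Submodule.eq_top_of_finrank_eq ?_
    rw [Module.finrank_fin_fun]
    exact hS.rank_eq z hz
  have h4 : IsUnit (S.reconstructabilityMatrix (S.htilde σ) z) :=
    Matrix.mulVec_surjective_iff_isUnit.1 h3
  simp only [h0, h1, h2, Matrix.det_transpose]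
  simpa using ((Matrix.isUnit_iff_isUnit_det _).1 h4).ne_zero

theorem Regular.mu_mul_nu (hS : S.Regular U σ) {z : M × ℝ} (hz : z ∈ U) :
    S.muTensor σ z * S.nuTensor σ z = 1 :=
  Matrix.mul_nonsing_inv _ (isUnit_iff_ne_zero.2 (hS.det_muTensor_ne_zero hz))

theorem Regular.nu_mul_mu (hS : S.Regular U σ) {z : M × ℝ} (hz : z ∈ U) :
    S.nuTensor σ z * S.muTensor σ z = 1 :=
  Matrix.nonsing_inv_mul _ (isUnit_iff_ne_zero.2 (hS.det_muTensor_ne_zero hz))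

/-- The column of index 0 of νμ = 1. Because of it, the combination by `ν` of the operators L_{g^β}
+ δ^β_0 ∂/∂t contains ∂/∂t exactly δ^α_0 times. -/
theorem Regular.nuTensor_zero (hS : S.Regular U σ) {z : M × ℝ} (hz : z ∈ U) (α : Fin (mw + 1)) :
    ∑ β, S.nuTensor σ z α β * timeCoeff β = timeCoeff α := by
  have h := congrFun (congrFun (hS.nu_mul_mu hz) α) 0
  rw [Matrix.mul_apply] at h
  simp only [muTensor_zero] at h
  rw [h, Matrix.one_apply, timeCoeff]

theorem Regular.smooth_nuTensor (hS : S.Regular U σ) (α β : Fin (mw + 1)) :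
    SmoothScalarOn n U (fun z => S.nuTensor σ z α β) := by
  refine smoothScalarOn_of_contDiffAt fun z hz => ?_
  refine contDiffAt_inv_apply (A := fun q => S.muTensor σ (ofChart (n := n) z.1 q))
    (fun i j => (hS.smooth_muTensor i j).contDiffAt hS.isOpen (toChart_mem_chartDom hz)) ?_ α β
  simp only [ofChart_toChart]
  exact hS.det_muTensor_ne_zero hz

theorem Regular.smooth_ghat (hS : S.Regular U σ) (α : Fin (mw + 1)) :
    SmoothVecOn U (S.ghat σ α) :=
  SmoothVecOn.sum hS.isOpen Finset.univ fun β =>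
    (hS.smooth_g β).smul hS.isOpen (hS.smooth_nuTensor α β)

/-- On functions, differentiation is linear over functions in the direction, so `ν` comes out
without derivatives. On vector fields this fails, which is why the autobracket is not a bracket with
`ĝ^α`. -/
theorem Regular.evolScalar_ghat (hS : S.Regular U σ) (α : Fin (mw + 1)) (h : ScalarField M)
    {z : M × ℝ} (hz : z ∈ U) :
    evolScalar (S.ghat σ α) (timeCoeff α) h z =
      ∑ β, S.nuTensor σ z α β * evolScalar (S.g β) (timeCoeff β) h z := by
  have h1 : lieScalar (S.ghat σ α) h z = ∑ β, S.nuTensor σ z α β * lieScalar (S.g β) h z := by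
    simp only [lieScalar, ghat, map_sum, map_smul]
    rfl
  have h2 : ∀ (X : VecField n M) (ε : ℝ), evolScalar X ε h z = lieScalar X h z + ε * dtScalar h z :=
    fun _ _ => rfl
  simp only [h2, h1, mul_add, Finset.sum_add_distrib, ← mul_assoc, ← Finset.sum_mul,
    hS.nuTensor_zero hz]

/-- The separate time term is redistributed over the sum by `Regular.nuTensor_zero`, which gives the
autobracket the same shape as `covAutobracket`. -/
theorem Regular.autobracket_eq (hS : S.Regular U σ) (φ : VecField n M) (α : Fin (mw + 1))
    {z : M × ℝ} (hz : z ∈ U) :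
    S.autobracket σ φ α z =
      ∑ β, S.nuTensor σ z α β • evolVec (S.g β) (timeCoeff β) φ z := by
  have h2 : ∀ (X : VecField n M) (ε : ℝ), evolVec X ε φ z = bracket X φ z + ε • dtVec φ z :=
    fun _ _ => rfl
  simp only [h2, smul_add, Finset.sum_add_distrib, smul_smul, ← Finset.sum_smul,
    hS.nuTensor_zero hz, autobracket]
  by_cases h : α = 0 <;> simp [timeCoeff, h]

theorem Regular.smooth_autobracket (hS : S.Regular U σ) {φ : VecField n M} (hφ : SmoothVecOn U φ)
    (α : Fin (mw + 1)) : SmoothVecOn U (S.autobracket σ φ α) :=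
  (SmoothVecOn.sum hS.isOpen Finset.univ fun β =>
    ((hS.smooth_g β).evolVec hS.isOpen (timeCoeff β) hφ).smul hS.isOpen
      (hS.smooth_nuTensor α β)).congr hS.isOpen fun _ hz => hS.autobracket_eq φ α hz

theorem Regular.smooth_autobracketIter (hS : S.Regular U σ) {φ : VecField n M}
    (hφ : SmoothVecOn U φ) (w : List (Fin (mw + 1))) : SmoothVecOn U (S.autobracketIter σ φ w) := by
  induction w using List.reverseRecOn with
  | nil => exact hφ
  | append_singleton w α ih =>
    rw [autobracketIter_append]
    exact hS.smooth_autobracket ih α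

theorem Regular.autobracket_congr (hS : S.Regular U σ) {φ ψ : VecField n M} (hφ : SmoothVecOn U φ)
    (h : ∀ z ∈ U, ψ z = φ z) (α : Fin (mw + 1)) {z : M × ℝ} (hz : z ∈ U) :
    S.autobracket σ ψ α z = S.autobracket σ φ α z := by
  rw [hS.autobracket_eq φ α hz, hS.autobracket_eq ψ α hz]
  exact Finset.sum_congr rfl fun β _ => by
    rw [evolVec_congr hS.isOpen (hS.smooth_g β) _ hz hφ h]

theorem Regular.autobracket_add (hS : S.Regular U σ) {φ ψ : VecField n M} (hφ : SmoothVecOn U φ)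
    (hψ : SmoothVecOn U ψ) (α : Fin (mw + 1)) {z : M × ℝ} (hz : z ∈ U) :
    S.autobracket σ (φ + ψ) α z = S.autobracket σ φ α z + S.autobracket σ ψ α z := by
  simp only [hS.autobracket_eq _ α hz, ← Finset.sum_add_distrib, ← smul_add]
  exact Finset.sum_congr rfl fun β _ => by
    rw [evolVec_add hS.isOpen (hS.smooth_g β) _ hz hφ hψ]

theorem Regular.autobracket_smul (hS : S.Regular U σ) {c : M × ℝ → ℝ} (hc : SmoothScalarOn n U c)
    {φ : VecField n M} (hφ : SmoothVecOn U φ) (α : Fin (mw + 1)) {z : M × ℝ} (hz : z ∈ U) :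
    S.autobracket σ (fun z => c z • φ z) α z =
      evolScalar (S.ghat σ α) (timeCoeff α) c z • φ z + c z • S.autobracket σ φ α z := by
  simp only [hS.autobracket_eq _ α hz, hS.evolScalar_ghat α c hz, Finset.sum_smul, Finset.smul_sum,
    ← Finset.sum_add_distrib]
  refine Finset.sum_congr rfl fun β _ => ?_
  rw [evolVec_smul hS.isOpen (hS.smooth_g β) _ hc hz hφ, smul_add, smul_smul,
    smul_comm (c z)]

/-- If the autobrackets of smooth generators lie in `D`, so do those of all the members of the
distribution that they generate. -/
theorem Regular.autobracket_mem_of_mem_vecSpan (hS : S.Regular U σ) (α : Fin (mw + 1))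
    {A : Set (VecField n M)} (hA : ∀ X ∈ A, SmoothVecOn U X) {D : Dist n U}
    (hAD : vecSpan U A ≤ D) (hD : ∀ X ∈ A, S.autobracket σ X α ∈ D) {X : VecField n M}
    (hX : X ∈ vecSpan U A) : SmoothVecOn U X ∧ S.autobracket σ X α ∈ D := by
  have hnull : vecSpan U ∅ ≤ D := (vecSpan_mono (empty_subset A)).trans hAD
  have h0 : ∀ z ∈ U, S.autobracket σ (0 : VecField n M) α z = 0 := fun z hz => by
    -- Additivity applied to 0 + 0 = 0.
    have h := hS.autobracket_add (smoothVecOn_zero (n := n) (U := U)) smoothVecOn_zero α hz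
    rw [add_zero] at h
    exact left_eq_add.1 h
  refine Submodule.span_induction (p := fun X _ => SmoothVecOn U X ∧ S.autobracket σ X α ∈ D)
    ?_ ?_ ?_ ?_ hX
  · rintro Y (hY | hY)
    · exact ⟨hA Y hY, hD Y hY⟩
    · refine ⟨smoothVecOn_zero.congr hS.isOpen hY, vec_mem_of_eqOn hnull D.zero_mem fun z hz => ?_⟩
      rw [hS.autobracket_congr smoothVecOn_zero hY α hz, h0 z hz]; rfl
  · exact ⟨smoothVecOn_zero, vec_mem_of_eqOn hnull D.zero_mem h0⟩
  · intro Y Z _ _ hY hZ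
    exact ⟨hY.1.add hS.isOpen hZ.1, vec_mem_of_eqOn hnull (D.add_mem hY.2 hZ.2)
      fun z hz => hS.autobracket_add hY.1 hZ.1 α hz⟩
  · intro c Y hYA hY
    exact ⟨hY.1.smul hS.isOpen c.2, vec_mem_of_eqOn hnull
      (D.add_mem (D.smul_mem ⟨_, SmoothScalarOn.evolScalar hS.isOpen (hS.smooth_ghat α)
        (timeCoeff α) c.2⟩ (hAD hYA)) (D.smul_mem c hY.2))
      fun z hz => hS.autobracket_smul c.2 hY.1 α hz⟩

/-- The distribution `Δ_k` is generated by the iterated autobrackets of length at most `k`. -/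
theorem Regular.delta_eq (hS : S.Regular U σ) (k : ℕ) :
    S.Delta U σ k =
      vecSpan U {X | ∃ i w, w.length ≤ k ∧ X = S.autobracketIter σ (S.f i) w} := by
  refine le_antisymm ?_ (vecSpan_le ?_ (null_le_delta k))
  · induction k with
    | zero =>
      refine vecSpan_mono ?_
      rintro _ ⟨i, rfl⟩
      exact ⟨i, [], le_rfl, rfl⟩
    | succ k ih =>
      have hmono : vecSpan U {X | ∃ i w, w.length ≤ k ∧ X = S.autobracketIter σ (S.f i) w} ≤
          vecSpan U {X | ∃ i w, w.length ≤ k + 1 ∧ X = S.autobracketIter σ (S.f i) w} :=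
        vecSpan_mono fun X ⟨i, w, hw, hX⟩ => ⟨i, w, hw.trans (Nat.le_succ k), hX⟩
      refine sup_le (ih.trans hmono) (iSup_le fun β => vecSpan_le ?_ (vecSpan_mono (empty_subset _)))
      rintro _ ⟨v, hv, rfl⟩
      refine (hS.autobracket_mem_of_mem_vecSpan β ?_ hmono ?_ (ih hv)).2
      · rintro _ ⟨i, w, -, rfl⟩
        exact hS.smooth_autobracketIter (hS.smooth_f i) w
      · rintro _ ⟨i, w, hw, rfl⟩
        refine subset_vecSpan _ ⟨i, w ++ [β], by simpa using hw, ?_⟩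
        rw [autobracketIter_append]
  · rintro _ ⟨i, w, hw, rfl⟩
    exact delta_mono hw (autobracketIter_mem_delta i w)

theorem finite_iter {ι α β : Type*} [Finite ι] [Finite α] (F : ι → List α → β) (k : ℕ) :
    {X | ∃ i w, w.length ≤ k ∧ X = F i w}.Finite := by
  have h : ((fun a : ι × List α => F a.1 a.2) '' (univ ×ˢ {w | w.length ≤ k})).Finite :=
    (finite_univ.prod (List.finite_length_le α k)).image _
  refine h.subset ?_
  rintro _ ⟨i, w, hw, rfl⟩
  exact ⟨(i, w), ⟨mem_univ _, hw⟩, rfl⟩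

theorem Regular.vecGenerated_delta (hS : S.Regular U σ) (k : ℕ) : VecGenerated (S.Delta U σ k) :=
  ⟨_, finite_iter (fun i w => S.autobracketIter σ (S.f i) w) k, by
    rintro _ ⟨i, w, -, rfl⟩
    exact hS.smooth_autobracketIter (hS.smooth_f i) w, hS.delta_eq k⟩

theorem Regular.gradGenerated_omegaG (hS : S.Regular U σ) (k : ℕ) :
    GradGenerated (S.OmegaG U σ k) := by
  induction k with
  | zero =>
    refine ⟨range (S.htilde σ), finite_range _, ?_, ?_⟩
    · rintro _ ⟨q, rfl⟩; exact hS.smooth_htilde q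
    · rw [← range_comp]; rfl
  | succ k ih => rw [omegaG_succ]; exact ih.codistStep hS.isOpen hS.smooth_g _

theorem Regular.gradGenerated_obs (hS : S.Regular U σ) (k : ℕ) :
    GradGenerated (S.Obs U σ k) := by
  induction k with
  | zero =>
    refine ⟨{h | ∃ (a : Fin mw × Fin mu) (l : List (Fin (mw + 1))),
      l.length ≤ S.sIndex U σ + S.rIndex U σ ∧
        h = lieScalar (S.autobracketIter σ (S.f a.2) l) (S.htilde σ a.1)} ∪ range S.h,
      (finite_iter _ _).union (finite_range _), ?_, ?_⟩
    · rintro _ (⟨a, l, -, rfl⟩ | ⟨j, rfl⟩)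
      · have := (hS.smooth_htilde a.1).evolScalar hS.isOpen
          (hS.smooth_autobracketIter (hS.smooth_f a.2) l) 0
        simpa [evolScalar] using this
      · exact hS.smooth_h j
    · rw [image_union, covSpan_union, ← range_comp]
      have e : {θ : CovField n M | ∃ (q : Fin mw) (i : Fin mu) (l : List (Fin (mw + 1))),
          l.length ≤ S.sIndex U σ + S.rIndex U σ ∧
            θ = grad (lieScalar (S.autobracketIter σ (S.f i) l) (S.htilde σ q))} =
          grad '' {h | ∃ (a : Fin mw × Fin mu) (l : List (Fin (mw + 1))),
            l.length ≤ S.sIndex U σ + S.rIndex U σ ∧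
              h = lieScalar (S.autobracketIter σ (S.f a.2) l) (S.htilde σ a.1)} := by
        ext θ
        constructor
        · rintro ⟨q, i, l, hl, rfl⟩
          exact ⟨_, ⟨(q, i), l, hl, rfl⟩, rfl⟩
        · rintro ⟨_, ⟨a, l, hl, rfl⟩, rfl⟩
          exact ⟨a.1, a.2, l, hl, rfl⟩
      rw [← e]
      rfl
  | succ k ih =>
    rw [obs_succ]
    refine ih.codistStep hS.isOpen ?_ _
    rintro (i | α)
    · exact hS.smooth_f i
    · exact hS.smooth_ghat α

end System

/-! ### Differentials of functions obtained by bordering a matrix -/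

section Gradients

open Matrix

variable {n : ℕ} {M : Type*} [TopologicalSpace M] [ChartedSpace (EuclideanSpace ℝ (Fin n)) M]
  {U : Set (M × ℝ)}

/-- The codistribution spanned by the differentials of all the smooth functions. -/
def gradModule (n : ℕ) {M : Type*} [TopologicalSpace M]
    [ChartedSpace (EuclideanSpace ℝ (Fin n)) M] (U : Set (M × ℝ)) : Codist n U :=
  covSpan U (grad '' {h | SmoothScalarOn n U h})

theorem null_le_gradModule : covSpan U ∅ ≤ gradModule (n := n) U := covSpan_mono (empty_subset _)

theorem grad_mem_gradModule {h : ScalarField M} (hh : SmoothScalarOn n U h) :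
    grad h ∈ gradModule n U := subset_covSpan _ ⟨h, hh, rfl⟩

theorem covAt_grad_congr {h k : ScalarField M} {z : M × ℝ} (he : h =ᶠ[𝓝 z] k) :
    covAt (n := n) (grad h) z = covAt (grad k) z := by
  have h1 : Tendsto (fun x : M => (x, z.2)) (𝓝 z.1) (𝓝 z) :=
    (Continuous.prodMk_left z.2).continuousAt
  exact Filter.EventuallyEq.mfderiv_eq (I := 𝓡 n) (I' := 𝓘(ℝ, ℝ)) (h1.eventually he)

variable [IsManifold (𝓡 n) ∞ M]

theorem covAt_grad_add (hU : IsOpen U) {h k : ScalarField M} (hh : SmoothScalarOn n U h)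
    (hk : SmoothScalarOn n U k) {z : M × ℝ} (hz : z ∈ U) :
    covAt (n := n) (grad (h + k)) z = covAt (grad h) z + covAt (grad k) z := by
  have hp := toChart_mem_chartDom (n := n) hz
  refine eq_of_covRep_eq (n := n) (θ := grad (h + k)) (θ' := grad h + grad k) ?_
  rw [covRep_add, Pi.add_apply, covRep_grad hU (ContMDiffOn.add hh hk) hp, covRep_grad hU hh hp,
    covRep_grad hU hk hp, ← ContinuousLinearMap.add_comp, ← fderiv_add
      ((hh.contDiffAt hU hp).differentiableAt (by simp))
      ((hk.contDiffAt hU hp).differentiableAt (by simp))]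
  rfl

theorem covAt_grad_mul (hU : IsOpen U) {h k : ScalarField M} (hh : SmoothScalarOn n U h)
    (hk : SmoothScalarOn n U k) {z : M × ℝ} (hz : z ∈ U) :
    covAt (n := n) (grad (h * k)) z = h z • covAt (grad k) z + k z • covAt (grad h) z := by
  have hp := toChart_mem_chartDom (n := n) hz
  refine eq_of_covRep_eq (n := n) (θ := grad (h * k))
    (θ' := (fun z => h z • grad k z) + (fun z => k z • grad h z)) ?_
  rw [covRep_add, Pi.add_apply, covRep_smul, covRep_smul,
    covRep_grad hU (ContMDiffOn.mul hh hk) hp]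
  simp only []
  rw [covRep_grad hU hh hp, covRep_grad hU hk hp]
  have := fderiv_mul ((hh.contDiffAt (n := n) hU hp).differentiableAt (by simp))
    ((hk.contDiffAt hU hp).differentiableAt (by simp))
  have e : (h * k) ∘ ofChart (n := n) z.1 = (h ∘ ofChart (n := n) z.1) * (k ∘ ofChart (n := n) z.1) :=
    rfl
  rw [e, this]
  rfl

theorem covAt_grad_const (hU : IsOpen U) (c : ℝ) {z : M × ℝ} (hz : z ∈ U) :
    covAt (n := n) (grad fun _ : M × ℝ => c) z = 0 := by
  have hp := toChart_mem_chartDom (n := n) hz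
  refine eq_of_covRep_eq (n := n) (θ := grad fun _ => c) (θ' := 0) ?_
  rw [covRep_grad hU contMDiffOn_const hp]
  have e : (fun _ : M × ℝ => c) ∘ ofChart (n := n) z.1 = fun _ => c := rfl
  rw [e, fderiv_fun_const]
  rfl

/-- The smooth functions whose differential at `z` lies in a given space. -/
def gradAlgebra (hU : IsOpen U) {z : M × ℝ} (hz : z ∈ U)
    (V : Submodule ℝ (EuclideanSpace ℝ (Fin n) →L[ℝ] ℝ)) : Subalgebra ℝ (M × ℝ → ℝ) where
  carrier := {h | SmoothScalarOn n U h ∧ covAt (grad h) z ∈ V}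
  mul_mem' := by
    rintro h k ⟨hh, hh'⟩ ⟨hk, hk'⟩
    refine ⟨ContMDiffOn.mul hh hk, ?_⟩
    rw [covAt_grad_mul hU hh hk hz]
    exact V.add_mem (V.smul_mem _ hk') (V.smul_mem _ hh')
  add_mem' := by
    rintro h k ⟨hh, hh'⟩ ⟨hk, hk'⟩
    refine ⟨ContMDiffOn.add hh hk, ?_⟩
    rw [covAt_grad_add hU hh hk hz]
    exact V.add_mem hh' hk'
  algebraMap_mem' c := by
    refine ⟨contMDiffOn_const (c := c), ?_⟩
    have := covAt_grad_const (n := n) hU c hz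
    rw [show (algebraMap ℝ (M × ℝ → ℝ) c) = fun _ => c from rfl, this]
    exact V.zero_mem

/-- Let a smooth function `Q` be the entry added to the matrix `P` when it is bordered, without
increasing its rank, by the row `R` and the column `C`. Then the differential of `Q` lies, at the
points of a dense set, in any codistribution that contains those of the entries of `P`, `R`, `C`. -/
theorem frequently_covAt_grad_mem (hU : IsOpen U) {I J : Type*} [Finite I] [Finite J]
    {P : I → J → ScalarField M} {R : J → ScalarField M} {C : I → ScalarField M}
    {Q : ScalarField M} (W : Codist n U)
    (hP : ∀ i j, SmoothScalarOn n U (P i j) ∧ grad (P i j) ∈ W)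
    (hR : ∀ j, SmoothScalarOn n U (R j) ∧ grad (R j) ∈ W)
    (hC : ∀ i, SmoothScalarOn n U (C i) ∧ grad (C i) ∈ W) (hQ : SmoothScalarOn n U Q)
    (hlin : ∀ y ∈ U, ∃ (u : EuclideanSpace ℝ (Fin n)) (θ : EuclideanSpace ℝ (Fin n) →L[ℝ] ℝ)
      (a : I → EuclideanSpace ℝ (Fin n)) (b : J → EuclideanSpace ℝ (Fin n) →L[ℝ] ℝ),
      (∀ i j, P i j y = b j (a i)) ∧ (∀ j, R j y = b j u) ∧ (∀ i, C i y = θ (a i)) ∧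
        Q y = θ u ∧ u ∈ Submodule.span ℝ (range a) ∧ θ ∈ Submodule.span ℝ (range b))
    {z : M × ℝ} (hz : z ∈ U) : ∃ᶠ y in 𝓝 z, covAt (grad Q) y ∈ covFiber W y := by
  classical
  have := Fintype.ofFinite I
  have := Fintype.ofFinite J
  rw [frequently_iff]
  intro V₀ hV₀
  obtain ⟨V, hV, hVo, hzV⟩ := mem_nhds_iff.1 (inter_mem hV₀ (hU.mem_nhds hz))
  have hcont : ContinuousOn (fun y => (Matrix.of fun i j => P i j y : Matrix I J ℝ)) V := by
    refine continuousOn_pi.2 fun i => continuousOn_pi.2 fun j => ?_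
    exact (ContMDiffOn.continuousOn (hP i j).1).mono fun y hy => (hV hy).2
  -- The rank of `P` need not be constant, so the point `y` is chosen near `z` where it is locally
  -- maximal; this is why the conclusion holds only frequently.
  obtain ⟨y, hyV, d, L, N, hdet, hev⟩ := exists_eventually_det_smul_eq hVo ⟨z, hzV⟩ hcont
  refine ⟨y, (hV hyV).1, ?_⟩
  have hyU := (hV hyV).2
  -- Computing determinants and adjugates over the algebra `A` makes their differentials at `y` lie
  -- in the fibre without writing any of them out; `ev w` recovers the values.
  let A := gradAlgebra hU hyU (covFiber W y)
  have hmemA : ∀ h, SmoothScalarOn n U h ∧ grad h ∈ W → h ∈ A := fun h hh =>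
    ⟨hh.1, covAt_mem_covFiber hh.2 y⟩
  let P' : Matrix I J A := Matrix.of fun i j => ⟨P i j, hmemA _ (hP i j)⟩
  let R' : J → A := fun j => ⟨R j, hmemA _ (hR j)⟩
  let C' : I → A := fun i => ⟨C i, hmemA _ (hC i)⟩
  let L' : Matrix (Fin d) I A := L.map (algebraMap ℝ A)
  let N' : Matrix J (Fin d) A := N.map (algebraMap ℝ A)
  let D : A := (L' * P' * N').det
  -- T = (R N) adj(L P N) (L C) is the numerator of `Q`, and D = det(L P N) its denominator.
  let T : A := (R' ᵥ* N') ⬝ᵥ ((L' * P' * N').adjugate *ᵥ (L' *ᵥ C'))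
  let ev : M × ℝ → A →+* ℝ := fun w => (Pi.evalRingHom (fun _ : M × ℝ => ℝ) w).comp A.val.toRingHom
  have hL' : ∀ w, L'.map (ev w) = L := fun w => by ext; rfl
  have hN' : ∀ w, N'.map (ev w) = N := fun w => by ext; rfl
  have hP' : ∀ w, P'.map (ev w) = Matrix.of fun i j => P i j w := fun w => by ext; rfl
  have hM : ∀ w, (L' * P' * N').map (ev w) = L * (Matrix.of fun i j => P i j w) * N := fun w => by
    rw [Matrix.map_mul, Matrix.map_mul, hL', hN', hP']
  have hD : ∀ w, D.1 w = (L * (Matrix.of fun i j => P i j w) * N).det := fun w => by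
    rw [← hM w]
    exact RingHom.map_det (ev w) _
  have hTw : ∀ w, T.1 w = ((fun j => R j w) ᵥ* N) ⬝ᵥ
      ((L * (Matrix.of fun i j => P i j w) * N).adjugate *ᵥ (L *ᵥ fun i => C i w)) := fun w => by
    change ev w T = _
    have h1 : ∀ k, ev w ((R' ᵥ* N') k) = ((fun j => R j w) ᵥ* N) k := fun k => by
      rw [RingHom.map_vecMul, hN']; rfl
    have h2 : ∀ k, ev w ((L' *ᵥ C') k) = (L *ᵥ fun i => C i w) k := fun k => by
      rw [RingHom.map_mulVec, hL']; rfl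
    have h3 : (L' * P' * N').adjugate.map (ev w) =
        (L * (Matrix.of fun i j => P i j w) * N).adjugate := by
      rw [← hM w]; exact RingHom.map_adjugate (ev w) _
    simp only [T]
    rw [RingHom.map_dotProduct]
    congr 1
    · funext k; exact h1 k
    · funext k
      change ev w _ = _
      rw [RingHom.map_mulVec, h3]
      congr 1
      funext k; exact h2 k
  -- With R = c P, C = P e and Q = c P e, this is the identity det(LPN) P = P N adj(LPN) L P between
  -- `c` and `e`.
  have hDQ : D.1 * Q =ᶠ[𝓝 y] T.1 := by
    filter_upwards [hev, hVo.mem_nhds hyV] with w hw hwV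
    obtain ⟨u, θ, a, b, hPw, hRw, hCw, hQw, hu, hθ⟩ := hlin w (hV hwV).2
    obtain ⟨c, rfl⟩ := (Submodule.mem_span_range_iff_exists_fun ℝ).1 hu
    obtain ⟨e, rfl⟩ := (Submodule.mem_span_range_iff_exists_fun ℝ).1 hθ
    set Pw : Matrix I J ℝ := Matrix.of fun i j => P i j w
    have hR' : (fun j => R j w) = c ᵥ* Pw := by
      funext j
      rw [hRw, map_sum]
      simp [Pw, Matrix.vecMul, dotProduct, hPw]
    have hC' : (fun i => C i w) = Pw *ᵥ e := by
      funext i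
      rw [hCw]
      simp [Pw, Matrix.mulVec, dotProduct, hPw, mul_comm]
    have hQ' : Q w = c ⬝ᵥ (Pw *ᵥ e) := by
      rw [hQw, ← hC', map_sum]
      simp only [dotProduct, hCw, map_smul, smul_eq_mul]
    rw [Pi.mul_apply, hD, hTw, hQ', hR', hC']
    have h1 : (L * Pw * N).det * (c ⬝ᵥ (Pw *ᵥ e)) = c ⬝ᵥ (((L * Pw * N).det • Pw) *ᵥ e) := by
      rw [Matrix.smul_mulVec, dotProduct_smul, smul_eq_mul]
    rw [h1, hw]
    simp only [← Matrix.mulVec_mulVec, Matrix.dotProduct_mulVec, Matrix.vecMul_vecMul]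
    simp only [Matrix.mul_assoc]
    rfl
  have hgrad := covAt_grad_congr (n := n) hDQ
  rw [covAt_grad_mul hU D.2.1 hQ hyU] at hgrad
  have hDy : D.1 y ≠ 0 := by rw [hD]; exact hdet
  -- Differentiating D Q = T gives D ∇Q = ∇T - Q ∇D, and `D` does not vanish at `y`.
  have h1 : D.1 y • covAt (grad Q) y ∈ covFiber W y := by
    have h2 := (covFiber W y).sub_mem T.2.2 ((covFiber W y).smul_mem (Q y) D.2.2)
    rw [← hgrad, add_sub_cancel_right] at h2
    exact h2
  have h2 := (covFiber W y).smul_mem (D.1 y)⁻¹ h1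
  rwa [smul_smul, inv_mul_cancel₀ hDy, one_smul] at h2

theorem mem_gradModule (hU : IsOpen U) {X : VecField n M} (hX : SmoothVecOn U X) (ε : ℝ)
    {θ : CovField n M} (hθ : θ ∈ gradModule n U) :
    (∀ z ∈ U, CovDifferentiableAt θ z) ∧ evolCov X ε θ ∈ gradModule n U := by
  refine evolCov_mem_of_mem_covSpan hU hX ε ?_ le_rfl ?_ hθ
  · rintro _ ⟨h, hh, rfl⟩ z hz
    exact covDifferentiableAt_grad hU hh hz
  · rintro _ ⟨h, hh, rfl⟩
    exact cov_mem_of_eqOn null_le_gradModule (grad_mem_gradModule (hh.evolScalar hU hX ε))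
      fun z hz => evolCov_grad hU hX ε hh hz

/-- On the generators the pairing is a Lie derivative, L_Y h = ⟨∇h, Y⟩, and it is linear over the
smooth functions. -/
theorem smooth_pairing (hU : IsOpen U) {Y : VecField n M} (hY : SmoothVecOn U Y)
    {θ : CovField n M} (hθ : θ ∈ gradModule n U) : SmoothScalarOn n U (pairing θ Y) := by
  refine Submodule.span_induction (p := fun θ _ => SmoothScalarOn n U (pairing θ Y)) ?_ ?_ ?_ ?_ hθ
  · rintro _ (⟨h, hh, rfl⟩ | hη)
    · have := SmoothScalarOn.evolScalar hU hY 0 hh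
      have e : evolScalar Y 0 h = pairing (grad h) Y := by
        simp only [evolScalar, zero_smul, add_zero]; rfl
      rwa [e] at this
    · refine ContMDiffOn.congr (f := fun _ => (0 : ℝ)) contMDiffOn_const fun z hz => ?_
      simp [pairing, hη z hz]
  · exact contMDiffOn_const (c := (0 : ℝ))
  · intro η η' _ _ h h'
    exact ContMDiffOn.add h h'
  · intro c η _ h
    exact ContMDiffOn.mul c.2 h

end Gradients

/-! ### Observability of the pairings of iterated autobrackets -/

namespace System

variable {n mu mw p : ℕ} {M : Type*} [TopologicalSpace M]
  [ChartedSpace (EuclideanSpace ℝ (Fin n)) M] [IsManifold (𝓡 n) ∞ M]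
  {S : System n mu mw p M} {U : Set (M × ℝ)} {σ : Fin mw → Fin p}

theorem Regular.covAutobracket_mem (hS : S.Regular U σ) {W : Codist n U} {θ : CovField n M}
    (h : ∀ β, evolCov (S.g β) (timeCoeff β) θ ∈ W) (α : Fin (mw + 1)) :
    S.covAutobracket σ θ α ∈ W := by
  have e : S.covAutobracket σ θ α = ∑ β, (⟨fun z => S.nuTensor σ z α β,
      hS.smooth_nuTensor α β⟩ : smoothRing n U) • evolCov (S.g β) (timeCoeff β) θ := by
    funext z
    rw [Finset.sum_apply]
    rfl
  rw [e]
  exact W.sum_mem fun β _ => W.smul_mem _ (h β)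

/-- The derivatives along the `g^β` are recovered from the autobrackets. -/
theorem Regular.evolCov_mem (hS : S.Regular U σ) {W : Codist n U} (hnull : covSpan U ∅ ≤ W)
    {θ : CovField n M} (h : ∀ α, S.covAutobracket σ θ α ∈ W) (β : Fin (mw + 1)) :
    evolCov (S.g β) (timeCoeff β) θ ∈ W := by
  refine cov_mem_of_eqOn hnull (W.sum_mem (t := Finset.univ) fun α _ =>
    W.smul_mem (⟨fun z => S.muTensor σ z β α, hS.smooth_muTensor β α⟩ : smoothRing n U) (h α))
    fun z hz => ?_
  rw [Finset.sum_apply]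
  have e : ∀ α, ((⟨fun z => S.muTensor σ z β α, hS.smooth_muTensor β α⟩ : smoothRing n U) •
      S.covAutobracket σ θ α) z = ∑ γ, (S.muTensor σ z β α * S.nuTensor σ z α γ) •
        evolCov (S.g γ) (timeCoeff γ) θ z := fun α => by
    change S.muTensor σ z β α • S.covAutobracket σ θ α z = _
    simp only [covAutobracket, Finset.smul_sum, smul_smul]
  simp only [e]
  rw [Finset.sum_comm]
  have h1 : ∀ γ, ∑ α, S.muTensor σ z β α * S.nuTensor σ z α γ = if β = γ then 1 else 0 := fun γ => by
    rw [← Matrix.mul_apply, hS.mu_mul_nu hz, Matrix.one_apply]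
  simp only [← Finset.sum_smul, h1]
  simp

/-- The coefficients `ν` generally keep the iterated covectors from being differentials, but they
remain combinations of differentials with smooth coefficients. This gives their differentiability
and the smoothness of their pairings. -/
theorem Regular.covIter_mem_gradModule (hS : S.Regular U σ) (q : Fin mw)
    (v : List (Fin (mw + 1))) : S.covIter σ q v ∈ gradModule n U := by
  induction v using List.reverseRecOn with
  | nil => exact grad_mem_gradModule (hS.smooth_htilde q)
  | append_singleton v α ih =>
    rw [covIter_append]
    exact hS.covAutobracket_mem (fun β => (mem_gradModule hS.isOpen (hS.smooth_g β) _ ih).2) α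

theorem Regular.covDifferentiableAt_covIter (hS : S.Regular U σ) (q : Fin mw)
    (v : List (Fin (mw + 1))) {z : M × ℝ} (hz : z ∈ U) :
    CovDifferentiableAt (S.covIter σ q v) z :=
  (mem_gradModule hS.isOpen (hS.smooth_g 0) 0 (hS.covIter_mem_gradModule q v)).1 z hz

theorem Regular.covIter_mem_omegaG (hS : S.Regular U σ) (q : Fin mw) (v : List (Fin (mw + 1))) :
    S.covIter σ q v ∈ S.OmegaG U σ v.length := by
  induction v using List.reverseRecOn with
  | nil => exact subset_covSpan _ ⟨q, rfl⟩
  | append_singleton v α ih =>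
    rw [covIter_append, List.length_append, List.length_singleton, omegaG_succ]
    exact hS.covAutobracket_mem (fun β => evolCov_mem_codistStep S.g timeCoeff β ih) α

/-- The codistribution `Ω^g_k` is generated by the iterated autobrackets of length at most `k`. -/
theorem Regular.omegaG_le (hS : S.Regular U σ) (k : ℕ) :
    S.OmegaG U σ k ≤ covSpan U {θ | ∃ q v, v.length ≤ k ∧ θ = S.covIter σ q v} := by
  induction k with
  | zero =>
    refine covSpan_mono ?_
    rintro _ ⟨q, rfl⟩
    exact ⟨q, [], le_rfl, rfl⟩
  | succ k ih =>
    have hmono : covSpan U {θ | ∃ q v, v.length ≤ k ∧ θ = S.covIter σ q v} ≤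
        covSpan U {θ | ∃ q v, v.length ≤ k + 1 ∧ θ = S.covIter σ q v} :=
      covSpan_mono fun X ⟨i, w, hw, hX⟩ => ⟨i, w, hw.trans (Nat.le_succ k), hX⟩
    rw [omegaG_succ]
    refine codistStep_le (covSpan_mono (empty_subset _)) (ih.trans hmono) fun β θ hθ => ?_
    refine (evolCov_mem_of_mem_covSpan hS.isOpen (hS.smooth_g β) _ ?_ hmono ?_ (ih hθ)).2
    · rintro _ ⟨q, v, -, rfl⟩ z hz
      exact hS.covDifferentiableAt_covIter q v hz
    · rintro _ ⟨q, v, hv, rfl⟩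
      refine hS.evolCov_mem (covSpan_mono (empty_subset _)) (fun α => ?_) β
      refine subset_covSpan _ ⟨q, v ++ [α], by simpa using hv, ?_⟩
      rw [covIter_append]

theorem Regular.smooth_pairIter (hS : S.Regular U σ) (i : Fin mu) (w : List (Fin (mw + 1)))
    (q : Fin mw) (v : List (Fin (mw + 1))) : SmoothScalarOn n U (S.pairIter σ i w q v) :=
  smooth_pairing hS.isOpen (hS.smooth_autobracketIter (hS.smooth_f i) w)
    (hS.covIter_mem_gradModule q v)

/-- Differentiation along `ĝ^α` moves a letter into either word. -/
theorem Regular.evolScalar_pairIter (hS : S.Regular U σ) (i : Fin mu) (w : List (Fin (mw + 1)))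
    (q : Fin mw) (v : List (Fin (mw + 1))) (α : Fin (mw + 1)) {z : M × ℝ} (hz : z ∈ U) :
    evolScalar (S.ghat σ α) (timeCoeff α) (S.pairIter σ i w q v) z =
      S.pairIter σ i w q (v ++ [α]) z + S.pairIter σ i (w ++ [α]) q v z := by
  rw [hS.evolScalar_ghat α _ hz]
  have h1 : ∀ β, evolScalar (S.g β) (timeCoeff β) (S.pairIter σ i w q v) z =
      pairing (evolCov (S.g β) (timeCoeff β) (S.covIter σ q v)) (S.autobracketIter σ (S.f i) w) z +
      pairing (S.covIter σ q v) (evolVec (S.g β) (timeCoeff β)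
        (S.autobracketIter σ (S.f i) w)) z := fun β =>
    evolScalar_pairing hS.isOpen (hS.smooth_g β)
      (hS.smooth_autobracketIter (hS.smooth_f i) w) _ (hS.smooth_pairIter i w q v) hz
      (hS.covDifferentiableAt_covIter q v hz)
  simp only [h1, mul_add, Finset.sum_add_distrib]
  congr 1
  · simp only [pairIter, pairing, covIter_append, covAutobracket]
    rw [sum_apply]
    rfl
  · simp only [pairIter, pairing, autobracketIter_append]
    rw [hS.autobracket_eq _ α hz, map_sum]
    simp only [map_smul, smul_eq_mul]

/-- Smooth functions with differential in `W`. -/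
def IsObservable (W : Codist n U) (h : ScalarField M) : Prop :=
  SmoothScalarOn n U h ∧ grad h ∈ W

/-- By invariance of `W` the derivative of ⟨θ_v, X_w⟩ along `ĝ^α` is observable, and it is the sum
of the two pairings in question; each of them is therefore observable if the other is. -/
theorem Regular.pairIter_shift (hS : S.Regular U σ) {W : Codist n U} (hnull : covSpan U ∅ ≤ W)
    (hW : codistStep (Sum.elim S.f (S.ghat σ)) (Sum.elim 0 timeCoeff) W ≤ W) {i : Fin mu}
    {w : List (Fin (mw + 1))} {q : Fin mw} {v : List (Fin (mw + 1))} (α : Fin (mw + 1))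
    (h : IsObservable W (S.pairIter σ i w q v)) :
    IsObservable W (S.pairIter σ i (w ++ [α]) q v) ↔
      IsObservable W (S.pairIter σ i w q (v ++ [α])) := by
  have hD : grad (evolScalar (S.ghat σ α) (timeCoeff α) (S.pairIter σ i w q v)) ∈ W := by
    refine cov_mem_of_eqOn hnull (hW (evolCov_mem_codistStep (Sum.elim S.f (S.ghat σ))
      (Sum.elim 0 timeCoeff) (Sum.inr α) h.2)) fun z hz => ?_
    exact (evolCov_grad hS.isOpen (hS.smooth_ghat α) _ h.1 hz).symm
  have hsum : ∀ z ∈ U, covAt (n := n) (grad (evolScalar (S.ghat σ α) (timeCoeff α)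
      (S.pairIter σ i w q v))) z = covAt (grad (S.pairIter σ i w q (v ++ [α]))) z +
        covAt (grad (S.pairIter σ i (w ++ [α]) q v)) z := fun z hz => by
    rw [← covAt_grad_add hS.isOpen (hS.smooth_pairIter _ _ _ _) (hS.smooth_pairIter _ _ _ _) hz]
    refine covAt_grad_congr ?_
    filter_upwards [hS.isOpen.mem_nhds hz] with y hy
    exact hS.evolScalar_pairIter i w q v α hy
  constructor
  · intro h1
    refine ⟨hS.smooth_pairIter _ _ _ _, cov_mem_of_eqOn hnull (W.sub_mem hD h1.2) fun z hz => ?_⟩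
    exact eq_sub_of_add_eq (hsum z hz).symm
  · intro h1
    refine ⟨hS.smooth_pairIter _ _ _ _, cov_mem_of_eqOn hnull (W.sub_mem hD h1.2) fun z hz => ?_⟩
    exact eq_sub_of_add_eq' (hsum z hz).symm

/-- Stationarity at `r` puts autobrackets of every length in Δ_r, which is generated by those of
length at most `r`. Only the pointwise consequence is used. -/
theorem Regular.autobracketIter_mem_span (hS : S.Regular U σ) {r : ℕ}
    (hr : S.Delta U σ (r + 1) = S.Delta U σ r) (i : Fin mu) (w : List (Fin (mw + 1)))
    {z : M × ℝ} (hz : z ∈ U) :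
    vecAt (S.autobracketIter σ (S.f i) w) z ∈ Submodule.span ℝ (range
      fun a : {a : Fin mu × List (Fin (mw + 1)) // a.2.length ≤ r} =>
        vecAt (S.autobracketIter σ (S.f a.1.1) a.1.2) z) := by
  have h1 : S.autobracketIter σ (S.f i) w ∈ S.Delta U σ r := by
    have h := delta_mono (le_max_left w.length r)
      (autobracketIter_mem_delta (S := S) (U := U) (σ := σ) i w)
    rwa [delta_eq_of_le hr (le_max_right _ _)] at h
  rw [hS.delta_eq r] at h1
  have h2 := vecAt_mem_vecFiber h1 z
  rw [vecFiber_vecSpan _ hz] at h2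
  refine Submodule.span_mono ?_ h2
  rintro _ ⟨_, ⟨i, w, hw, rfl⟩, rfl⟩
  exact ⟨⟨(i, w), hw⟩, rfl⟩

theorem Regular.covIter_mem_span (hS : S.Regular U σ) {s : ℕ}
    (hs : S.OmegaG U σ (s + 1) = S.OmegaG U σ s) (q : Fin mw) (v : List (Fin (mw + 1)))
    {z : M × ℝ} (hz : z ∈ U) :
    covAt (S.covIter σ q v) z ∈ Submodule.span ℝ (range
      fun b : {b : Fin mw × List (Fin (mw + 1)) // b.2.length ≤ s} =>
        covAt (S.covIter σ b.1.1 b.1.2) z) := by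
  have h1 : S.covIter σ q v ∈ S.OmegaG U σ s := by
    have h := omegaG_mono (le_max_left v.length s) (hS.covIter_mem_omegaG q v)
    rwa [omegaG_eq_of_le hs (le_max_right _ _)] at h
  have h2 := covAt_mem_covFiber (hS.omegaG_le s h1) z
  rw [covFiber_covSpan _ hz] at h2
  refine Submodule.span_mono ?_ h2
  rintro _ ⟨_, ⟨q, v, hv, rfl⟩, rfl⟩
  exact ⟨⟨(q, v), hv⟩, rfl⟩

theorem finite_words {ι α : Type*} [Finite ι] [Finite α] (k : ℕ) :
    Finite {a : ι × List α // a.2.length ≤ k} := by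
  have h : (univ ×ˢ {w : List α | w.length ≤ k} : Set (ι × List α)).Finite :=
    finite_univ.prod (List.finite_length_le α k)
  exact (h.subset fun a (ha : a.2.length ≤ k) => ⟨mem_univ _, ha⟩).to_subtype

/-- If the pairings of total order at most `N` are observable, where `r + s + 1 ≤ N`, then so are
those of an autobracket of `f^i` of order `r + 1` and one of `∇h̃_q` of order `N - r`. -/
theorem Regular.pairIter_observable_of_length_eq (hS : S.Regular U σ) {W : Codist n U}
    (hW : GradGenerated W) {d : ℕ} (hd : ∀ z ∈ U, codistDim W z = d) {r s N : ℕ}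
    (hr : S.Delta U σ (r + 1) = S.Delta U σ r) (hs : S.OmegaG U σ (s + 1) = S.OmegaG U σ s)
    (hN : r + s + 1 ≤ N)
    (h : ∀ i w q v, w.length + v.length ≤ N → IsObservable W (S.pairIter σ i w q v))
    {i : Fin mu} {w : List (Fin (mw + 1))} {q : Fin mw} {v : List (Fin (mw + 1))}
    (hw : w.length = r + 1) (hv : v.length + r = N) :
    IsObservable W (S.pairIter σ i w q v) := by
  have hsm := hS.smooth_pairIter i w q v
  have := finite_words (ι := Fin mu) (α := Fin (mw + 1)) r
  have := finite_words (ι := Fin mw) (α := Fin (mw + 1)) s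
  -- Constant dimension serves twice: it extends membership from a dense set to every point, and
  -- then passes from all fibres to the module.
  refine ⟨hsm, hW.grad_mem hS.isOpen hd hsm fun z hz =>
    hW.mem_covFiber_of_frequently hS.isOpen hd hsm hz ?_⟩
  refine frequently_covAt_grad_mem hS.isOpen
    (I := {a : Fin mu × List (Fin (mw + 1)) // a.2.length ≤ r})
    (J := {b : Fin mw × List (Fin (mw + 1)) // b.2.length ≤ s})
    (P := fun a b => S.pairIter σ a.1.1 a.1.2 b.1.1 b.1.2)
    (R := fun b => S.pairIter σ i w b.1.1 b.1.2)
    (C := fun a => S.pairIter σ a.1.1 a.1.2 q v) W ?_ ?_ ?_ hsm ?_ hz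
  -- The total orders are at most r + s for the matrix, r + 1 + s for the row and r + (N - r) = N
  -- for the column: all at most `N`, although the corner has order N + 1.
  · intro a b
    have := a.2
    have := b.2
    exact h _ _ _ _ (by omega)
  · intro b
    have := b.2
    exact h _ _ _ _ (by omega)
  · intro a
    have := a.2
    exact h _ _ _ _ (by omega)
  · intro y hy
    exact ⟨vecAt (S.autobracketIter σ (S.f i) w) y, covAt (S.covIter σ q v) y,
      fun a => vecAt (S.autobracketIter σ (S.f a.1.1) a.1.2) y,
      fun b => covAt (S.covIter σ b.1.1 b.1.2) y, fun _ _ => rfl, fun _ => rfl, fun _ => rfl, rfl,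
      hS.autobracketIter_mem_span hr i w hy, hS.covIter_mem_span hs q v hy⟩

theorem exists_append_of_length_pos {α : Type*} {l : List α} {k : ℕ} (h : l.length = k + 1) :
    ∃ l' a, l = l' ++ [a] ∧ l'.length = k := by
  refine ⟨l.dropLast, l.getLast (by rintro rfl; simp at h), ?_, by simp [h]⟩
  exact (List.dropLast_append_getLast _).symm

/-- All the pairings are observable as soon as those with `∇h̃_q` of order at most `r + s + 1`
are. -/
theorem Regular.pairIter_observable (hS : S.Regular U σ) {W : Codist n U}
    (hW : GradGenerated W) {d : ℕ} (hd : ∀ z ∈ U, codistDim W z = d)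
    (hinv : codistStep (Sum.elim S.f (S.ghat σ)) (Sum.elim 0 timeCoeff) W ≤ W) {r s : ℕ}
    (hr : S.Delta U σ (r + 1) = S.Delta U σ r) (hs : S.OmegaG U σ (s + 1) = S.OmegaG U σ s)
    (h : ∀ i w q, w.length ≤ r + s + 1 → IsObservable W (S.pairIter σ i w q []))
    (i : Fin mu) (w : List (Fin (mw + 1))) (q : Fin mw) (v : List (Fin (mw + 1))) :
    IsObservable W (S.pairIter σ i w q v) := by
  have hnull := hW.null_le
  -- Orders up to r + s + 1: induction on the length of `v`, whose last letter is moved to `w` until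
  -- `v` is empty.
  have base : ∀ (k : ℕ) (i : Fin mu) (w : List (Fin (mw + 1))) (q : Fin mw)
      (v : List (Fin (mw + 1))), v.length = k → w.length + v.length ≤ r + s + 1 →
        IsObservable W (S.pairIter σ i w q v) := by
    intro k
    induction k with
    | zero =>
      intro i w q v hv hlen
      obtain rfl := List.length_eq_zero_iff.1 hv
      exact h i w q (by simpa using hlen)
    | succ k ih =>
      intro i w q v hv hlen
      obtain ⟨v, α, rfl, hv'⟩ := exists_append_of_length_pos hv
      simp only [List.length_append, List.length_singleton] at hlen
      refine (hS.pairIter_shift hnull hinv α (ih i w q v hv' (by omega))).1 ?_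
      exact ih i (w ++ [α]) q v hv'
        (by simp only [List.length_append, List.length_singleton]; omega)
  have main : ∀ N, r + s + 1 ≤ N → ∀ (i : Fin mu) (w : List (Fin (mw + 1))) (q : Fin mw)
      (v : List (Fin (mw + 1))), w.length + v.length ≤ N →
        IsObservable W (S.pairIter σ i w q v) := by
    intro N hN
    induction N, hN using Nat.le_induction with
    | base => exact fun i w q v hlen => base _ i w q v rfl hlen
    | succ N hN ih =>
      -- In order N + 1 the case |w| = r + 1 comes from the bordered matrix. Longer `w` are reduced
      -- to it by moving their last letter to `v`.
      have up : ∀ a, r + 1 ≤ a → ∀ (i : Fin mu) (w : List (Fin (mw + 1))) (q : Fin mw)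
          (v : List (Fin (mw + 1))), w.length = a → w.length + v.length = N + 1 →
            IsObservable W (S.pairIter σ i w q v) := by
        intro a ha
        induction a, ha using Nat.le_induction with
        | base =>
          intro i w q v hw hlen
          exact hS.pairIter_observable_of_length_eq hW hd hr hs hN ih hw (by omega)
        | succ a _ iha =>
          intro i w q v hw hlen
          obtain ⟨w, α, rfl, hw'⟩ := exists_append_of_length_pos hw
          simp only [List.length_append, List.length_singleton] at hlen
          refine (hS.pairIter_shift hnull hinv α (ih i w q v (by omega))).2 ?_
          exact iha i w q (v ++ [α]) hw'
            (by simp only [List.length_append, List.length_singleton]; omega)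
      -- Shorter `w` receive letters from `v` until their length is r + 1; `v` is nonempty because N
      -- + 1 > r + 1.
      have down : ∀ k a, a + k = r + 1 → ∀ (i : Fin mu) (w : List (Fin (mw + 1))) (q : Fin mw)
          (v : List (Fin (mw + 1))), w.length = a → w.length + v.length = N + 1 →
            IsObservable W (S.pairIter σ i w q v) := by
        intro k
        induction k with
        | zero =>
          intro a ha
          exact up a (by omega)
        | succ k ihk =>
          intro a ha i w q v hw hlen
          obtain ⟨v, α, rfl, hv⟩ := exists_append_of_length_pos
            (show v.length = (v.length - 1) + 1 by omega)
          simp only [List.length_append, List.length_singleton] at hlen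
          refine (hS.pairIter_shift hnull hinv α (ih i w q v (by omega))).1 ?_
          exact ihk (a + 1) (by omega) i (w ++ [α]) q v
            (by simp only [List.length_append, List.length_singleton]; omega)
            (by simp only [List.length_append, List.length_singleton]; omega)
      intro i w q v hlen
      rcases Nat.lt_or_ge (w.length + v.length) (N + 1) with hlt | hge
      · exact ih i w q v (by omega)
      · rcases Nat.lt_or_ge w.length (r + 1) with h1 | h1
        · exact down (r + 1 - w.length) w.length (by omega) i w q v rfl (by omega)
        · exact up w.length h1 i w q v rfl (by omega)
  exact main (max (r + s + 1) (w.length + v.length)) (le_max_left _ _) i w q v (le_max_right _ _)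

/-! ### Convergence of the algorithm and comparison of the two recursions -/

theorem Regular.lieCov_grad_htilde (hS : S.Regular U σ) (i : Fin mu) (w : List (Fin (mw + 1)))
    (q : Fin mw) {z : M × ℝ} (hz : z ∈ U) :
    lieCov (S.autobracketIter σ (S.f i) w) (grad (S.htilde σ q)) z =
      grad (lieScalar (S.autobracketIter σ (S.f i) w) (S.htilde σ q)) z := by
  have := evolCov_grad hS.isOpen (hS.smooth_autobracketIter (hS.smooth_f i) w) 0
    (hS.smooth_htilde q) hz
  simpa [evolCov, evolScalar] using this

theorem Regular.exists_omegaG_eq_succ (hS : S.Regular U σ) (hne : U.Nonempty)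
    (hdim : S.ConstantDimensions U σ) : ∃ k, S.OmegaG U σ (k + 1) = S.OmegaG U σ k := by
  obtain ⟨z, hz⟩ := hne
  obtain ⟨k, hk, -⟩ := exists_codist_eq_succ hS.isOpen hz (S.OmegaG U σ) hS.gradGenerated_omegaG
    omegaG_le_succ hdim.omegaG
  exact ⟨k, hk⟩

theorem Regular.sIndex_spec (hS : S.Regular U σ) (hne : U.Nonempty)
    (hdim : S.ConstantDimensions U σ) :
    1 ≤ S.sIndex U σ ∧ S.OmegaG U σ (S.sIndex U σ) = S.OmegaG U σ (S.sIndex U σ - 1) := by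
  obtain ⟨k, hk⟩ := hS.exists_omegaG_eq_succ hne hdim
  exact Nat.sInf_mem (s := {s | 1 ≤ s ∧ S.OmegaG U σ s = S.OmegaG U σ (s - 1)})
    ⟨k + 1, by omega, by simpa using hk⟩

theorem Regular.rIndex_spec (hS : S.Regular U σ) (hne : U.Nonempty)
    (hdim : S.ConstantDimensions U σ) :
    S.Delta U σ (S.rIndex U σ + 1) = S.Delta U σ (S.rIndex U σ) := by
  obtain ⟨z, hz⟩ := hne
  exact Nat.sInf_mem (s := {r | S.Delta U σ (r + 1) = S.Delta U σ r})
    (exists_dist_eq_succ hS.isOpen hz (S.Delta U σ) hS.vecGenerated_delta delta_le_succ hdim.delta)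

/-- The differentials of the `h̃_q` are independent. -/
theorem Regular.le_codistDim_obs_zero (hS : S.Regular U σ) {z : M × ℝ} (hz : z ∈ U) :
    mw ≤ codistDim (S.Obs U σ 0) z := by
  rw [codistDim_eq]
  have hmem : ∀ q, covAt (grad (S.htilde σ q)) z ∈ covFiber (S.Obs U σ 0) z := fun q => by
    have h1 : covSpan U (range fun j => grad (S.h j)) ≤ S.Obs U σ 0 := le_sup_right
    exact covAt_mem_covFiber (h1 (subset_covSpan _ ⟨σ q, rfl⟩)) z
  have hind : LinearIndependent ℝ fun q : Fin mw => covAt (n := n) (grad (S.htilde σ q)) z := by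
    -- Evaluation on the `g^i`, i ≥ 1, sends the differentials of the `h̃_q` to the rows of the
    -- invertible reconstructability matrix.
    let ev : (EuclideanSpace ℝ (Fin n) →L[ℝ] ℝ) →ₗ[ℝ] (Fin mw → ℝ) :=
      { toFun := fun θ i => θ (vecAt (S.g i.succ) z)
        map_add' := fun _ _ => rfl
        map_smul' := fun _ _ => rfl }
    have hrow : LinearIndependent ℝ (S.reconstructabilityMatrix (S.htilde σ) z).row := by
      rw [Matrix.linearIndependent_rows_iff_isUnit, ← Matrix.mulVec_surjective_iff_isUnit]
      change Function.Surjective (S.reconstructabilityMatrix (S.htilde σ) z).mulVecLin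
      rw [← LinearMap.range_eq_top]
      refine Submodule.eq_top_of_finrank_eq ?_
      rw [Module.finrank_fin_fun]
      exact hS.rank_eq z hz
    exact LinearIndependent.of_comp ev hrow
  have hind' : LinearIndependent ℝ fun q : Fin mw =>
      (⟨covAt (grad (S.htilde σ q)) z, hmem q⟩ : covFiber (S.Obs U σ 0) z) :=
    LinearIndependent.of_comp (covFiber (S.Obs U σ 0) z).subtype hind
  simpa using hind'.fintype_card_le_finrank

theorem Regular.exists_obs_eq_succ (hS : S.Regular U σ) (hne : U.Nonempty)
    (hdim : S.ConstantDimensions U σ) :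
    ∃ k, S.Obs U σ (k + 1) = S.Obs U σ k ∧ mw + k ≤ n := by
  obtain ⟨z, hz⟩ := hne
  obtain ⟨k, hk, hkn⟩ := exists_codist_eq_succ hS.isOpen hz (S.Obs U σ) hS.gradGenerated_obs
    obs_le_succ hdim.obs
  have := hS.le_codistDim_obs_zero hz
  exact ⟨k, hk, by omega⟩

theorem Regular.convStep_isLeast (hS : S.Regular U σ) (hne : U.Nonempty)
    (hdim : S.ConstantDimensions U σ) :
    IsLeast {k | 1 ≤ k ∧ S.Obs U σ k = S.Obs U σ (k - 1)} (S.convStep U σ) := by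
  obtain ⟨k, hk, -⟩ := hS.exists_obs_eq_succ hne hdim
  exact ⟨Nat.sInf_mem (s := {k | 1 ≤ k ∧ S.Obs U σ k = S.Obs U σ (k - 1)})
    ⟨k + 1, by omega, by simpa using hk⟩, fun _ hj => Nat.sInf_le hj⟩

theorem Regular.obs_eq_obsLimit (hS : S.Regular U σ) (hne : U.Nonempty)
    (hdim : S.ConstantDimensions U σ) {j : ℕ} (hj : S.convStep U σ - 1 ≤ j) :
    S.Obs U σ j = S.ObsLimit U σ := by
  obtain ⟨⟨h1, h2⟩, -⟩ := hS.convStep_isLeast hne hdim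
  have h3 : S.Obs U σ (S.convStep U σ - 1 + 1) = S.Obs U σ (S.convStep U σ - 1) := by
    rw [Nat.sub_add_cancel h1]; exact h2
  rw [obs_eq_of_le h3 hj, ObsLimit, h2]

/-- A word of length ℓ enters `Omega` at step ℓ + 1, so the initialization, with words of length up
to s + r, is contained in step s + r + 1; after that both recursions apply the same derivations. -/
theorem Regular.obs_le_omega (hS : S.Regular U σ) (k : ℕ) :
    S.Obs U σ k ≤ S.Omega U σ (S.sIndex U σ + S.rIndex U σ + 1 + k) := by
  induction k with
  | zero =>
    refine sup_le (covSpan_le ?_ (null_le_omega _)) (omega_mono (Nat.zero_le _))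
    rintro _ ⟨q, i, l, hl, rfl⟩
    have hmem : lieCov (S.autobracketIter σ (S.f i) l) (grad (S.htilde σ q)) ∈
        S.Omega U σ (l.length + 1) := by
      rw [omega_succ]
      exact le_sup_right (a := codistStep (Sum.elim S.f (S.ghat σ)) (Sum.elim 0 timeCoeff)
        (S.Omega U σ l.length)) (subset_covSpan _ ⟨q, i, l, rfl, rfl⟩)
    refine cov_mem_of_eqOn (null_le_omega _) (omega_mono (by omega) hmem) fun z hz => ?_
    exact (hS.lieCov_grad_htilde i l q hz).symm
  | succ k ih =>
    rw [obs_succ, ← Nat.add_assoc, omega_succ]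
    exact (codistStep_mono _ _ ih).trans le_sup_left

/-- The limit is invariant under the derivations, so only the autobracket terms are at stake. They
are differentials of pairings with empty `v`, observable for words of any length. -/
theorem Regular.omega_le_obsLimit (hS : S.Regular U σ) (hne : U.Nonempty)
    (hdim : S.ConstantDimensions U σ) (k : ℕ) : S.Omega U σ k ≤ S.ObsLimit U σ := by
  have hW : GradGenerated (S.ObsLimit U σ) := hS.gradGenerated_obs _
  obtain ⟨d, hd⟩ := hdim.obs (S.convStep U σ)
  have h0 : S.Obs U σ 0 ≤ S.ObsLimit U σ := obs_mono (Nat.zero_le _)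
  have hinv : codistStep (Sum.elim S.f (S.ghat σ)) (Sum.elim 0 timeCoeff) (S.ObsLimit U σ) ≤
      S.ObsLimit U σ := by
    rw [ObsLimit, ← obs_succ, hS.obs_eq_obsLimit hne hdim (by omega)]
    exact le_rfl
  obtain ⟨hs1, hs2⟩ := hS.sIndex_spec hne hdim
  have hr := hS.rIndex_spec hne hdim
  have hs : S.OmegaG U σ (S.sIndex U σ - 1 + 1) = S.OmegaG U σ (S.sIndex U σ - 1) := by
    rw [Nat.sub_add_cancel hs1]; exact hs2
  -- The chain Ω^g is stationary from s - 1 on, so the lemma is applied with s - 1 and asks for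
  -- words of length at most r + (s - 1) + 1 = s + r, exactly those in `Otilde`.
  have hobs := hS.pairIter_observable hW hd hinv hr hs (fun i w q hlen => by
    refine ⟨hS.smooth_pairIter i w q [], ?_⟩
    have h1 : S.Otilde U σ ≤ S.Obs U σ 0 := le_sup_left
    exact h0 (h1 (subset_covSpan _ ⟨q, i, w, by omega, rfl⟩)))
  induction k with
  | zero =>
    have h1 : S.Omega U σ 0 ≤ S.Obs U σ 0 := le_sup_right
    exact h1.trans h0
  | succ k ih =>
    rw [omega_succ]
    refine sup_le ((codistStep_mono _ _ ih).trans hinv) (covSpan_le ?_ hW.null_le)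
    rintro _ ⟨q, i, l, -, rfl⟩
    exact cov_mem_of_eqOn hW.null_le (hobs i l q []).2 fun z hz => hS.lieCov_grad_htilde i l q hz

end System

end UnknownInput

end
theorem mainTheorem2 {n mu mw p : ℕ} {M : Type*} [TopologicalSpace M]
    [ChartedSpace (EuclideanSpace ℝ (Fin n)) M] [IsManifold (𝓡 n) ∞ M]
    (S : UnknownInput.System n mu mw p M) (U : Set (M × ℝ)) (hU : IsOpen U) (hne : U.Nonempty)
    (hsmooth : S.SmoothOn U) (hcan : S.InCanonicalFormOn U)
    (σ : Fin mw → Fin p)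
    (hσ : ∀ z ∈ U, (S.reconstructabilityMatrix (S.htilde σ) z).rank = mw)
    (hdim : S.ConstantDimensions U σ) :
    -- the integers `s` and `r` that enter the initialization exist
    (1 ≤ S.sIndex U σ ∧ S.OmegaG U σ (S.sIndex U σ) = S.OmegaG U σ (S.sIndex U σ - 1)) ∧
    S.Delta U σ (S.rIndex U σ + 1) = S.Delta U σ (S.rIndex U σ) ∧
    -- the new algorithm converges at the first `k` with `O_k = O_{k-1}`, and `k ≤ n - mw + 1`
    IsLeast {k | 1 ≤ k ∧ S.Obs U σ k = S.Obs U σ (k - 1)} (S.convStep U σ) ∧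
    S.convStep U σ + mw ≤ n + 1 ∧
    (∀ j, S.convStep U σ - 1 ≤ j → S.Obs U σ j = S.ObsLimit U σ) ∧
    -- comparison with the codistributions `Ω_k`
    (∃ khat, ∀ k, khat ≤ k → S.ObsLimit U σ ≤ S.Omega U σ k) ∧
    (∀ k, S.Omega U σ k ≤ S.ObsLimit U σ) ∧
    S.ObsLimit U σ = ⨆ k, S.Omega U σ k := by

  have hS : S.Regular U σ := ⟨hU, hsmooth, hσ⟩
  have hle : ∀ k, UnknownInput.System.Omega S U σ k ≤ S.ObsLimit U σ :=
    hS.omega_le_obsLimit hne hdim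
  have hge := hS.obs_le_omega (S.convStep U σ)
  have hleast := hS.convStep_isLeast hne hdim
  refine ⟨hS.sIndex_spec hne hdim, hS.rIndex_spec hne hdim, hleast, ?_,
    fun j hj => hS.obs_eq_obsLimit hne hdim hj, ⟨_, fun k hk =>
      hge.trans (UnknownInput.System.omega_mono hk)⟩, hle, ?_⟩
  · obtain ⟨k, hk, hkn⟩ := hS.exists_obs_eq_succ hne hdim
    have : S.convStep U σ ≤ k + 1 := hleast.2 ⟨by omega, by simpa using hk⟩
    omega
  · exact le_antisymm (hge.trans (le_iSup (S.Omega U σ) _)) (iSup_le hle)
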